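/- Consider the focusing modified Korteweg--de Vries equation $$\partial_t u+\partial_x^3u=-6u^2\,\partial_x u \qquad\text{(mKdV)}$$ for real-valued $u$ on $\mathbb{R}_t\times\mathbb{R}_x$. A solution means a (global) Schwartz solution: $t\mapsto u(t)$ is a continuous curve in the Schwartz space $\mathcal{S}(\mathbb{R})$ and the equation holds at every $(t,x)\in\mathbb{R}\times\mathbb{R}$. For $1\le p<\infty$, $s\in\mathbb{R}$ and Schwartz $f$, let $$\|f\|_{\mathcal{F}L^p_s(\mathbb{R})}=\bigl\|\langle\xi\rangle^s\widehat f(\xi)\bigr\|_{L^p_\xi(\mathbb{R})},\qquad \widehat f(\xi)=\tfrac1{\sqrt{2\pi}}\int_{\mathbb{R}}e^{-ix\xi}f(x)\,dx,\qquad \langle\xi\rangle=(1+\xi^2)^{1/2}.$$ For every integer $N\ge1$ and every real $\lambda\ge N$ there is exactly one solution $u_{N,\lambda}$ of (mKdV) with initial data $u_{N,\lambda}(0,x)=(-1)^N N\lambda^{-1}\operatorname{sech}(x/\lambda)$, and the following hold. 1. For all $1\le p<\infty$ and $s\in\mathbb{R}$ there are constants $c,C>0$ depending only on $p$ and $s$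 such that, for all integers $N\ge1$ and all real $\lambda\ge N$, $$c\,N\lambda^{-\frac1p}\le\|u_{N,\lambda}(0)\|_{\mathcal{F}L^p_s(\mathbb{R})}\le C\,N\lambda^{-\frac1p}.$$ 2. For each $2<p<\infty$ there is $\alpha=\alpha(p)>0$ such that for every $s\in\mathbb{R}$ there is $C>0$, depending only on $p$ and $s$, with the following property: for all integers $N\ge1$ and all real $\lambda\ge N$ there is a time $t_*>0$ (which may depend on $p,s,N,\lambda$) with $$\|u_{N,\lambda}(t_*)\|_{\mathcal{F}L^p_s(\mathbb{R})}\le C\,N^{1-\alpha}\lambda^{-\frac1p}.$$ 3. For each $1\le p<2$ there is $\alpha=\alpha(p)>0$ such that for every $s\in\mathbb{R}$ there is $c>0$, depending only on $p$ and $s$, with the following property: for all integers $N\ge1$ and all real $\lambda\ge N$ there is a time $t_*>0$ (which may depend on $p,s,N,\lambda$) with $$\|u_{N,\lambda}(t_*)\|_{\mathcal{F}L^p_s(\mathbb{R})}\ge c\,N^{1+\alpha}\lambda^{-\frac1p}.$$ -/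

import Mathlib

open MeasureTheory
open scoped SchwartzMap ENNReal

noncomputable section

/-- The Fourier transform of a real-valued Schwartz function, with the convention
`(2π)^(-1/2) ∫ e^(-i x ξ) f(x) dx`. -/
def fourierHat (f : 𝓢(ℝ, ℝ)) (ξ : ℝ) : ℂ :=
  ((1 / Real.sqrt (2 * Real.pi) : ℝ) : ℂ) *
    ∫ x : ℝ, Complex.exp (-(Complex.I * (x : ℂ) * (ξ : ℂ))) * ((f x : ℝ) : ℂ)

/-- The Japanese bracket `⟨ξ⟩ = (1 + ξ²)^(1/2)`. -/
def japaneseBracket (ξ : ℝ) : ℝ := Real.sqrt (1 + ξ ^ 2)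

/-- The Fourier--Lebesgue norm `‖⟨ξ⟩^s f̂(ξ)‖_{L^p}` of a Schwartz function, as an extended
nonnegative real, for a finite exponent `p`. -/
def fourierLebesgueNorm (p s : ℝ) (f : 𝓢(ℝ, ℝ)) : ℝ≥0∞ :=
  eLpNorm (fun ξ : ℝ => ((japaneseBracket ξ ^ s : ℝ) : ℂ) * fourierHat f ξ)
    (ENNReal.ofReal p) volume

/-- `u` is a global real-valued Schwartz solution of the focusing mKdV equation
`∂ₜu + ∂ₓ³u = -6 u² ∂ₓu`: a continuous curve in the Schwartz space which satisfies
the equation at every point `(t, x)` of space-time. -/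
structure IsSchwartzSolutionMKdV (u : ℝ → 𝓢(ℝ, ℝ)) : Prop where
  continuous : Continuous u
  equation : ∀ t x : ℝ,
    HasDerivAt (fun τ : ℝ => u τ x)
      (-iteratedDeriv 3 (fun y : ℝ => u t y) x
        - 6 * (u t x) ^ 2 * deriv (fun y : ℝ => u t y) x) t

/-- `u` is a Schwartz solution of mKdV with initial data `(-1)^N N lam⁻¹ sech(x / lam)`. -/
def IsRescaledSechSolution (N : ℕ) (lam : ℝ) (u : ℝ → 𝓢(ℝ, ℝ)) : Prop :=
  IsSchwartzSolutionMKdV u ∧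
    ∀ x : ℝ, u 0 x = (-1) ^ N * (N : ℝ) * lam⁻¹ * (1 / Real.cosh (x / lam))

end

/-! Up to sign and the scaling λ⁻¹U(t/λ³, x/λ), the data is the reflectionless potential N sech x,
whose evolution is an explicit N-soliton with spectral parameters κ_j = 1, 3, …, 2N-1. Initially its
Fourier transform has height N on frequencies of size O(1). For large t the solution separates into
solitons of speeds κ_j², and the transform becomes a sum of N profiles of height O(1) and width κ_j
≲ N, carrying the phases exp(-iη(κ_j² t + δ_j)). The square of the L² norm is still comparable to Σ
κ_j = N², but the mass is now spread over |η| ≲ N, so the L^p norm has dropped for p > 2 and grown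
for p < 2. Since λ ≥ N, the weight ⟨η/λ⟩^s is harmless at these frequencies.

This spreading is measured by moments (`exists_time_moments`). By Riemann–Lebesgue, only stationary
phases survive in the limit. In the second moment these are the diagonal terms, because the speeds
are distinct. In the fourth moment they are the solutions of κ_j² + κ_l² = κ_k² + κ_n²; a
divisor-type count (`card_resonances_le`) gives O(N^{5/2}) of them, each contributing O(N). The
resulting N^{7/2} beats the trivial N⁴, and interpolation between these moments, with the pointwise
bound O(N) when p > 4, gives all p.

The solitons come from the resolvent of a Cauchy matrix: u = 2 Re Σ_{jk} ((F + iΓ)⁻¹)_{jk} with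
Γ_{jk} = 2/(κ_j + κ_k) and F = diag(e^{-θ_j}). The rank-one relation KΓ + ΓK = 2·`ones` closes the
equations for the moments of the resolvent, and mKdV becomes a polynomial identity
(`potential_mkdv`). In logistic coordinates 1/(1 + e^{-θ_j}) the potential is smooth on the closed
unit cube and reduces to a single sech on each edge (`cubePotential_edge`); this yields both the
Schwartz regularity and the soliton resolution. The norming constants of N sech are verified by
Newton interpolation (`potential_initial`), and uniqueness is an L² energy estimate. -/

set_option linter.unusedSectionVars false

noncomputable section

/-! ### The Cauchy-matrix resolvent and the mKdV equation for its potential -/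

namespace MKdV

open Complex Matrix

attribute [local instance] Matrix.linftyOpNormedAddCommGroup Matrix.linftyOpNormedSpace
  Matrix.linftyOpNormedRing Matrix.linftyOpNormedAlgebra

variable {ι : Type*} [Fintype ι] [DecidableEq ι]

/-- The Cauchy matrix `2 / (κ_j + κ_k)`. -/
def cauchyGram (κ : ι → ℝ) : Matrix ι ι ℝ := Matrix.of fun j k => 2 / (κ j + κ k)

/-- Positive definiteness of the Cauchy matrix, in elementary form. -/
def GramPos (κ : ι → ℝ) : Prop :=
  ∀ a : ι → ℝ, a ≠ 0 → 0 < ∑ j, ∑ k, a j * (2 / (κ j + κ k)) * a k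

/-- The pencil `diag f + i Γ diag s`. -/
def pencil (κ f s : ι → ℝ) : Matrix ι ι ℂ :=
  diagonal (fun j => (f j : ℂ)) +
    I • ((cauchyGram κ).map (fun r => (r : ℂ)) * diagonal (fun j => (s j : ℂ)))

lemma pencil_apply (κ f s : ι → ℝ) (j k : ι) :
    pencil κ f s j k = (if j = k then (f j : ℂ) else 0) + I * ((2 / (κ j + κ k) : ℝ) : ℂ) * s k := by
  simp [pencil, diagonal_apply, cauchyGram, mul_assoc]

lemma pencil_mulVec (κ f s : ι → ℝ) (w : ι → ℂ) (j : ι) :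
    (pencil κ f s *ᵥ w) j = f j * w j + I * ∑ k, ((2 / (κ j + κ k) : ℝ) : ℂ) * (s k * w k) := by
  simp only [mulVec, dotProduct, pencil_apply, add_mul, Finset.sum_add_distrib, ite_mul, zero_mul,
    Finset.sum_ite_eq, Finset.mem_univ, if_true, Finset.mul_sum]
  congr 1
  exact Finset.sum_congr rfl fun k _ => by ring

/-- Pair the real and imaginary parts of the system with the real and imaginary parts of diag s · w:
the f-terms cancel and two values of the positive form Γ add up to zero. Hence diag s · w = 0, then
diag f · w = 0, and f + s > 0 concludes. Since f or s may vanish in some coordinates, this applies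
up to the boundary of the cube. -/
lemma pencil_mulVec_eq_zero {κ f s : ι → ℝ} (hκ : GramPos κ) (hf : ∀ j, 0 ≤ f j)
    (hs : ∀ j, 0 ≤ s j) (hfs : ∀ j, 0 < f j + s j) {w : ι → ℂ} (hw : pencil κ f s *ᵥ w = 0) :
    w = 0 := by
  have hrow : ∀ j, (f j : ℂ) * w j + I * ∑ k, ((2 / (κ j + κ k) : ℝ) : ℂ) * (s k * w k) = 0 := by
    intro j
    rw [← pencil_mulVec, hw]; rfl
  set a : ι → ℝ := fun j => s j * (w j).re with ha
  set b : ι → ℝ := fun j => s j * (w j).im with hb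
  have hre : ∀ j, f j * (w j).re - ∑ k, (2 / (κ j + κ k)) * b k = 0 := by
    intro j
    have := congrArg Complex.re (hrow j)
    simpa [hb, sub_eq_add_neg, -ofReal_div, -ofReal_add] using this
  have him : ∀ j, f j * (w j).im + ∑ k, (2 / (κ j + κ k)) * a k = 0 := by
    intro j
    have := congrArg Complex.im (hrow j)
    simpa [ha, -ofReal_div, -ofReal_add] using this
  have hq : (∑ j, ∑ k, a j * (2 / (κ j + κ k)) * a k) + ∑ j, ∑ k, b j * (2 / (κ j + κ k)) * b k
      = 0 := by
    have h1 : ∀ j, ∑ k, a j * (2 / (κ j + κ k)) * a k = - (f j * (w j).im * a j) := by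
      intro j
      simp only [mul_assoc, ← Finset.mul_sum]
      have := him j
      linear_combination (a j) * this
    have h2 : ∀ j, ∑ k, b j * (2 / (κ j + κ k)) * b k = (f j * (w j).re * b j) := by
      intro j
      simp only [mul_assoc, ← Finset.mul_sum]
      have := hre j
      linear_combination -(b j) * this
    rw [← Finset.sum_add_distrib]
    refine Finset.sum_eq_zero fun j _ => ?_
    rw [h1, h2, ha, hb]; ring
  have hnn : ∀ c : ι → ℝ, 0 ≤ ∑ j, ∑ k, c j * (2 / (κ j + κ k)) * c k := by
    intro c
    by_cases hc : c = 0
    · simp [hc]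
    · exact (hκ c hc).le
  have ha0 : a = 0 := by
    by_contra h
    linarith [hκ a h, hnn b]
  have hb0 : b = 0 := by
    by_contra h
    linarith [hκ b h, hnn a]
  funext j
  have e1 := hre j
  have e2 := him j
  simp only [ha0, hb0, Pi.zero_apply, mul_zero, Finset.sum_const_zero, sub_zero, add_zero] at e1 e2
  have e3 : s j * (w j).re = 0 := congrFun ha0 j
  have e4 : s j * (w j).im = 0 := congrFun hb0 j
  have hne := (hfs j).ne'
  apply Complex.ext
  · have : (f j + s j) * (w j).re = 0 := by linarith
    simpa [hne] using this
  · have : (f j + s j) * (w j).im = 0 := by linarith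
    simpa [hne] using this

lemma pencil_isUnit_det {κ f s : ι → ℝ} (hκ : GramPos κ) (hf : ∀ j, 0 ≤ f j)
    (hs : ∀ j, 0 ≤ s j) (hfs : ∀ j, 0 < f j + s j) : IsUnit (pencil κ f s).det := by
  rw [isUnit_iff_ne_zero]
  intro h
  obtain ⟨w, hw, hw0⟩ := Matrix.exists_mulVec_eq_zero_iff.2 h
  exact hw (pencil_mulVec_eq_zero hκ hf hs hfs hw0)

/-- The resolvent `(F + iΓ)⁻¹`. -/
def resolvent (κ f : ι → ℝ) : Matrix ι ι ℂ := (pencil κ f 1)⁻¹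

/-- The moments `∑ κ_j^m R_{jk} κ_k^n`. -/
def momentMap (κ : ι → ℝ) (m n : ℕ) : Matrix ι ι ℂ →ₗ[ℝ] ℂ where
  toFun R := ∑ j, ∑ k, (κ j : ℂ) ^ m * R j k * (κ k : ℂ) ^ n
  map_add' A B := by
    simp only [Matrix.add_apply, mul_add, add_mul, Finset.sum_add_distrib]
  map_smul' c A := by
    simp only [Matrix.smul_apply, Finset.smul_sum, RingHom.id_apply]
    refine Finset.sum_congr rfl fun j _ => Finset.sum_congr rfl fun k _ => ?_
    rw [Complex.real_smul, Complex.real_smul]; ring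

lemma momentMap_apply (κ : ι → ℝ) (m n : ℕ) (R : Matrix ι ι ℂ) :
    momentMap κ m n R = ∑ j, ∑ k, (κ j : ℂ) ^ m * R j k * (κ k : ℂ) ^ n := rfl

lemma momentMap_smul (κ : ι → ℝ) (m n : ℕ) (c : ℂ) (R : Matrix ι ι ℂ) :
    momentMap κ m n (c • R) = c * momentMap κ m n R := by
  simp only [momentMap_apply, Finset.mul_sum, Matrix.smul_apply, smul_eq_mul]
  refine Finset.sum_congr rfl fun j _ => Finset.sum_congr rfl fun k _ => by ring

/-- The diagonal matrix of the spectral parameters. -/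
def spec (κ : ι → ℝ) : Matrix ι ι ℂ := diagonal (fun j => (κ j : ℂ))

/-- The matrix with all entries equal to one. -/
def ones : Matrix ι ι ℂ := Matrix.of fun _ _ => 1

lemma momentMap_spec_mul (κ : ι → ℝ) (m n a : ℕ) (R : Matrix ι ι ℂ) :
    momentMap κ m n (spec κ ^ a * R) = momentMap κ (m + a) n R := by
  simp only [momentMap_apply, spec, diagonal_pow, diagonal_mul, Pi.pow_apply]
  refine Finset.sum_congr rfl fun j _ => Finset.sum_congr rfl fun k _ => by ring

lemma momentMap_mul_spec (κ : ι → ℝ) (m n a : ℕ) (R : Matrix ι ι ℂ) :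
    momentMap κ m n (R * spec κ ^ a) = momentMap κ m (n + a) R := by
  simp only [momentMap_apply, spec, diagonal_pow, mul_diagonal, Pi.pow_apply]
  refine Finset.sum_congr rfl fun j _ => Finset.sum_congr rfl fun k _ => by ring

lemma momentMap_ones (κ : ι → ℝ) (m n : ℕ) (A B : Matrix ι ι ℂ) :
    momentMap κ m n (A * ones * B) = momentMap κ m 0 A * momentMap κ 0 n B := by
  have h : ∀ j k, (A * ones * B : Matrix ι ι ℂ) j k = (∑ l, A j l) * ∑ l, B l k := by
    intro j k
    simp [Matrix.mul_apply, ones, Finset.sum_mul, Finset.mul_sum]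
  simp only [momentMap_apply, h, pow_zero, one_mul, mul_one]
  rw [Finset.sum_comm (f := fun l k => B l k * (κ k : ℂ) ^ n), Finset.sum_mul_sum]
  refine Finset.sum_congr rfl fun j _ => Finset.sum_congr rfl fun k _ => ?_
  rw [← Finset.mul_sum, ← Finset.sum_mul]; ring

lemma pencil_one (κ f : ι → ℝ) : pencil κ f 1 =
    diagonal (fun j => (f j : ℂ)) + I • (cauchyGram κ).map (fun r => (r : ℂ)) := by
  simp [pencil]

/-- Displacement structure: multiplying an entry 2/(κ_j + κ_k) by κ_j + κ_k leaves a constant, hence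
rank one. Products through `ones` factor into two moments, which is the source of the quadratic
terms below. -/
lemma spec_gram {κ : ι → ℝ} (hκ : ∀ j, 0 < κ j) :
    spec κ * (cauchyGram κ).map (fun r => (r : ℂ)) + (cauchyGram κ).map (fun r => (r : ℂ)) * spec κ
      = (2 : ℂ) • ones := by
  ext j k
  have h : (κ j : ℂ) + κ k ≠ 0 := by
    exact_mod_cast (add_pos (hκ j) (hκ k)).ne'
  simp [spec, ones, cauchyGram, diagonal_mul, mul_diagonal]
  field_simp

lemma pencil_transpose (κ f : ι → ℝ) : (pencil κ f 1)ᵀ = pencil κ f 1 := by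
  ext j k
  simp only [transpose_apply, pencil_apply, add_comm (κ j) (κ k)]
  by_cases h : j = k
  · subst h; simp
  · simp [h, Ne.symm h]

lemma resolvent_transpose (κ f : ι → ℝ) : (resolvent κ f)ᵀ = resolvent κ f := by
  rw [resolvent, transpose_nonsing_inv, pencil_transpose]

lemma momentMap_symm (κ f : ι → ℝ) (m n : ℕ) :
    momentMap κ m n (resolvent κ f) = momentMap κ n m (resolvent κ f) := by
  rw [momentMap_apply, momentMap_apply, Finset.sum_comm]
  refine Finset.sum_congr rfl fun j _ => Finset.sum_congr rfl fun k _ => ?_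
  have : resolvent κ f k j = resolvent κ f j k := by
    conv_lhs => rw [← resolvent_transpose]
    rfl
  rw [this]; ring

section resolvent
variable {κ f : ι → ℝ} (hκ : GramPos κ) (hf : ∀ j, 0 < f j)
include hκ hf

lemma pencil_mul_resolvent : pencil κ f 1 * resolvent κ f = 1 :=
  Matrix.mul_nonsing_inv _ (pencil_isUnit_det hκ (fun j => (hf j).le) (by simp)
    (fun j => by simpa using add_pos (hf j) one_pos))

lemma resolvent_mul_pencil : resolvent κ f * pencil κ f 1 = 1 :=
  Matrix.nonsing_inv_mul _ (pencil_isUnit_det hκ (fun j => (hf j).le) (by simp)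
    (fun j => by simpa using add_pos (hf j) one_pos))

/-- Relation between a resolvent and its complex conjugate. -/
lemma conj_resolvent_relation (hpos : ∀ j, 0 < κ j) :
    spec κ * (resolvent κ f).map (starRingEnd ℂ) = resolvent κ f * spec κ +
      (2 * I) • (resolvent κ f * ones * (resolvent κ f).map (starRingEnd ℂ)) := by
  set R := resolvent κ f
  set Rc := R.map (starRingEnd ℂ)
  set F : Matrix ι ι ℂ := diagonal (fun j => (f j : ℂ))
  set Γ := (cauchyGram κ).map (fun r => (r : ℂ))
  have h1 : R * (F + I • Γ) = 1 := by rw [← pencil_one]; exact resolvent_mul_pencil hκ hf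
  have h2 : (F - I • Γ) * Rc = 1 := by
    have h := congrArg (fun A => A.map (starRingEnd ℂ)) (pencil_mul_resolvent hκ hf)
    simp only [Matrix.map_mul] at h
    rw [pencil_one] at h
    have e : (F + I • Γ).map (starRingEnd ℂ) = F - I • Γ := by
      ext j k
      by_cases hjk : j = k <;> simp [F, Γ, hjk, sub_eq_add_neg]
    rw [e] at h
    rw [h]
    exact Matrix.map_one _ (map_zero _) (map_one _)
  have hK := spec_gram hpos
  have hFK : F * spec κ = spec κ * F := by
    simp [F, spec, mul_comm]
  -- Moving `spec κ` across the pencil conjugates the pencil, up to a rank-one remainder.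
  have h3 : (F + I • Γ) * spec κ = spec κ * (F - I • Γ) + (2 * I) • ones := by
    have : Γ * spec κ = (2 : ℂ) • ones - spec κ * Γ := by rw [← hK]; abel
    rw [add_mul, mul_sub, hFK, smul_mul_assoc, this, mul_smul_comm, smul_sub, smul_smul,
      mul_comm I 2]
    abel
  calc spec κ * Rc = R * (F + I • Γ) * spec κ * Rc := by rw [h1, one_mul]
    _ = R * ((F + I • Γ) * spec κ) * Rc := by rw [mul_assoc R]
    _ = _ := by
      rw [h3, mul_add, add_mul, ← mul_assoc R (spec κ), mul_assoc (R * spec κ), h2, mul_one,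
        mul_smul_comm, smul_mul_assoc]

/-- The moment form of the preceding matrix relation. It makes real parts of moments accessible to
polynomial algebra. -/
lemma conj_moment_relation (hpos : ∀ j, 0 < κ j) (m n : ℕ) :
    starRingEnd ℂ (momentMap κ (m + 1) n (resolvent κ f)) =
      momentMap κ m (n + 1) (resolvent κ f) + 2 * I * (momentMap κ m 0 (resolvent κ f) *
        starRingEnd ℂ (momentMap κ 0 n (resolvent κ f))) := by
  have hc : ∀ (m n : ℕ) (A : Matrix ι ι ℂ), starRingEnd ℂ (momentMap κ m n A) =
      momentMap κ m n (A.map (starRingEnd ℂ)) := by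
    intro m n A
    simp [momentMap_apply]
  have h := congrArg (momentMap κ m n) (conj_resolvent_relation hκ hf hpos)
  have h1 := momentMap_spec_mul κ m n 1 ((resolvent κ f).map (starRingEnd ℂ))
  have h2 := momentMap_mul_spec κ m n 1 (resolvent κ f)
  rw [pow_one] at h1 h2
  rw [map_add, momentMap_smul, momentMap_ones, h1, h2] at h
  rw [hc, hc, h]

end resolvent

/-- The derivative of the resolvent along a flow `f_j' = c κ_j^r f_j`. -/
lemma hasDerivAt_resolvent {κ : ι → ℝ} (hκ : GramPos κ) {f : ℝ → ι → ℝ} {r : ℕ} {c : ℝ} {x : ℝ}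
    (hf : ∀ y j, 0 < f y j)
    (hd : ∀ j, HasDerivAt (fun y => f y j) (c * κ j ^ r * f x j) x) :
    HasDerivAt (fun y => resolvent κ (f y))
      (-(c • (resolvent κ (f x) * (spec κ ^ r * diagonal (fun j => (f x j : ℂ))) *
        resolvent κ (f x)))) x := by
  have hu : IsUnit (pencil κ (f x) 1) := (Matrix.isUnit_iff_isUnit_det _).2
    (pencil_isUnit_det hκ (fun j => (hf x j).le) (by simp)
    (fun j => by simpa using add_pos (hf x j) one_pos))
  obtain ⟨U, hU⟩ := hu
  have hp : HasDerivAt (fun y => pencil κ (f y) 1)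
      (c • (spec κ ^ r * diagonal (fun j => (f x j : ℂ)))) x := by
    have h0 : HasDerivAt (fun y => (diagonal (fun j => (f y j : ℂ)) : Matrix ι ι ℂ))
        (c • (spec κ ^ r * diagonal (fun j => (f x j : ℂ)))) x := by
      refine hasDerivAt_pi.2 fun j => hasDerivAt_pi.2 fun k => ?_
      by_cases hjk : j = k
      · subst hjk
        have := (hd j).ofReal_comp
        simpa [spec, diagonal_pow, mul_assoc] using this
      · simpa [spec, diagonal_pow, hjk] using hasDerivAt_const x (0 : ℂ)
    simp only [pencil_one]
    exact h0.add_const _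
  have h := hasFDerivAt_ringInverse (𝕜 := ℝ) U
  rw [hU] at h
  have h3 := h.comp_hasDerivAt x hp
  have e : (↑U⁻¹ : Matrix ι ι ℂ) = resolvent κ (f x) := by
    rw [resolvent, ← hU, Matrix.coe_units_inv]
  have e2 : (fun y => resolvent κ (f y)) = Ring.inverse ∘ fun y => pencil κ (f y) 1 := by
    funext y
    simp [resolvent, nonsing_inv_eq_ringInverse]
  rw [e2]
  refine h3.congr_deriv ?_
  change -((↑U⁻¹ : Matrix ι ι ℂ) * (c • (spec κ ^ r * diagonal (fun j => (f x j : ℂ)))) *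
    (↑U⁻¹ : Matrix ι ι ℂ)) = _
  rw [e, Matrix.mul_smul, Matrix.smul_mul]

/-- Eliminates F from the derivative of the resolvent. As RF = 1 - iRΓ and FR = 1 - iΓR, the product
R K^r F R can be reduced from either side; adding the two forms produces K^rΓ + ΓK^r, which has low
rank for r = 1 and r = 3. -/
lemma resolvent_flow {κ f : ι → ℝ} (hκ : GramPos κ) (hf : ∀ j, 0 < f j) (r : ℕ) :
    (2 : ℂ) • (resolvent κ f * (spec κ ^ r * diagonal (fun j => (f j : ℂ))) * resolvent κ f) =
      resolvent κ f * spec κ ^ r + spec κ ^ r * resolvent κ f -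
      I • (resolvent κ f * (spec κ ^ r * (cauchyGram κ).map (fun r => (r : ℂ)) +
        (cauchyGram κ).map (fun r => (r : ℂ)) * spec κ ^ r) * resolvent κ f) := by
  have h1 := resolvent_mul_pencil hκ hf
  have h2 := pencil_mul_resolvent hκ hf
  rw [pencil_one] at h1 h2
  set R := resolvent κ f
  set F : Matrix ι ι ℂ := diagonal (fun j => (f j : ℂ)) with hF
  set Γ := (cauchyGram κ).map (fun r => (r : ℂ))
  have h3 : R * F = 1 - I • (R * Γ) := by
    rw [← h1, mul_add, mul_smul_comm]; abel
  have h4 : F * R = 1 - I • (Γ * R) := by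
    rw [← h2, add_mul, smul_mul_assoc]; abel
  have hc : spec κ ^ r * F = F * spec κ ^ r := by
    rw [hF, spec, diagonal_pow, diagonal_mul_diagonal, diagonal_mul_diagonal]
    simp only [mul_comm]
  have e1 : R * (spec κ ^ r * F) * R = R * spec κ ^ r - I • (R * (spec κ ^ r * Γ) * R) := by
    rw [mul_assoc, mul_assoc, h4]
    simp only [mul_sub, mul_one, mul_smul_comm, mul_assoc]
  have e2 : R * (spec κ ^ r * F) * R = spec κ ^ r * R - I • (R * (Γ * spec κ ^ r) * R) := by
    rw [hc, ← mul_assoc R F, h3]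
    simp only [sub_mul, one_mul, smul_mul_assoc, mul_assoc]
  rw [two_smul]
  nth_rewrite 1 [e1]
  rw [e2, mul_add, add_mul, smul_add]
  abel

/-- The factorisation a³ + b³ = (a + b)(a² - ab + b²) cancels the Cauchy denominator. -/
lemma spec_cube_gram {κ : ι → ℝ} (hκ : ∀ j, 0 < κ j) :
    spec κ ^ 3 * (cauchyGram κ).map (fun r => (r : ℂ)) +
      (cauchyGram κ).map (fun r => (r : ℂ)) * spec κ ^ 3
      = (2 : ℂ) • (spec κ ^ 2 * ones - spec κ ^ 1 * ones * spec κ ^ 1 + ones * spec κ ^ 2) := by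
  ext j k
  have h : (κ j : ℂ) + κ k ≠ 0 := by
    exact_mod_cast (add_pos (hκ j) (hκ k)).ne'
  simp [spec, ones, cauchyGram, diagonal_mul, mul_diagonal, diagonal_pow]
  field_simp
  ring

lemma hasDerivAt_momentMap {κ : ι → ℝ} (hκ : GramPos κ) {f : ℝ → ι → ℝ} {r : ℕ} {c : ℝ} {x : ℝ}
    (hf : ∀ y j, 0 < f y j)
    (hd : ∀ j, HasDerivAt (fun y => f y j) (c * κ j ^ r * f x j) x) (m n : ℕ) :
    HasDerivAt (fun y => momentMap κ m n (resolvent κ (f y)))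
      (-(c / 2 : ℂ) * (momentMap κ m (n + r) (resolvent κ (f x)) +
        momentMap κ (m + r) n (resolvent κ (f x)) -
        I * momentMap κ m n (resolvent κ (f x) *
          (spec κ ^ r * (cauchyGram κ).map (fun r => (r : ℂ)) +
        (cauchyGram κ).map (fun r => (r : ℂ)) * spec κ ^ r) * resolvent κ (f x)))) x := by
  have h := (LinearMap.toContinuousLinearMap (momentMap κ m n)).hasFDerivAt.comp_hasDerivAt x
    (hasDerivAt_resolvent hκ hf hd)
  refine h.congr_deriv ?_
  have e := congrArg (momentMap κ m n) (resolvent_flow hκ (hf x) r)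
  rw [map_sub, map_add, momentMap_smul, momentMap_smul, momentMap_spec_mul,
    momentMap_mul_spec] at e
  rw [← e]
  change momentMap κ m n _ = _
  rw [map_neg, LinearMap.map_smul, Complex.real_smul]
  ring

lemma hasDerivAt_momentMap_space {κ : ι → ℝ} (hκ : GramPos κ) (hpos : ∀ j, 0 < κ j)
    {f : ℝ → ι → ℝ} {x : ℝ} (hf : ∀ y j, 0 < f y j)
    (hd : ∀ j, HasDerivAt (fun y => f y j) (-(κ j) * f x j) x) (m n : ℕ) :
    HasDerivAt (fun y => momentMap κ m n (resolvent κ (f y)))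
      ((1 / 2) * (momentMap κ m (n + 1) (resolvent κ (f x)) +
        momentMap κ (m + 1) n (resolvent κ (f x))) -
        I * (momentMap κ m 0 (resolvent κ (f x)) * momentMap κ 0 n (resolvent κ (f x)))) x := by
  have h := hasDerivAt_momentMap (r := 1) (c := -1) hκ hf (fun j => by simpa using hd j) m n
  refine h.congr_deriv ?_
  rw [pow_one, spec_gram hpos, mul_smul_comm, smul_mul_assoc, momentMap_smul, momentMap_ones]
  push_cast
  ring

lemma hasDerivAt_momentMap_time {κ : ι → ℝ} (hκ : GramPos κ) (hpos : ∀ j, 0 < κ j)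
    {f : ℝ → ι → ℝ} {x : ℝ} (hf : ∀ y j, 0 < f y j)
    (hd : ∀ j, HasDerivAt (fun y => f y j) (κ j ^ 3 * f x j) x) (m n : ℕ) :
    HasDerivAt (fun y => momentMap κ m n (resolvent κ (f y)))
      (-(1 / 2) * (momentMap κ m (n + 3) (resolvent κ (f x)) +
        momentMap κ (m + 3) n (resolvent κ (f x))) +
        I * (momentMap κ m 2 (resolvent κ (f x)) * momentMap κ 0 n (resolvent κ (f x)) -
          momentMap κ m 1 (resolvent κ (f x)) * momentMap κ 1 n (resolvent κ (f x)) +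
          momentMap κ m 0 (resolvent κ (f x)) * momentMap κ 2 n (resolvent κ (f x)))) x := by
  have h := hasDerivAt_momentMap (r := 3) (c := 1) hκ hf (fun j => by simpa using hd j) m n
  refine h.congr_deriv ?_
  set R := resolvent κ (f x)
  rw [spec_cube_gram hpos, mul_smul_comm, smul_mul_assoc, momentMap_smul]
  have e1 : R * (spec κ ^ 2 * ones - spec κ ^ 1 * ones * spec κ ^ 1 + ones * spec κ ^ 2) * R
      = (R * spec κ ^ 2) * ones * R - (R * spec κ ^ 1) * ones * (spec κ ^ 1 * R)
        + R * ones * (spec κ ^ 2 * R) := by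
    noncomm_ring
  rw [e1, map_add, map_sub, momentMap_ones, momentMap_ones, momentMap_ones, momentMap_mul_spec,
    momentMap_mul_spec, momentMap_spec_mul, momentMap_spec_mul]
  push_cast
  ring

/-- The real potential attached to the resolvent. -/
def potential (κ f : ι → ℝ) : ℝ := 2 * (momentMap κ 0 0 (resolvent κ f)).re

/-- The exponentials `exp (-θ_j)` of the phases `θ_j = κ_j x - κ_j³ t + β_j`. -/
def expPhase (κ β : ι → ℝ) (t x : ℝ) (j : ι) : ℝ := Real.exp (-(κ j * x - κ j ^ 3 * t + β j))

lemma expPhase_pos (κ β : ι → ℝ) (t x : ℝ) (j : ι) : 0 < expPhase κ β t x j := Real.exp_pos _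

lemma hasDerivAt_expPhase_space (κ β : ι → ℝ) (t x : ℝ) (j : ι) :
    HasDerivAt (fun y => expPhase κ β t y j) (-(κ j) * expPhase κ β t x j) x := by
  have h : HasDerivAt (fun y => -(κ j * y - κ j ^ 3 * t + β j)) (-(κ j)) x := by
    simpa using ((((hasDerivAt_id' x).const_mul (κ j)).sub_const _).add_const (β j)).fun_neg
  simpa [expPhase, mul_comm] using h.exp

lemma hasDerivAt_expPhase_time (κ β : ι → ℝ) (t x : ℝ) (j : ι) :
    HasDerivAt (fun τ => expPhase κ β τ x j) (κ j ^ 3 * expPhase κ β t x j) t := by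
  have h : HasDerivAt (fun τ => -(κ j * x - κ j ^ 3 * τ + β j)) (κ j ^ 3) t := by
    simpa only [neg_neg, mul_one] using
      (((((hasDerivAt_id' t).const_mul (κ j ^ 3)).const_sub (κ j * x))).add_const (β j)).fun_neg
  simpa [expPhase, mul_comm] using h.exp

/-- Here p_n stands for the moment S_{n0}, and each T is the conjugate of the corresponding moment;
the hypotheses are the conjugation relations. With u = p0 + T0 the three groups of terms are u_t,
u_xxx and 6u²u_x, for the phases κx - κ³t + β. -/
lemma mkdv_moment_identity {p0 p1 p2 p3 S11 S12 T0 T1 T2 T3 T11 T12 : ℂ}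
    (h1 : T1 = p1 + 2 * I * (p0 * T0)) (h2 : T2 = S11 + 2 * I * (p1 * T0))
    (h11 : T11 = p2 + 2 * I * (p0 * T1)) (h3 : T3 = S12 + 2 * I * (p2 * T0))
    (h21 : T12 = S12 + 2 * I * (p1 * T1)) (h12 : T12 = p3 + 2 * I * (p0 * T2)) :
    (-p3 + I * (2 * p2 * p0 - p1 ^ 2)) + (-T3 - I * (2 * T2 * T0 - T1 ^ 2)) +
    ((1 / 2 * (S12 - I * p1 ^ 2 + 1 / 2 * (S12 + p3) - I * p2 * p0)
      - 3 * I * ((p1 - I * p0 ^ 2) * p1 + p0 * (1 / 2 * (S11 + p2) - I * p1 * p0))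
      - 6 * p0 ^ 2 * (p1 - I * p0 ^ 2))
    + (1 / 2 * (T12 + I * T1 ^ 2 + 1 / 2 * (T12 + T3) + I * T2 * T0)
      + 3 * I * ((T1 + I * T0 ^ 2) * T1 + T0 * (1 / 2 * (T11 + T2) + I * T1 * T0))
      - 6 * T0 ^ 2 * (T1 + I * T0 ^ 2)))
    + 6 * (p0 + T0) ^ 2 * ((p1 - I * p0 ^ 2) + (T1 + I * T0 ^ 2)) = 0 := by
  -- Two of the relations compute `T12`; equating them expresses p3 through the remaining moments.
  have hp3 : p3 = S12 + 2 * I * p1 * T1 - 2 * I * p0 * T2 := by linear_combination h21 - h12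
  have hI : I ^ 2 = -1 := I_sq
  have hI3 : I ^ 3 = -I := by rw [pow_succ, hI]; ring
  rw [hp3, h21, h3, h11, h2, h1]
  ring_nf
  simp only [hI, hI3]
  ring

lemma hasDerivAt_two_re {A : ℝ → ℂ} {A' : ℂ} {x : ℝ} (h : HasDerivAt A A' x) :
    HasDerivAt (fun y => 2 * (A y).re) (2 * A'.re) x :=
  (Complex.reCLM.hasFDerivAt.comp_hasDerivAt x h).const_mul 2

/-- The potential of the time-dependent resolvent solves mKdV. -/
theorem potential_mkdv {κ : ι → ℝ} (hκ : GramPos κ) (hpos : ∀ j, 0 < κ j) (β : ι → ℝ) (t x : ℝ) :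
    HasDerivAt (fun τ => potential κ (expPhase κ β τ x))
      (-iteratedDeriv 3 (fun y => potential κ (expPhase κ β t y)) x
        - 6 * potential κ (expPhase κ β t x) ^ 2 *
          deriv (fun y => potential κ (expPhase κ β t y)) x) t := by
  set S : ℕ → ℕ → ℝ → ℂ := fun m n y => momentMap κ m n (resolvent κ (expPhase κ β t y)) with hS
  have hd : ∀ m n y, HasDerivAt (S m n)
      ((1 / 2) * (S m (n + 1) y + S (m + 1) n y) - I * (S m 0 y * S 0 n y)) y := fun m n y =>
    hasDerivAt_momentMap_space hκ hpos (fun z j => expPhase_pos κ β t z j)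
      (fun j => hasDerivAt_expPhase_space κ β t y j) m n
  have hsym : ∀ m n y, S m n y = S n m y := fun m n y => momentMap_symm _ _ _ _
  have hconj : ∀ m n y, starRingEnd ℂ (S (m + 1) n y) =
      S m (n + 1) y + 2 * I * (S m 0 y * starRingEnd ℂ (S 0 n y)) := fun m n y =>
    conj_moment_relation hκ (expPhase_pos κ β t y) hpos m n
  have hu : (fun y => potential κ (expPhase κ β t y)) = fun y => 2 * (S 0 0 y).re := rfl
  have d1 : ∀ y, HasDerivAt (S 0 0) (S 1 0 y - I * S 0 0 y ^ 2) y := by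
    intro y
    refine (hd 0 0 y).congr_deriv ?_
    rw [hsym 0 (0 + 1)]; ring_nf
  have d10 : ∀ y, HasDerivAt (S 1 0) (1 / 2 * (S 1 1 y + S 2 0 y) - I * S 1 0 y * S 0 0 y) y := by
    intro y
    refine (hd 1 0 y).congr_deriv ?_
    ring_nf
  have d11 : ∀ y, HasDerivAt (S 1 1) (S 1 2 y - I * S 1 0 y ^ 2) y := by
    intro y
    refine (hd 1 1 y).congr_deriv ?_
    rw [hsym (1 + 1) 1, hsym 0 1]; ring_nf
  have d20 : ∀ y, HasDerivAt (S 2 0) (1 / 2 * (S 1 2 y + S 3 0 y) - I * S 2 0 y * S 0 0 y) y := by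
    intro y
    refine (hd 2 0 y).congr_deriv ?_
    rw [hsym 1 2]; ring_nf
  have d2 : ∀ y, HasDerivAt (fun y => S 1 0 y - I * S 0 0 y ^ 2)
      (1 / 2 * (S 1 1 y + S 2 0 y) - 3 * I * S 0 0 y * S 1 0 y - 2 * S 0 0 y ^ 3) y := by
    intro y
    refine ((d10 y).sub (((d1 y).pow 2).const_mul I)).congr_deriv ?_
    have hI : I ^ 2 = -1 := I_sq
    push_cast
    linear_combination (2 * S 0 0 y ^ 3) * hI
  have d3 : ∀ y, HasDerivAt (fun y => 1 / 2 * (S 1 1 y + S 2 0 y) - 3 * I * S 0 0 y * S 1 0 y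
      - 2 * S 0 0 y ^ 3)
      (1 / 2 * (S 1 2 y - I * S 1 0 y ^ 2 + 1 / 2 * (S 1 2 y + S 3 0 y) - I * S 2 0 y * S 0 0 y)
      - 3 * I * ((S 1 0 y - I * S 0 0 y ^ 2) * S 1 0 y +
        S 0 0 y * (1 / 2 * (S 1 1 y + S 2 0 y) - I * S 1 0 y * S 0 0 y))
      - 6 * S 0 0 y ^ 2 * (S 1 0 y - I * S 0 0 y ^ 2)) y := by
    intro y
    refine (((((d11 y).add (d20 y)).const_mul (1 / 2)).sub
      (((d1 y).const_mul (3 * I)).mul (d10 y))).sub (((d1 y).pow 3).const_mul 2)).congr_deriv ?_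
    push_cast
    ring
  have D1 : deriv (fun y => potential κ (expPhase κ β t y)) =
      fun y => 2 * (S 1 0 y - I * S 0 0 y ^ 2).re := by
    funext y
    rw [hu]
    exact (hasDerivAt_two_re (d1 y)).deriv
  have D2 : deriv (fun y => 2 * (S 1 0 y - I * S 0 0 y ^ 2).re) = fun y =>
      2 * (1 / 2 * (S 1 1 y + S 2 0 y) - 3 * I * S 0 0 y * S 1 0 y - 2 * S 0 0 y ^ 3).re :=
    funext fun y => (hasDerivAt_two_re (d2 y)).deriv
  have D3 : iteratedDeriv 3 (fun y => potential κ (expPhase κ β t y)) x = deriv (fun y =>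
      2 * (1 / 2 * (S 1 1 y + S 2 0 y) - 3 * I * S 0 0 y * S 1 0 y - 2 * S 0 0 y ^ 3).re) x := by
    rw [iteratedDeriv_succ, iteratedDeriv_succ, iteratedDeriv_one, D1, D2]
  rw [(hasDerivAt_two_re (d3 x)).deriv] at D3
  have dt := hasDerivAt_two_re (hasDerivAt_momentMap_time hκ hpos (x := t)
    (f := fun τ => expPhase κ β τ x)
    (fun z j => expPhase_pos κ β z x j) (fun j => hasDerivAt_expPhase_time κ β t x j) 0 0)
  refine dt.congr_deriv ?_
  rw [D3, D1]
  change 2 * (-(1 / 2) * (S 0 3 x + S 3 0 x) + I * (S 0 2 x * S 0 0 x - S 0 1 x * S 1 0 x +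
    S 0 0 x * S 2 0 x)).re = -_ - 6 * (2 * (S 0 0 x).re) ^ 2 * _
  rw [hsym 0 3, hsym 0 2, hsym 0 1]
  have c1 := hconj 0 0 x
  have c2 := hconj 1 0 x
  have c11 := hconj 0 1 x
  have c3 := hconj 2 0 x
  have c21 := hconj 1 1 x
  have c12 := hconj 0 2 x
  simp only [zero_add, Nat.reduceAdd] at c1 c2 c11 c3 c21 c12
  rw [hsym 0 1] at c1 c11
  rw [hsym 0 2] at c11 c12
  rw [hsym 0 3] at c12
  rw [hsym 2 1] at c3 c21
  rw [hsym 0 1] at c21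
  have key := mkdv_moment_identity c1 c2 c11 c3 c21 c12
  -- All real quantities involved are of the form 2 Re z = z + conj z, so the complex identity
  -- suffices.
  have tr : ∀ z1 z2 z3 z4 : ℂ, (z1 + starRingEnd ℂ z1) + (z3 + starRingEnd ℂ z3) +
      6 * (z4 + starRingEnd ℂ z4) ^ 2 * (z2 + starRingEnd ℂ z2) = 0 →
      2 * z1.re = -(2 * z3.re) - 6 * (2 * z4.re) ^ 2 * (2 * z2.re) := by
    intro z1 z2 z3 z4 h
    simp only [add_conj] at h
    have h' : 2 * z1.re + 2 * z3.re + 6 * (2 * z4.re) ^ 2 * (2 * z2.re) = 0 := by exact_mod_cast h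
    linarith
  apply tr
  simp only [map_add, map_sub, map_mul, map_neg, map_pow, map_div₀, map_one, map_ofNat, conj_I]
  linear_combination key

end MKdV

/-! ### Smooth functions of logistic coordinates as Schwartz curves -/

namespace MKdV

open Set Filter Topology
open scoped ContDiff

variable {ι : Type*} [Fintype ι] [DecidableEq ι]

/-- Functions which are smooth at every point of the unit cube. -/
def CubeSmooth (Φ : (ι → ℝ) → ℝ) : Prop := ∀ s ∈ Icc (0 : ι → ℝ) 1, ContDiffAt ℝ ∞ Φ s

/-- The derivative of `Φ` along the logistic field `c_j s_j (1 - s_j)`. -/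
def logisticDeriv (c : ι → ℝ) (Φ : (ι → ℝ) → ℝ) (s : ι → ℝ) : ℝ :=
  fderiv ℝ Φ s (fun j => c j * (s j * (1 - s j)))

lemma CubeSmooth.logisticDeriv {Φ : (ι → ℝ) → ℝ} (h : CubeSmooth Φ) (c : ι → ℝ) :
    CubeSmooth (logisticDeriv c Φ) := by
  intro s hs
  have h1 : ContDiffAt ℝ ∞ (fderiv ℝ Φ) s := (h s hs).fderiv_right (by simp)
  have h2 : ContDiffAt ℝ ∞ (fun s : ι → ℝ => fun j => c j * (s j * (1 - s j))) s := by fun_prop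
  exact h1.clm_apply h2

lemma CubeSmooth.iterate {Φ : (ι → ℝ) → ℝ} (h : CubeSmooth Φ) (c : ι → ℝ) (n : ℕ) :
    CubeSmooth ((MKdV.logisticDeriv c)^[n] Φ) := by
  induction n with
  | zero => exact h
  | succ n ih => rw [Function.iterate_succ_apply']; exact ih.logisticDeriv c

lemma CubeSmooth.lipschitz {Φ : (ι → ℝ) → ℝ} (h : CubeSmooth Φ) :
    ∃ L : ℝ, 0 ≤ L ∧ ∀ s ∈ Icc (0 : ι → ℝ) 1, ∀ s' ∈ Icc (0 : ι → ℝ) 1,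
      |Φ s - Φ s'| ≤ L * ‖s - s'‖ := by
  have hc : IsCompact (Icc (0 : ι → ℝ) 1) := isCompact_Icc
  have hcont : ContinuousOn (fun s => fderiv ℝ Φ s) (Icc (0 : ι → ℝ) 1) := fun s hs =>
    (ContDiffAt.continuousAt (n := ∞)
      ((h s hs).fderiv_right (m := ∞) (by simp))).continuousWithinAt
  obtain ⟨L, hL⟩ := hc.exists_bound_of_continuousOn hcont
  refine ⟨max L 0, le_max_right _ _, fun s hs s' hs' => ?_⟩
  rw [← Real.norm_eq_abs]
  exact (convex_Icc (0 : ι → ℝ) 1).norm_image_sub_le_of_norm_fderiv_le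
    (fun x hx => (h x hx).differentiableAt (by simp))
    (fun x hx => (hL x hx).trans (le_max_left _ _)) hs' hs

/-- Vertices of the cube are equilibria of the logistic field, so derivatives along it vanish there
whatever Φ is. -/
lemma logisticDeriv_zero (c : ι → ℝ) (Φ : (ι → ℝ) → ℝ) : logisticDeriv c Φ 0 = 0 := by
  have : (fun j : ι => c j * ((0 : ι → ℝ) j * (1 - (0 : ι → ℝ) j))) = 0 := by
    funext j; simp
  rw [logisticDeriv, this, map_zero]

lemma logisticDeriv_one (c : ι → ℝ) (Φ : (ι → ℝ) → ℝ) : logisticDeriv c Φ 1 = 0 := by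
  have : (fun j : ι => c j * ((1 : ι → ℝ) j * (1 - (1 : ι → ℝ) j))) = 0 := by
    funext j; simp
  rw [logisticDeriv, this, map_zero]

/-- The logistic coordinates `1 / (1 + e^{-θ_j})` of the phases. -/
def logistic (κ β : ι → ℝ) (t x : ℝ) : ι → ℝ := fun j => (1 + expPhase κ β t x j)⁻¹

lemma logistic_pos (κ β : ι → ℝ) (t x : ℝ) (j : ι) : 0 < logistic κ β t x j :=
  inv_pos.2 (add_pos one_pos (expPhase_pos κ β t x j))

lemma one_sub_logistic (κ β : ι → ℝ) (t x : ℝ) (j : ι) :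
    1 - logistic κ β t x j = expPhase κ β t x j * logistic κ β t x j := by
  have := expPhase_pos κ β t x j
  simp only [logistic]
  field_simp
  ring

lemma logistic_mem (κ β : ι → ℝ) (t x : ℝ) : logistic κ β t x ∈ Icc (0 : ι → ℝ) 1 := by
  refine ⟨fun j => (logistic_pos κ β t x j).le, fun j => ?_⟩
  have h1 := one_sub_logistic κ β t x j
  have h2 := mul_pos (expPhase_pos κ β t x j) (logistic_pos κ β t x j)
  simp only [Pi.one_apply]
  linarith

lemma logistic_le_exp (κ β : ι → ℝ) (t x : ℝ) (j : ι) :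
    logistic κ β t x j ≤ Real.exp (κ j * x - κ j ^ 3 * t + β j) := by
  rw [logistic, expPhase, Real.exp_neg]
  refine inv_le_of_inv_le₀ (Real.exp_pos _) ?_
  linarith

lemma one_sub_logistic_le_exp (κ β : ι → ℝ) (t x : ℝ) (j : ι) :
    1 - logistic κ β t x j ≤ Real.exp (-(κ j * x - κ j ^ 3 * t + β j)) := by
  rw [one_sub_logistic]
  exact mul_le_of_le_one_right (expPhase_pos κ β t x j).le ((logistic_mem κ β t x).2 j)

lemma hasDerivAt_logistic_space (κ β : ι → ℝ) (t x : ℝ) :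
    HasDerivAt (fun y => logistic κ β t y)
      (fun j => κ j * (logistic κ β t x j * (1 - logistic κ β t x j))) x := by
  refine hasDerivAt_pi.2 fun j => ?_
  have hp := expPhase_pos κ β t x j
  refine (((hasDerivAt_expPhase_space κ β t x j).const_add 1).inv (by positivity)).congr_deriv ?_
  rw [one_sub_logistic, logistic]
  field_simp

lemma hasDerivAt_logistic_time (κ β : ι → ℝ) (t x : ℝ) :
    HasDerivAt (fun τ => logistic κ β τ x)
      (fun j => -(κ j ^ 3) * (logistic κ β t x j * (1 - logistic κ β t x j))) t := by
  refine hasDerivAt_pi.2 fun j => ?_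
  have hp := expPhase_pos κ β t x j
  refine (((hasDerivAt_expPhase_time κ β t x j).const_add 1).inv (by positivity)).congr_deriv ?_
  rw [one_sub_logistic, logistic]
  field_simp

section curve
variable {Φ : (ι → ℝ) → ℝ} (h : CubeSmooth Φ) (κ β : ι → ℝ)
include h

omit β in
lemma hasDerivAt_comp_curve {γ : ℝ → ι → ℝ} (hm : ∀ y, γ y ∈ Icc (0 : ι → ℝ) 1)
    (hγ : ∀ y, HasDerivAt γ (fun j => κ j * (γ y j * (1 - γ y j))) y) (x : ℝ) :
    HasDerivAt (fun y => Φ (γ y)) (logisticDeriv κ Φ (γ x)) x :=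
  ((h _ (hm x)).differentiableAt (by simp)).hasFDerivAt.comp_hasDerivAt x (hγ x)

omit β in
lemma iteratedDeriv_comp_curve {γ : ℝ → ι → ℝ} (hm : ∀ y, γ y ∈ Icc (0 : ι → ℝ) 1)
    (hγ : ∀ y, HasDerivAt γ (fun j => κ j * (γ y j * (1 - γ y j))) y) (n : ℕ) :
    iteratedDeriv n (fun y => Φ (γ y)) = fun y => (logisticDeriv κ)^[n] Φ (γ y) := by
  induction n with
  | zero => simp
  | succ n ih =>
    funext y
    rw [iteratedDeriv_succ, ih, Function.iterate_succ_apply']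
    exact (hasDerivAt_comp_curve (h.iterate κ n) κ hm hγ y).deriv

omit β in
lemma contDiff_comp_curve {γ : ℝ → ι → ℝ} (hm : ∀ y, γ y ∈ Icc (0 : ι → ℝ) 1)
    (hγ : ∀ y, HasDerivAt γ (fun j => κ j * (γ y j * (1 - γ y j))) y) :
    ContDiff ℝ ∞ (fun y => Φ (γ y)) := by
  refine contDiff_of_differentiable_iteratedDeriv fun m _ => ?_
  rw [iteratedDeriv_comp_curve h κ hm hγ]
  exact fun y => (hasDerivAt_comp_curve (h.iterate κ m) κ hm hγ y).differentiableAt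

lemma hasDerivAt_comp_logistic_time (t x : ℝ) :
    HasDerivAt (fun τ => Φ (logistic κ β τ x))
      (logisticDeriv (fun j => -(κ j ^ 3)) Φ (logistic κ β t x)) t :=
  ((h _ (logistic_mem κ β t x)).differentiableAt (by simp)).hasFDerivAt.comp_hasDerivAt t
    (hasDerivAt_logistic_time κ β t x)

lemma iteratedDeriv_comp_logistic (n : ℕ) (t : ℝ) :
    iteratedDeriv n (fun y => Φ (logistic κ β t y)) =
      fun y => (logisticDeriv κ)^[n] Φ (logistic κ β t y) :=
  iteratedDeriv_comp_curve h κ (logistic_mem κ β t) (hasDerivAt_logistic_space κ β t) n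

lemma contDiff_comp_logistic (t : ℝ) : ContDiff ℝ ∞ (fun y => Φ (logistic κ β t y)) :=
  contDiff_comp_curve h κ (logistic_mem κ β t) (hasDerivAt_logistic_space κ β t)

/-- All logistic coordinates tend to 0 as x → -∞ and to 1 as x → +∞, at least as fast as e^{-|x|}
because κ_j ≥ 1; the Lipschitz bound transfers this to Φ. The shifts β and the bounded time range
cost only the factor e^M. -/
lemma comp_logistic_decay (hκ : ∀ j, 1 ≤ κ j) (h0 : Φ 0 = 0) (h1 : Φ 1 = 0) (T : ℝ) :
    ∃ C : ℝ, 0 ≤ C ∧ ∀ t x : ℝ, |t| ≤ T → |Φ (logistic κ β t x)| ≤ C * Real.exp (-|x|) := by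
  obtain ⟨L, hL, hLip⟩ := h.lipschitz
  set M : ℝ := ∑ j, (κ j ^ 3 * T + |β j|) with hM
  refine ⟨L * Real.exp M, by positivity, fun t x ht => ?_⟩
  have hT : 0 ≤ T := (abs_nonneg t).trans ht
  have hMj : ∀ j, κ j ^ 3 * |t| + |β j| ≤ M := by
    intro j
    have hk : ∀ j, 0 ≤ κ j ^ 3 := fun j => pow_nonneg (zero_le_one.trans (hκ j)) 3
    calc κ j ^ 3 * |t| + |β j| ≤ κ j ^ 3 * T + |β j| := by
          have := mul_le_mul_of_nonneg_left ht (hk j); linarith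
      _ ≤ M := Finset.single_le_sum (f := fun j => κ j ^ 3 * T + |β j|)
          (fun i _ => by have := mul_nonneg (hk i) hT; positivity) (Finset.mem_univ j)
  have hk3 : ∀ j, |κ j ^ 3 * t| = κ j ^ 3 * |t| := fun j => by
    rw [abs_mul, abs_of_nonneg (pow_nonneg (zero_le_one.trans (hκ j)) 3)]
  have hmem := logistic_mem κ β t x
  rw [mul_assoc, ← Real.exp_add]
  rcases le_total x 0 with hx | hx
  · have hb := hLip _ hmem 0 ⟨le_refl _, zero_le_one⟩
    rw [h0, sub_zero, sub_zero] at hb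
    refine hb.trans (mul_le_mul_of_nonneg_left ?_ hL)
    refine (pi_norm_le_iff_of_nonneg (Real.exp_pos _).le).2 fun j => ?_
    rw [Real.norm_eq_abs, abs_of_pos (logistic_pos κ β t x j)]
    refine (logistic_le_exp κ β t x j).trans (Real.exp_le_exp.2 ?_)
    have e1 := hMj j
    rw [← hk3] at e1
    have e2 := neg_abs_le (κ j ^ 3 * t)
    have e3 := le_abs_self (β j)
    rw [abs_of_nonpos hx]
    nlinarith [hκ j]
  · have hb := hLip _ hmem 1 ⟨zero_le_one, le_refl _⟩
    rw [h1, sub_zero] at hb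
    refine hb.trans (mul_le_mul_of_nonneg_left ?_ hL)
    refine (pi_norm_le_iff_of_nonneg (Real.exp_pos _).le).2 fun j => ?_
    rw [Real.norm_eq_abs, Pi.sub_apply, Pi.one_apply, abs_sub_comm,
      abs_of_nonneg (sub_nonneg.2 (show logistic κ β t x j ≤ 1 from hmem.2 j))]
    refine (one_sub_logistic_le_exp κ β t x j).trans (Real.exp_le_exp.2 ?_)
    have e1 := hMj j
    rw [← hk3] at e1
    have e2 := le_abs_self (κ j ^ 3 * t)
    have e3 := neg_abs_le (β j)
    rw [abs_of_nonneg hx]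
    nlinarith [hκ j]

omit h in
lemma pow_mul_exp_neg_le (k : ℕ) (x : ℝ) : |x| ^ k * Real.exp (-|x|) ≤ k.factorial := by
  have h1 := Real.pow_div_factorial_le_exp |x| (abs_nonneg x) k
  rw [Real.exp_neg, ← div_eq_mul_inv, div_le_iff₀ (Real.exp_pos _)]
  rwa [div_le_iff₀' (by positivity)] at h1

omit h in
lemma iterate_logisticDeriv_vertices (h0 : Φ 0 = 0) (h1 : Φ 1 = 0) (n : ℕ) :
    (logisticDeriv κ)^[n] Φ 0 = 0 ∧ (logisticDeriv κ)^[n] Φ 1 = 0 := by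
  cases n with
  | zero => exact ⟨h0, h1⟩
  | succ n =>
    rw [Function.iterate_succ_apply']
    exact ⟨logisticDeriv_zero _ _, logisticDeriv_one _ _⟩

/-- Space and time derivatives along the flow are again smooth functions on the cube vanishing at 0
and 1, so they decay exponentially, uniformly for bounded times. The mean value inequality in time
then bounds every seminorm of u t - u t₀ by a multiple of |t - t₀|. -/
lemma exists_schwartz_curve (hκ : ∀ j, 1 ≤ κ j) (h0 : Φ 0 = 0) (h1 : Φ 1 = 0) :
    ∃ u : ℝ → 𝓢(ℝ, ℝ), Continuous u ∧ ∀ t x, u t x = Φ (logistic κ β t x) := by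
  have hdec : ∀ (t : ℝ) (k n : ℕ), ∃ C : ℝ, ∀ x : ℝ, ‖x‖ ^ k *
      ‖iteratedFDeriv ℝ n (fun y => Φ (logistic κ β t y)) x‖ ≤ C := by
    intro t k n
    have hv := iterate_logisticDeriv_vertices κ h0 h1 n
    obtain ⟨C, hC, hb⟩ := comp_logistic_decay (h.iterate κ n) κ β hκ hv.1 hv.2 |t|
    refine ⟨C * k.factorial, fun x => ?_⟩
    rw [norm_iteratedFDeriv_eq_norm_iteratedDeriv, iteratedDeriv_comp_logistic h,
      Real.norm_eq_abs, Real.norm_eq_abs]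
    calc |x| ^ k * |(logisticDeriv κ)^[n] Φ (logistic κ β t x)|
        ≤ |x| ^ k * (C * Real.exp (-|x|)) :=
          mul_le_mul_of_nonneg_left (hb t x le_rfl) (by positivity)
      _ = C * (|x| ^ k * Real.exp (-|x|)) := by ring
      _ ≤ _ := mul_le_mul_of_nonneg_left (pow_mul_exp_neg_le k x) hC
  let u : ℝ → 𝓢(ℝ, ℝ) := fun t =>
    ⟨fun y => Φ (logistic κ β t y), contDiff_comp_logistic h κ β t, hdec t⟩
  have hu : ∀ t x, u t x = Φ (logistic κ β t x) := fun t x => rfl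
  refine ⟨u, continuous_iff_continuousAt.2 fun t₀ => ?_, hu⟩
  rw [ContinuousAt, (schwartz_withSeminorms ℝ ℝ ℝ).tendsto_nhds]
  rintro ⟨k, n⟩ ε hε
  change ∀ᶠ t in 𝓝 t₀, SchwartzMap.seminorm ℝ k n (u t - u t₀) < ε
  -- Bounds the time derivative of the n-th space derivative; in time the logistic field has speeds
  -- -κ_j³. The radius |t₀| + 1 covers all times within distance 1 of t₀.
  obtain ⟨C, hC, hb⟩ := comp_logistic_decay ((h.iterate κ n).logisticDeriv (fun j => -(κ j ^ 3)))
    κ β hκ (logisticDeriv_zero _ _) (logisticDeriv_one _ _) (|t₀| + 1)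
  have hsem : ∀ t, |t - t₀| ≤ 1 →
      SchwartzMap.seminorm ℝ k n (u t - u t₀) ≤ (C * k.factorial) * |t - t₀| := by
    intro t ht
    refine SchwartzMap.seminorm_le_bound' ℝ k n _ (by positivity) fun x => ?_
    have e1 : iteratedDeriv n (⇑(u t - u t₀)) x =
        (logisticDeriv κ)^[n] Φ (logistic κ β t x) - (logisticDeriv κ)^[n] Φ (logistic κ β t₀ x) := by
      have e2 : (⇑(u t - u t₀) : ℝ → ℝ) = (fun y => Φ (logistic κ β t y)) -
          fun y => Φ (logistic κ β t₀ y) := by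
        funext y; rfl
      rw [e2, iteratedDeriv_sub
        ((contDiff_comp_logistic h κ β t).contDiffAt.of_le (by exact_mod_cast le_top))
        ((contDiff_comp_logistic h κ β t₀).contDiffAt.of_le (by exact_mod_cast le_top)),
        iteratedDeriv_comp_logistic h, iteratedDeriv_comp_logistic h]
    have e3 : |(logisticDeriv κ)^[n] Φ (logistic κ β t x) -
        (logisticDeriv κ)^[n] Φ (logistic κ β t₀ x)| ≤ C * Real.exp (-|x|) * |t - t₀| := by
      rw [← Real.norm_eq_abs, ← Real.norm_eq_abs]
      refine (convex_Icc (t₀ - 1) (t₀ + 1)).norm_image_sub_le_of_norm_hasDerivWithin_le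
        (f := fun τ => (logisticDeriv κ)^[n] Φ (logistic κ β τ x))
        (fun τ _ => (hasDerivAt_comp_logistic_time (h.iterate κ n) κ β τ x).hasDerivWithinAt)
        (fun τ hτ => ?_) ⟨by linarith, by linarith⟩ ?_
      · rw [Real.norm_eq_abs]
        refine hb τ x ?_
        have h3 : |τ - t₀| ≤ 1 := abs_le.2 ⟨by linarith [hτ.1], by linarith [hτ.2]⟩
        have h4 := abs_add_le (τ - t₀) t₀
        rw [sub_add_cancel] at h4
        linarith
      · have := abs_le.1 ht
        exact ⟨by linarith [this.1], by linarith [this.2]⟩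
    rw [e1, Real.norm_eq_abs]
    calc |x| ^ k * _ ≤ |x| ^ k * (C * Real.exp (-|x|) * |t - t₀|) :=
          mul_le_mul_of_nonneg_left e3 (by positivity)
      _ = C * (|x| ^ k * Real.exp (-|x|)) * |t - t₀| := by ring
      _ ≤ _ := mul_le_mul_of_nonneg_right
          (mul_le_mul_of_nonneg_left (pow_mul_exp_neg_le k x) hC) (abs_nonneg _)
  have hlim : Tendsto (fun t => (C * k.factorial) * |t - t₀|) (𝓝 t₀) (𝓝 0) := by
    have : Continuous fun t => (C * k.factorial) * |t - t₀| := by fun_prop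
    simpa using this.tendsto t₀
  filter_upwards [hlim.eventually (gt_mem_nhds hε), Metric.closedBall_mem_nhds t₀ one_pos]
    with t h3 h4
  exact (hsem t (by simpa [Real.dist_eq] using h4)).trans_lt h3

end curve

end MKdV

/-! ### The potential on the closed cube and on its edges -/

namespace MKdV

open Complex Matrix Set
open scoped ContDiff

section cube

attribute [local instance] Matrix.linftyOpNormedAddCommGroup Matrix.linftyOpNormedSpace
  Matrix.linftyOpNormedRing Matrix.linftyOpNormedAlgebra

variable {ι : Type*} [Fintype ι] [DecidableEq ι]

/-- The potential as a function on the unit cube of logistic coordinates. -/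
def cubePotential (κ s : ι → ℝ) : ℝ :=
  2 * (∑ j, ∑ k, (s j : ℂ) * (pencil κ (1 - s) s)⁻¹ j k).re

lemma pencil_cube_isUnit_det {κ : ι → ℝ} (hκ : GramPos κ) {s : ι → ℝ}
    (hs : s ∈ Icc (0 : ι → ℝ) 1) : IsUnit (pencil κ (1 - s) s).det :=
  pencil_isUnit_det hκ (fun j => sub_nonneg.2 (hs.2 j)) hs.1 (fun j => by simp)

lemma contDiff_pencil (κ : ι → ℝ) : ContDiff ℝ ∞ (fun s : ι → ℝ => pencil κ (1 - s) s) := by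
  have h : ∀ j k, ContDiff ℝ ∞ (fun s : ι → ℝ => pencil κ (1 - s) s j k) := by
    intro j k
    simp only [pencil_apply]
    have h1 : ∀ l, ContDiff ℝ ∞ (fun s : ι → ℝ => (s l : ℂ)) := fun l =>
      Complex.ofRealCLM.contDiff.comp (contDiff_apply ℝ ℝ l)
    refine ContDiff.add ?_ (contDiff_const.mul (h1 k))
    by_cases hjk : j = k
    · simp only [hjk, if_true, Pi.sub_apply, Pi.one_apply, ofReal_sub, ofReal_one]
      exact contDiff_const.sub (h1 k)
    · simp only [hjk, if_false]
      exact contDiff_const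
  have h2 : ContDiff ℝ ∞ (fun s : ι → ℝ => (fun j k => pencil κ (1 - s) s j k : ι → ι → ℂ)) :=
    contDiff_pi.2 fun j => contDiff_pi.2 fun k => h j k
  let M : (ι → ι → ℂ) →ₗ[ℝ] Matrix ι ι ℂ := (Matrix.ofLinearEquiv ℝ).toLinearMap
  exact (LinearMap.toContinuousLinearMap M).contDiff.comp h2

/-- Since (1 - s) + s = 1, the pencil stays invertible on the whole closed cube, and matrix
inversion is smooth. -/
lemma cubeSmooth_cubePotential {κ : ι → ℝ} (hκ : GramPos κ) : CubeSmooth (cubePotential κ) := by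
  intro s hs
  obtain ⟨U, hU⟩ := (Matrix.isUnit_iff_isUnit_det _).2 (pencil_cube_isUnit_det hκ hs)
  have h1 : ContDiffAt ℝ ∞ (fun s : ι → ℝ => (pencil κ (1 - s) s)⁻¹) s := by
    simp only [nonsing_inv_eq_ringInverse]
    have h2 := contDiffAt_ringInverse ℝ U (n := ∞)
    rw [hU] at h2
    exact ContDiffAt.comp (f := fun s : ι → ℝ => pencil κ (1 - s) s) s h2
      (contDiff_pencil κ).contDiffAt
  have h2 : ∀ j k, ContDiffAt ℝ ∞ (fun s : ι → ℝ => (pencil κ (1 - s) s)⁻¹ j k) s := fun j k =>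
    (LinearMap.toContinuousLinearMap
      (Matrix.entryLinearMap ℝ ℂ j k)).contDiff.contDiffAt.comp s h1
  refine contDiffAt_const.mul (Complex.reCLM.contDiff.contDiffAt.comp s ?_)
  refine ContDiffAt.sum fun j _ => ContDiffAt.sum fun k _ => ContDiffAt.mul ?_ (h2 j k)
  exact (Complex.ofRealCLM.contDiff.comp (contDiff_apply ℝ ℝ j)).contDiffAt

end cube

section edge

variable {ι : Type*} [Fintype ι] [DecidableEq ι]

/-- For s = 1/(1 + f) one has 1 - s = f s, so the cube pencil is the pencil of the resolvent times
diag s. The cube form remains regular as f tends to 0 or to infinity. -/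
lemma potential_eq_cubePotential {κ f : ι → ℝ} (hf : ∀ j, 0 < f j) :
    potential κ f = cubePotential κ (fun j => (1 + f j)⁻¹) := by
  set s : ι → ℝ := fun j => (1 + f j)⁻¹ with hs
  have hs0 : ∀ j, (s j : ℂ) ≠ 0 := fun j => by
    have : s j ≠ 0 := inv_ne_zero (by linarith [hf j])
    exact_mod_cast this
  have h1 : pencil κ (1 - s) s = pencil κ f 1 * diagonal (fun j => (s j : ℂ)) := by
    have e : ∀ j, (1 - s) j = f j * s j := by
      intro j
      have : 1 + f j ≠ 0 := by linarith [hf j]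
      simp only [hs, Pi.sub_apply, Pi.one_apply]
      field_simp
      ring
    ext j k
    rw [mul_diagonal, pencil_apply, pencil_apply, e]
    by_cases hjk : j = k
    · subst hjk; simp; ring
    · simp [hjk]
  have hd : diagonal (fun j => (s j : ℂ)) * diagonal (fun j => (s j : ℂ)⁻¹) = 1 := by
    rw [diagonal_mul_diagonal, ← diagonal_one]
    congr 1
    funext j
    exact mul_inv_cancel₀ (hs0 j)
  have h2 : (diagonal (fun j => (s j : ℂ)))⁻¹ = diagonal (fun j => (s j : ℂ)⁻¹) :=
    Matrix.inv_eq_right_inv hd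
  rw [potential, cubePotential, momentMap_apply, h1, Matrix.mul_inv_rev, h2]
  congr 2
  refine Finset.sum_congr rfl fun j _ => Finset.sum_congr rfl fun k _ => ?_
  rw [diagonal_mul, resolvent, ← mul_assoc, mul_inv_cancel₀ (hs0 j)]
  simp

lemma potential_expPhase (κ β : ι → ℝ) (t x : ℝ) :
    potential κ (expPhase κ β t x) = cubePotential κ (logistic κ β t x) :=
  potential_eq_cubePotential (expPhase_pos κ β t x)

lemma cubePotential_of_solution {κ : ι → ℝ} (hκ : GramPos κ) {s : ι → ℝ}
    (hs : s ∈ Icc (0 : ι → ℝ) 1) {w : ι → ℂ} (hw : pencil κ (1 - s) s *ᵥ w = 1) :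
    cubePotential κ s = 2 * (∑ j, (s j : ℂ) * w j).re := by
  have h1 : w = (pencil κ (1 - s) s)⁻¹ *ᵥ 1 := by
    rw [← hw, mulVec_mulVec, nonsing_inv_mul _ (pencil_cube_isUnit_det hκ hs), one_mulVec]
  rw [cubePotential, h1]
  congr 2
  refine Finset.sum_congr rfl fun j _ => ?_
  simp [mulVec, dotProduct, Finset.mul_sum]

lemma cubePotential_zero {κ : ι → ℝ} : cubePotential κ 0 = 0 := by
  simp [cubePotential]

/-- Systems with a principal submatrix of the Cauchy matrix are solvable. -/
lemma exists_restricted_solution {κ : ι → ℝ} (hκ : GramPos κ) (Q : Finset ι) (r : ι → ℝ) :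
    ∃ b : ι → ℝ, (∀ k, k ∉ Q → b k = 0) ∧ ∀ k ∈ Q, ∑ l, 2 / (κ k + κ l) * b l = r k := by
  -- With the indicator of Q, the rows in Q contain only iΓ, while the other rows merely determine
  -- entries of w that v removes.
  set v : ι → ℝ := fun k => if k ∈ Q then 1 else 0 with hv
  have hvm : v ∈ Icc (0 : ι → ℝ) 1 := by
    constructor <;> intro k <;> by_cases hk : k ∈ Q <;> simp [hv, hk]
  set w : ι → ℂ := (pencil κ (1 - v) v)⁻¹ *ᵥ (fun k => I * (r k : ℂ)) with hw
  have h1 : pencil κ (1 - v) v *ᵥ w = fun k => I * (r k : ℂ) := by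
    rw [hw, mulVec_mulVec, mul_nonsing_inv _ (pencil_cube_isUnit_det hκ hvm), one_mulVec]
  refine ⟨fun k => v k * (w k).re, fun k hk => by simp [hv, hk], fun k hk => ?_⟩
  have h2 := congrFun h1 k
  rw [pencil_mulVec] at h2
  have h3 := congrArg Complex.im h2
  simpa [hv, hk, -ofReal_div, -ofReal_add] using h3

/-- The point of the edge of the cube in direction `j` whose coordinates in `P` equal one. -/
def edgePoint (P : Finset ι) (j : ι) (σ : ℝ) : ι → ℝ := fun k =>
  if k ∈ P then 1 else if k = j then σ else 0

lemma edgePoint_mem (P : Finset ι) (j : ι) {σ : ℝ} (hσ : σ ∈ Icc (0 : ℝ) 1) :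
    edgePoint P j σ ∈ Icc (0 : ι → ℝ) 1 := by
  obtain ⟨h0, h1⟩ := hσ
  constructor <;> intro k <;> simp only [edgePoint, Pi.zero_apply, Pi.one_apply] <;>
    split_ifs <;> simp [*]

/-- Along an edge of the cube the potential is a one-soliton profile. -/
lemma cubePotential_edge {κ : ι → ℝ} (hκ : GramPos κ) (hpos : ∀ j, 0 < κ j) (P : Finset ι) {j : ι}
    (hj : j ∉ P) : ∃ g : ℝ, 0 < g ∧ ∀ σ ∈ Icc (0 : ℝ) 1, cubePotential κ (edgePoint P j σ) =
      2 * κ j * g * (σ * (1 - σ)) / (σ ^ 2 + g ^ 2 * (1 - σ) ^ 2) := by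
  obtain ⟨a, ha0, ha⟩ := exists_restricted_solution hκ (insert j P) 1
  obtain ⟨b, hb0, hb⟩ := exists_restricted_solution hκ (insert j P) (Pi.single j 1)
  have hjQ : j ∈ insert j P := Finset.mem_insert_self _ _
  -- On `insert j P` the vector Γb is the j-th unit vector, so pairing with it reads off a
  -- coordinate.
  have quad : ∀ c : ι → ℝ, (∀ k, k ∉ insert j P → c k = 0) →
      ∑ k, c k * ∑ l, 2 / (κ k + κ l) * b l = c j := by
    intro c hc
    rw [Finset.sum_eq_single j]
    · rw [hb j hjQ]; simp
    · intro k _ hk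
      by_cases hkQ : k ∈ insert j P
      · rw [hb k hkQ]; simp [hk]
      · rw [hc k hkQ]; simp
    · simp
  set g := b j with hg
  set h := ∑ k, b k with hh
  have hsumA : a j = h := by
    rw [← quad a ha0, hh]
    simp only [Finset.mul_sum]
    rw [Finset.sum_comm]
    refine Finset.sum_congr rfl fun l _ => ?_
    by_cases hl : l ∈ insert j P
    · have := ha l hl
      rw [Pi.one_apply] at this
      calc ∑ k, a k * (2 / (κ k + κ l) * b l) = (∑ k, 2 / (κ l + κ k) * a k) * b l := by
            rw [Finset.sum_mul]
            exact Finset.sum_congr rfl fun k _ => by rw [add_comm (κ l)]; ring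
        _ = b l := by rw [this, one_mul]
    · simp [hb0 l hl]
  have hgpos : 0 < g := by
    have h1 := quad b hb0
    rw [← hg] at h1
    rw [← h1]
    have h2 : b ≠ 0 := by
      intro h0
      have := hb j hjQ
      simp [h0] at this
    have h3 := hκ b h2
    refine h3.trans_eq (Finset.sum_congr rfl fun k _ => ?_)
    rw [Finset.mul_sum]
    exact Finset.sum_congr rfl fun l _ => by ring
  -- The form bᵀKΓb equals κ_j g by the pairing, and h² after symmetrisation with KΓ + ΓK =
  -- 2·`ones`.
  have hrel : κ j * g = h ^ 2 := by
    have h1 := quad (fun k => κ k * b k) (fun k hk => by simp [hb0 k hk])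
    have h1' : ∑ k, ∑ l, κ k * b k * (2 / (κ k + κ l) * b l) = κ j * g := by
      rw [← h1]
      exact Finset.sum_congr rfl fun k _ => by rw [Finset.mul_sum]
    have h2 : ∑ k, ∑ l, κ l * b k * (2 / (κ k + κ l) * b l) = κ j * g := by
      rw [← h1', Finset.sum_comm]
      refine Finset.sum_congr rfl fun k _ => Finset.sum_congr rfl fun l _ => ?_
      rw [add_comm]; ring
    have h3 : κ j * g + κ j * g = 2 * h ^ 2 := by
      rw [← h2]
      nth_rewrite 1 [h2]
      rw [← h1', ← Finset.sum_add_distrib, hh, sq, Finset.sum_mul_sum, Finset.mul_sum]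
      refine Finset.sum_congr rfl fun k _ => ?_
      rw [← Finset.sum_add_distrib, Finset.mul_sum]
      refine Finset.sum_congr rfl fun l _ => ?_
      have := (add_pos (hpos k) (hpos l)).ne'
      field_simp
    linarith
  refine ⟨g, hgpos, fun σ hσ => ?_⟩
  set s := edgePoint P j σ with hs
  -- The ansatz diag s · w = x = -ia + icb solves the rows in P. Row j requires c = (1 - σ)w_j, and
  -- the j-th coordinate of x gives σw_j = -ih + icg; together w_j D = -ih.
  set D : ℂ := (σ : ℂ) - I * ((1 - σ) * g) with hD
  have hn : 0 < σ ^ 2 + g ^ 2 * (1 - σ) ^ 2 := by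
    rcases hσ.1.eq_or_lt with h0 | h0
    · rw [← h0]; simp; positivity
    · positivity
  have hDn : D ≠ 0 := by
    intro h0
    have e1 := congrArg Complex.re h0
    have e2 := congrArg Complex.im h0
    simp [hD] at e1 e2
    rw [e1] at e2
    simp at e2
    linarith
  set c : ℂ := -I * h * (1 - σ) / D with hc
  set x : ι → ℂ := fun k => -I * a k + I * c * b k with hx
  have hxj : x j = σ * (-I * h / D) := by
    simp only [hx, hc, hsumA, ← hg]
    field_simp
    rw [hD]
    have hI : I ^ 2 = -1 := I_sq
    linear_combination (-(h : ℂ) * (1 - σ) * g) * hI + (h : ℂ) * (1 - σ) * g * hI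
  -- Outside `insert j P` one has s = 0, so the row gives w_k directly.
  set w : ι → ℂ := fun k => if k ∈ P then x k else if k = j then -I * h / D else
    1 - I * ∑ l, ((2 / (κ k + κ l) : ℝ) : ℂ) * x l with hw
  have hsw : ∀ k, (s k : ℂ) * w k = x k := by
    intro k
    by_cases hk : k ∈ P
    · simp [hs, hw, edgePoint, hk]
    · by_cases hkj : k = j
      · subst hkj
        rw [hxj]
        simp [hs, hw, edgePoint, hk]
      · have hkQ : k ∉ insert j P := by simp [hk, hkj]
        simp [hs, edgePoint, hk, hkj, hx, ha0 k hkQ, hb0 k hkQ]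
  have hGx : ∀ k ∈ insert j P, ∑ l, ((2 / (κ k + κ l) : ℝ) : ℂ) * x l =
      -I + I * c * ((Pi.single j 1 : ι → ℝ) k : ℝ) := by
    intro k hk
    have e1 : ((∑ l, 2 / (κ k + κ l) * a l : ℝ) : ℂ) = 1 := by rw [ha k hk]; simp
    have e2 : ((∑ l, 2 / (κ k + κ l) * b l : ℝ) : ℂ) = ((Pi.single j 1 : ι → ℝ) k : ℝ) := by
      rw [hb k hk]
    rw [← e2]
    have e3 : -I = -I * ((∑ l, 2 / (κ k + κ l) * a l : ℝ) : ℂ) := by rw [e1, mul_one]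
    nth_rewrite 1 [e3]
    rw [ofReal_sum, ofReal_sum, Finset.mul_sum, Finset.mul_sum, ← Finset.sum_add_distrib]
    refine Finset.sum_congr rfl fun l _ => ?_
    simp only [hx, ofReal_mul]
    ring
  have hsol : pencil κ (1 - s) s *ᵥ w = 1 := by
    funext k
    rw [pencil_mulVec]
    simp only [hsw]
    by_cases hk : k ∈ P
    · have hkj : k ≠ j := fun h => hj (h ▸ hk)
      rw [hGx k (Finset.mem_insert_of_mem hk)]
      simp [hs, edgePoint, hk, hkj]
    · by_cases hkj : k = j
      · subst hkj
        rw [hGx k hjQ]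
        simp [hs, hw, edgePoint, hk, hc]
        field_simp
        have hI : I ^ 2 = -1 := I_sq
        linear_combination (-D - (1 - σ) * I * h) * hI
      · simp [hs, hw, edgePoint, hk, hkj]
  have hsm : s ∈ Icc (0 : ι → ℝ) 1 := edgePoint_mem P j hσ
  rw [cubePotential_of_solution hκ hsm hsol]
  simp only [hsw]
  have hsum : ∑ k, x k = -I * (∑ k, a k : ℝ) + I * c * h := by
    rw [hh, ofReal_sum, ofReal_sum, Finset.mul_sum, Finset.mul_sum, ← Finset.sum_add_distrib]
  have hic : I * c * h = ((h ^ 2 * (1 - σ) / (σ ^ 2 + g ^ 2 * (1 - σ) ^ 2) : ℝ) : ℂ) *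
      (σ + I * ((1 - σ) * g)) := by
    have hDD : D * (σ + I * ((1 - σ) * g)) = ((σ ^ 2 + g ^ 2 * (1 - σ) ^ 2 : ℝ) : ℂ) := by
      rw [hD]; push_cast
      have hI : I ^ 2 = -1 := I_sq
      linear_combination (-((1 - σ) * g : ℂ) ^ 2) * hI
    have hn' : ((σ ^ 2 + g ^ 2 * (1 - σ) ^ 2 : ℝ) : ℂ) ≠ 0 := by exact_mod_cast hn.ne'
    rw [ofReal_div, div_mul_eq_mul_div, eq_div_iff hn', ← hDD, hc]
    have hI : I ^ 2 = -1 := I_sq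
    push_cast
    field_simp
    linear_combination (-((h : ℂ) ^ 2 * (1 - σ) * (σ + I * (1 - σ) * g))) * hI
  rw [hsum, hic]
  simp only [add_re, mul_re, neg_re, neg_im, I_re, I_im, ofReal_re, ofReal_im, add_im, mul_im,
    sub_re, sub_im, one_re, one_im]
  rw [mul_assoc 2 (κ j) g, hrel]
  ring

/-- The vertex 1 is the endpoint σ = 1 of an edge, where the one-soliton profile vanishes. -/
lemma cubePotential_one [Nonempty ι] {κ : ι → ℝ} (hκ : GramPos κ) (hpos : ∀ j, 0 < κ j) :
    cubePotential κ 1 = 0 := by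
  obtain ⟨j⟩ := ‹Nonempty ι›
  obtain ⟨g, -, h⟩ := cubePotential_edge hκ hpos (Finset.univ.erase j) (j := j) (by simp)
  have e : edgePoint (Finset.univ.erase j) j 1 = 1 := by
    funext k
    by_cases hk : k = j <;> simp [edgePoint, hk]
  rw [← e, h 1 ⟨zero_le_one, le_rfl⟩]
  simp

/-- The multisoliton solution of mKdV as a curve in the Schwartz space. -/
theorem exists_multisoliton [Nonempty ι] {κ : ι → ℝ} (hκ : GramPos κ) (hpos : ∀ j, 1 ≤ κ j)
    (β : ι → ℝ) : ∃ u : ℝ → 𝓢(ℝ, ℝ), IsSchwartzSolutionMKdV u ∧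
      ∀ t x, u t x = cubePotential κ (logistic κ β t x) := by
  have hpos' : ∀ j, 0 < κ j := fun j => zero_lt_one.trans_le (hpos j)
  obtain ⟨u, hu, hux⟩ := exists_schwartz_curve (cubeSmooth_cubePotential hκ) κ β hpos
    cubePotential_zero (cubePotential_one hκ hpos')
  refine ⟨u, ⟨hu, fun t x => ?_⟩, hux⟩
  have e1 : ∀ t, (fun y => u t y) = fun y => potential κ (expPhase κ β t y) := fun t =>
    funext fun y => by rw [hux, potential_expPhase]
  have e2 : (fun τ => u τ x) = fun τ => potential κ (expPhase κ β τ x) :=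
    funext fun τ => by rw [hux, potential_expPhase]
  rw [e1, e2, hux, ← potential_expPhase]
  exact potential_mkdv hκ hpos' β t x

end edge

end MKdV

/-! ### The potential at time zero is (m + 1) sech -/

namespace MKdV

open Polynomial
open scoped Matrix

/-! ### Newton interpolation at the nodes `0, …, m` -/

/-- The product of the differences of the node `l` with the other nodes among `0, …, m`. -/
def nodeProd (m l : ℕ) : ℂ := ∏ k ∈ (Finset.range (m + 1)).erase l, ((l : ℂ) - k)

lemma nodeProd_ne_zero (m l : ℕ) : nodeProd m l ≠ 0 := by
  refine Finset.prod_ne_zero_iff.2 fun k hk => sub_ne_zero.2 ?_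
  exact_mod_cast (Finset.ne_of_mem_erase hk).symm

lemma nodeProd_sub {m j : ℕ} (hj : j ≤ m) :
    nodeProd m (m - j) = (m - j).factorial * ((-1) ^ j * j.factorial) := by
  obtain ⟨l, rfl⟩ := Nat.exists_eq_add_of_le' hj
  rw [Nat.add_sub_cancel, nodeProd]
  -- Nodes below l contribute l!, nodes above it (-1)^j j!.
  have h : (Finset.range (l + j + 1)).erase l =
      (Finset.range l) ∪ (Finset.range j).map (addRightEmbedding (l + 1)) := by
    ext k
    simp only [Finset.mem_erase, Finset.mem_range, Finset.mem_union, Finset.mem_map,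
      addRightEmbedding_apply]
    constructor
    · rintro ⟨h1, h2⟩
      rcases lt_or_gt_of_ne h1 with h | h
      · exact Or.inl h
      · exact Or.inr ⟨k - (l + 1), by omega, by omega⟩
    · rintro (h | ⟨i, hi, rfl⟩) <;> omega
  rw [h, Finset.prod_union, Finset.prod_map]
  · congr 1
    · rw [← Finset.prod_range_reflect, ← Finset.prod_range_add_one_eq_factorial]
      push_cast
      refine Finset.prod_congr rfl fun i hi => ?_
      have hi' := Finset.mem_range.1 hi
      rw [Nat.cast_sub (by omega), Nat.cast_sub (by omega)]
      push_cast; ring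
    · rw [← Finset.prod_range_add_one_eq_factorial]
      push_cast
      rw [← Finset.card_range j, ← Finset.prod_const, Finset.card_range, ← Finset.prod_mul_distrib]
      refine Finset.prod_congr rfl fun i _ => ?_
      simp; ring
  · rw [Finset.disjoint_left]
    simp only [Finset.mem_range, Finset.mem_map, addRightEmbedding_apply, not_exists, not_and]
    omega

/-- The Newton series `∑ h_k (n choose k)` of order `m + 1`. -/
def newtonSeries (m : ℕ) (h : ℕ → ℂ) (n : ℕ) : ℂ :=
  ∑ k ∈ Finset.range (m + 2), h k * (n.choose k : ℂ)

/-- Cutting the series at k = m gives the Lagrange interpolant at the nodes 0, …, m, since the last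
binomial vanishes there. Comparing leading coefficients gives the first identity, evaluating away
from the nodes the second. -/
lemma newtonSeries_interpolation (m : ℕ) (h : ℕ → ℂ) :
    (∑ l ∈ Finset.range (m + 1), newtonSeries m h l / nodeProd m l = h m / m.factorial) ∧
    ∀ n, m + 1 ≤ n → newtonSeries m h n = (n.descFactorial (m + 1) : ℂ) *
      (h (m + 1) / (m + 1).factorial +
        ∑ l ∈ Finset.range (m + 1), newtonSeries m h l / (nodeProd m l * ((n : ℂ) - l))) := by
  have hchoose : ∀ n k : ℕ, ((n.descFactorial k : ℕ) : ℂ) / k.factorial = n.choose k := by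
    intro n k
    rw [Nat.descFactorial_eq_factorial_mul_choose, Nat.cast_mul,
      mul_div_cancel_left₀ _ (by exact_mod_cast Nat.factorial_ne_zero k)]
  set P : ℂ[X] := ∑ k ∈ Finset.range (m + 1), C (h k / k.factorial) * descPochhammer ℂ k with hP
  have hPe : ∀ n : ℕ, P.eval (n : ℂ) = ∑ k ∈ Finset.range (m + 1), h k * (n.choose k : ℂ) := by
    intro n
    rw [hP, eval_finsetSum]
    refine Finset.sum_congr rfl fun k _ => ?_
    rw [eval_C_mul, descPochhammer_eval_eq_descFactorial, ← hchoose]; ring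
  have hdeg : ∀ k, (C (h k / k.factorial) * descPochhammer ℂ k).natDegree ≤ k := fun k =>
    (natDegree_C_mul_le _ _).trans (descPochhammer_natDegree ℂ k).le
  have hPd : P.degree < (Finset.range (m + 1)).card := by
    rw [Finset.card_range]
    refine (degree_le_natDegree).trans_lt ?_
    have : P.natDegree ≤ m := natDegree_sum_le_of_forall_le _ _ fun k hk =>
      (hdeg k).trans (Nat.lt_succ_iff.1 (Finset.mem_range.1 hk))
    exact_mod_cast Nat.lt_succ_of_le this
  have hPc : P.coeff m = h m / m.factorial := by
    rw [hP, finsetSum_coeff, Finset.sum_eq_single m]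
    · have h1 := monic_descPochhammer ℂ m
      rw [Monic, leadingCoeff, descPochhammer_natDegree] at h1
      rw [coeff_C_mul, h1, mul_one]
    · intro k hk hkm
      refine coeff_eq_zero_of_natDegree_lt ((hdeg k).trans_lt ?_)
      have := Finset.mem_range.1 hk
      omega
    · intro h; simp at h
  have hinj : Set.InjOn (fun l : ℕ => (l : ℂ)) (Finset.range (m + 1)) :=
    fun a _ b _ hab => Nat.cast_injective (R := ℂ) hab
  have hnode : ∀ l ∈ Finset.range (m + 1), P.eval (l : ℂ) = newtonSeries m h l := by
    intro l hl
    rw [hPe, newtonSeries, Finset.sum_range_succ _ (m + 1),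
      Nat.choose_eq_zero_of_lt (Finset.mem_range.1 hl)]
    simp
  constructor
  · have h1 := Lagrange.coeff_eq_sum hinj hPd
    rw [Finset.card_range, Nat.add_sub_cancel, hPc] at h1
    rw [h1]
    exact Finset.sum_congr rfl fun l hl => by rw [hnode l hl, nodeProd]
  · intro n hn
    have hx : ∀ i ∈ Finset.range (m + 1), (n : ℂ) ≠ ((fun l : ℕ => (l : ℂ)) i) := by
      intro i hi
      have := Finset.mem_range.1 hi
      exact fun h => absurd (Nat.cast_injective (R := ℂ) h) (by omega)
    have h1 := Lagrange.eval_interpolate_not_at_node (s := Finset.range (m + 1))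
      (v := fun l : ℕ => (l : ℂ)) (fun i => P.eval ((i : ℕ) : ℂ)) hx
    rw [← Lagrange.eq_interpolate hinj hPd, Lagrange.eval_nodal, hPe] at h1
    have h2 : ∏ i ∈ Finset.range (m + 1), ((n : ℂ) - i) = (n.descFactorial (m + 1) : ℂ) := by
      rw [Nat.descFactorial_eq_prod_range]
      push_cast
      refine Finset.prod_congr rfl fun i hi => ?_
      have := Finset.mem_range.1 hi
      rw [Nat.cast_sub (by omega)]
    rw [h2] at h1
    rw [newtonSeries, Finset.sum_range_succ, h1, ← hchoose n (m + 1), mul_add, add_comm]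
    congr 1
    · ring
    · congr 1
      refine Finset.sum_congr rfl fun l hl => ?_
      rw [hnode l hl, Lagrange.nodalWeight, nodeProd, Finset.prod_inv_distrib]
      have := sub_ne_zero.2 (hx l hl)
      simp only at this ⊢
      field_simp

/-! ### Krawtchouk type polynomials -/

section krawtchouk
variable (α β : ℂ)

/-- The generating polynomial `(1 + αX)^n (1 + βX)^r`. -/
def krawGen (n r : ℕ) : ℂ[X] := (1 + C α * X) ^ n * (1 + C β * X) ^ r

/-- Reversal sends 1 + aX to X + a, and X + α = α(1 + βX) when αβ = 1, so the two exponents are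
exchanged. -/
lemma krawGen_reflect {α β : ℂ} (hαβ : α * β = 1) (n r : ℕ) :
    (krawGen α β n r).reflect (n + r) = C (α ^ n * β ^ r) * krawGen α β r n := by
  have hd : ∀ a : ℂ, (1 + C a * X).natDegree ≤ 1 := fun a => by
    refine (natDegree_add_le _ _).trans ?_
    rw [natDegree_one]
    exact max_le zero_le_one ((natDegree_C_mul_le a X).trans natDegree_X_le)
  have h1 : ∀ a : ℂ, (1 + C a * X).reflect 1 = X + C a := by
    intro a
    rw [reflect_add, reflect_one, reflect_C_mul, reflect_one_X]; simp
  have hpd : ∀ (a : ℂ) (n : ℕ), ((1 + C a * X) ^ n).natDegree ≤ n := fun a n =>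
    (natDegree_pow_le_of_le n (hd a)).trans (by simp)
  have hp : ∀ (a : ℂ) (n : ℕ), ((1 + C a * X) ^ n).reflect n = (X + C a) ^ n := by
    intro a n
    induction n with
    | zero => simp
    | succ n ih => rw [pow_succ, reflect_mul _ _ (hpd a n) (hd a), ih, h1, pow_succ]
  have hβα : C α * C β = 1 := by rw [← C_mul, hαβ, C_1]
  rw [krawGen, reflect_mul _ _ (hpd α n) (hpd β r), hp, hp, krawGen]
  have e1 : (X + C α) = C α * (1 + C β * X) := by linear_combination (-X : ℂ[X]) * hβα
  have e2 : (X + C β) = C β * (1 + C α * X) := by linear_combination (-X : ℂ[X]) * hβα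
  rw [e1, e2, mul_pow, mul_pow, C_mul, C_pow, C_pow]
  ring

/-- The coefficient of `X^{m+1}` in `(1 + X)(1 + αX)^n (1 + βX)^{2m+1-n}`. -/
def kraw (m n : ℕ) : ℂ := ((1 + X) * krawGen α β n (2 * m + 1 - n)).coeff (m + 1)

/-- Reversal in degree 2m + 1 exchanges the coefficients of X^m and X^{m+1}, and multiplication by 1
+ X adds exactly these two. -/
lemma kraw_symm {α β : ℂ} (hαβ : α * β = 1) {m j : ℕ} (hj : j ≤ m) :
    kraw α β m (m + 1 + j) = α ^ (2 * j + 1) * kraw α β m (m - j) := by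
  have hc : ∀ Q : ℂ[X], ((1 + X) * Q).coeff (m + 1) = Q.coeff (m + 1) + Q.coeff m := by
    intro Q
    rw [add_mul, one_mul, coeff_add, coeff_X_mul]
  have e1 : 2 * m + 1 - (m + 1 + j) = m - j := by omega
  have e2 : 2 * m + 1 - (m - j) = m + 1 + j := by omega
  rw [kraw, kraw, hc, hc, e1, e2]
  have hr := krawGen_reflect hαβ (m + 1 + j) (m - j)
  have e3 : m + 1 + j + (m - j) = 2 * m + 1 := by omega
  rw [e3] at hr
  have hpow : α ^ (m + 1 + j) * β ^ (m - j) = α ^ (2 * j + 1) := by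
    have : m + 1 + j = (2 * j + 1) + (m - j) := by omega
    rw [this, pow_add, mul_assoc, ← mul_pow, hαβ, one_pow, mul_one]
  rw [hpow] at hr
  have c1 := congrArg (fun Q => Q.coeff m) hr
  have c2 := congrArg (fun Q => Q.coeff (m + 1)) hr
  simp only [coeff_reflect, coeff_C_mul] at c1 c2
  rw [revAt_le (by omega)] at c1 c2
  rw [show 2 * m + 1 - m = m + 1 by omega] at c1
  rw [show 2 * m + 1 - (m + 1) = m by omega] at c2
  rw [c1, c2]; ring

/-- The Newton coefficients of `kraw`. -/
def krawNewton (m k : ℕ) : ℂ :=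
  (α - β) ^ k * ((1 + X) * (1 + C β * X) ^ (2 * m + 1 - k)).coeff (m + 1 - k)

/-- Expand the n-th power of 1 + αX = (α - β)X + (1 + βX): n remains only in binomial coefficients,
and terms with k > m + 1 cannot reach X^{m+1}. -/
lemma kraw_eq_newtonSeries {m n : ℕ} (hn : n ≤ 2 * m + 1) :
    kraw α β m n = newtonSeries m (krawNewton α β m) n := by
  have h1 : krawGen α β n (2 * m + 1 - n) = ∑ k ∈ Finset.range (2 * m + 2),
      C ((α - β) ^ k * (n.choose k : ℂ)) * X ^ k * (1 + C β * X) ^ (2 * m + 1 - k) := by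
    have e : (1 + C α * X : ℂ[X]) = C (α - β) * X + (1 + C β * X) := by
      rw [C_sub]; ring
    rw [krawGen, e, add_pow, Finset.sum_mul]
    refine Finset.sum_subset_zero_on_sdiff (Finset.range_subset_range.2 (by omega)) ?_ ?_
    · intro k hk
      simp only [Finset.mem_sdiff, Finset.mem_range] at hk
      rw [Nat.choose_eq_zero_of_lt (by omega)]
      simp
    · intro k hk
      have hk' := Finset.mem_range.1 hk
      have : 2 * m + 1 - k = (n - k) + (2 * m + 1 - n) := by omega
      rw [this, pow_add, C_mul, C_pow, mul_pow, C_eq_natCast]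
      ring
  rw [kraw, h1, Finset.mul_sum, finsetSum_coeff, newtonSeries]
  symm
  refine Finset.sum_subset_zero_on_sdiff (Finset.range_subset_range.2 (by omega)) ?_ ?_
  · intro k hk
    simp only [Finset.mem_sdiff, Finset.mem_range] at hk
    rw [show (1 + X : ℂ[X]) * (C ((α - β) ^ k * (n.choose k : ℂ)) * X ^ k *
      (1 + C β * X) ^ (2 * m + 1 - k)) = X ^ k * ((1 + X) * (C ((α - β) ^ k * (n.choose k : ℂ)) *
      (1 + C β * X) ^ (2 * m + 1 - k))) by ring, coeff_X_pow_mul', if_neg (by omega)]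
  · intro k hk
    have hk' := Finset.mem_range.1 hk
    rw [show (1 + X : ℂ[X]) * (C ((α - β) ^ k * (n.choose k : ℂ)) * X ^ k *
      (1 + C β * X) ^ (2 * m + 1 - k)) = C ((α - β) ^ k * (n.choose k : ℂ)) * (X ^ k * ((1 + X) *
      (1 + C β * X) ^ (2 * m + 1 - k))) by ring, coeff_C_mul, coeff_X_pow_mul', if_pos (by omega),
      krawNewton]
    ring

lemma krawNewton_top (m : ℕ) : krawNewton α β m (m + 1) = (α - β) ^ (m + 1) := by
  rw [krawNewton, Nat.sub_self, coeff_zero_eq_eval_zero]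
  simp

lemma krawNewton_sub (m : ℕ) :
    krawNewton α β m m = (α - β) ^ m * (1 + (m + 1) * β) := by
  rw [krawNewton, show m + 1 - m = 1 by omega, show 2 * m + 1 - m = m + 1 by omega, add_mul,
    one_mul, coeff_add, coeff_X_mul, coeff_zero_eq_eval_zero]
  have : ((1 + C β * X : ℂ[X]) ^ (m + 1)).coeff 1 = (m + 1) * β := by
    have h := coeff_derivative ((1 + C β * X : ℂ[X]) ^ (m + 1)) 0
    rw [derivative_pow, coeff_zero_eq_eval_zero] at h
    simp at h
    exact h.symm
  have h0 : ((1 + C β * X : ℂ[X]) ^ (m + 1)).eval 0 = 1 := by simp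
  rw [this, h0]
  ring

end krawtchouk

/-! ### The initial data -/

/-- The spectral parameters `1, 3, 5, …`. -/
def oddSpec (N : ℕ) : Fin N → ℝ := fun j => 2 * (j : ℕ) + 1

lemma oddSpec_pos {N : ℕ} (j : Fin N) : 1 ≤ oddSpec N j := by
  simp [oddSpec]

/-- For odd parameters Γ is the Hilbert matrix, with entries 1/(j + k + 1) = ∫₀¹ x^{j+k} dx, so the
form is the integral of the square of a polynomial. -/
lemma gramPos_oddSpec (N : ℕ) : GramPos (oddSpec N) := by
  intro a ha
  set p : ℝ[X] := ∑ j : Fin N, C (a j) * X ^ (j : ℕ) with hp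
  have hpc : ∀ j : Fin N, p.coeff j = a j := by
    intro j
    rw [hp, finsetSum_coeff, Finset.sum_eq_single j]
    · simp
    · intro k _ hkj
      have : (j : ℕ) ≠ k := fun h => hkj (Fin.ext h.symm)
      simp [coeff_X_pow, this]
    · simp
  have hp0 : p ≠ 0 := by
    intro h
    apply ha
    funext j
    rw [← hpc j, h]; simp
  have hint : ∑ j, ∑ k, a j * (2 / (oddSpec N j + oddSpec N k)) * a k =
      ∫ x in (0 : ℝ)..1, (p.eval x) ^ 2 := by
    have h1 : ∀ x : ℝ, (p.eval x) ^ 2 = ∑ j, ∑ k, a j * a k * x ^ ((j : ℕ) + (k : ℕ)) := by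
      intro x
      rw [hp, eval_finsetSum, sq, Finset.sum_mul_sum]
      refine Finset.sum_congr rfl fun j _ => Finset.sum_congr rfl fun k _ => ?_
      simp only [eval_mul, eval_C, eval_pow, eval_X, pow_add]
      ring
    simp only [h1]
    rw [intervalIntegral.integral_finsetSum]
    · refine Finset.sum_congr rfl fun j _ => ?_
      rw [intervalIntegral.integral_finsetSum]
      · refine Finset.sum_congr rfl fun k _ => ?_
        rw [intervalIntegral.integral_const_mul, integral_pow, oddSpec, oddSpec]
        push_cast
        have h2 : (2 * (j : ℝ) + 1 + (2 * (k : ℝ) + 1)) ≠ 0 := by positivity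
        have h3 : ((j : ℝ) + k + 1) ≠ 0 := by positivity
        simp
        field_simp
        ring
      · intro k _
        exact Continuous.intervalIntegrable (by fun_prop) _ _
    · intro j _
      exact Continuous.intervalIntegrable (by fun_prop) _ _
  rw [hint]
  refine intervalIntegral.integral_pos zero_lt_one (by fun_prop) (fun x _ => sq_nonneg _) ?_
  by_contra hcon
  push Not at hcon
  refine hp0 (eq_zero_of_infinite_isRoot p ((Set.Icc_infinite (zero_lt_one (α := ℝ))).mono ?_))
  intro x hx
  have := hcon x hx
  exact pow_eq_zero_iff two_ne_zero |>.1 (le_antisymm this (sq_nonneg _))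

/-- The norming constants of `N sech`. -/
def sechPhase (m : ℕ) : Fin (m + 1) → ℝ := fun j =>
  Real.log ((m + 1 + j).factorial / ((m - j).factorial * (j : ℕ).factorial ^ 2))

lemma expPhase_sech (m : ℕ) (x : ℝ) (j : Fin (m + 1)) :
    expPhase (oddSpec (m + 1)) (sechPhase m) 0 x j =
      ((Real.exp x)⁻¹) ^ (2 * (j : ℕ) + 1) * (((m - j).factorial * (j : ℕ).factorial ^ 2) /
        (m + 1 + j).factorial) := by
  have hpos : (0 : ℝ) < (m + 1 + j).factorial / ((m - j).factorial * (j : ℕ).factorial ^ 2) := by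
    positivity
  rw [expPhase, mul_zero, sub_zero, neg_add, Real.exp_add, sechPhase, Real.exp_neg (Real.log _),
    Real.exp_log hpos, inv_div, ← Real.exp_neg, ← Real.exp_nat_mul]
  congr 2
  rw [oddSpec]; push_cast; ring

-- The system (F + iΓ)η = 1 is solved in closed form. Its kernel 1/(j + k + 1) is that of
-- interpolation from the nodes m - k to the point m + 1 + j, and the symmetry of `kraw` accounts
-- for the diagonal term f_j η_j. The potential needs only Σ η, which is a leading coefficient.
open Complex in
theorem potential_initial (m : ℕ) (x : ℝ) :
    potential (oddSpec (m + 1)) (expPhase (oddSpec (m + 1)) (sechPhase m) 0 x) =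
      (m + 1) * (1 / Real.cosh x) := by
  set κ := oddSpec (m + 1) with hκ
  set f := expPhase κ (sechPhase m) 0 x with hf
  set z : ℝ := Real.exp x with hz
  have hz0 : (z : ℂ) ≠ 0 := by exact_mod_cast (Real.exp_pos x).ne'
  -- This choice gives αβ = 1 and α - β = 2i cosh x, which is nonzero.
  set α : ℂ := I / z with hα
  set β : ℂ := z / I with hβ
  have hαβ : α * β = 1 := by
    rw [hα, hβ]; field_simp
  have hI : I ^ 2 = -1 := I_sq
  have hsub : α - β = I * (((z⁻¹ + z : ℝ)) : ℂ) := by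
    rw [hα, hβ, div_I]; push_cast; field_simp; ring
  have hzz : z⁻¹ + z = 2 * Real.cosh x := by
    rw [Real.cosh_eq, hz, Real.exp_neg]; ring
  have hch : (Real.cosh x : ℂ) ≠ 0 := by exact_mod_cast (Real.cosh_pos x).ne'
  have hne : α - β ≠ 0 := by
    rw [hsub, hzz]
    push_cast
    exact mul_ne_zero I_ne_zero (mul_ne_zero two_ne_zero (by simpa using hch))
  obtain ⟨hsum, hint⟩ := newtonSeries_interpolation m (krawNewton α β m)
  rw [krawNewton_sub] at hsum
  simp only [krawNewton_top] at hint
  set A : ℂ := (α - β) ^ (m + 1) / (m + 1).factorial with hA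
  have hfac : ∀ n : ℕ, (n.factorial : ℂ) ≠ 0 := fun n => by exact_mod_cast n.factorial_ne_zero
  have hA0 : A ≠ 0 := div_ne_zero (pow_ne_zero _ hne) (hfac _)
  -- Interpolation weights at the nodes m - j, divided by the top coefficient A so that the
  -- right-hand side of the system is 1.
  set η : Fin (m + 1) → ℂ := fun j =>
    I * (kraw α β m (m - j) / (A * nodeProd m (m - j))) with hη
  have hrefl : ∀ F : ℕ → ℂ, ∑ j : Fin (m + 1), F (m - j) = ∑ l ∈ Finset.range (m + 1), F l := by
    intro F
    rw [Fin.sum_univ_eq_sum_range (fun j => F (m - j)), ← Finset.sum_range_reflect]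
    refine Finset.sum_congr rfl fun j hj => ?_
    congr 1
    have := Finset.mem_range.1 hj
    omega
  have hsol : pencil κ f 1 *ᵥ η = 1 := by
    funext j
    rw [pencil_mulVec, Pi.one_apply]
    have hj : (j : ℕ) ≤ m := Nat.lt_succ_iff.1 j.2
    -- 2/(κ_j + κ_k) = 1/(j + k + 1) = 1/((m + 1 + j) - (m - k)).
    have e1 : ∑ k, ((2 / (κ j + κ k) : ℝ) : ℂ) * (((1 : Fin (m + 1) → ℝ) k : ℂ) * η k) =
        I * ((∑ l ∈ Finset.range (m + 1), newtonSeries m (krawNewton α β m) l /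
          (nodeProd m l * (((m + 1 + j : ℕ) : ℂ) - l))) / A) := by
      rw [← hrefl, Finset.sum_div, Finset.mul_sum]
      refine Finset.sum_congr rfl fun k _ => ?_
      have hk : (k : ℕ) ≤ m := Nat.lt_succ_iff.1 k.2
      rw [← kraw_eq_newtonSeries _ _ (by omega), hη, hκ, oddSpec, oddSpec, Nat.cast_sub hk]
      have h1 := nodeProd_ne_zero m (m - k)
      have h2 : ((j : ℂ) + k + 1) ≠ 0 := by exact_mod_cast (by omega : (j : ℕ) + k + 1 ≠ 0)
      have h3 : (2 * (j : ℂ) + 1 + (2 * (k : ℂ) + 1)) ≠ 0 := by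
        exact_mod_cast (by omega : 2 * (j : ℕ) + 1 + (2 * (k : ℕ) + 1) ≠ 0)
      have h4 : ((m : ℂ) + 1 + j - (m - k)) ≠ 0 := by
        rw [show ((m : ℂ) + 1 + j - (m - k)) = (j : ℂ) + k + 1 by ring]; exact h2
      push_cast
      simp only [Pi.one_apply, ofReal_one, one_mul]
      rw [show ((m : ℂ) + 1 + j - (m - k)) = (j : ℂ) + k + 1 by ring]
      field_simp
      ring
    -- The value at m + 1 + j is α^{2j+1} times the value at the node m - j; this and the chosen
    -- norming constants reproduce f_j η_j.
    have hi := hint (m + 1 + j) (by omega)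
    rw [← kraw_eq_newtonSeries _ _ (by omega), kraw_symm hαβ hj] at hi
    set Q := ∑ l ∈ Finset.range (m + 1), newtonSeries m (krawNewton α β m) l /
          (nodeProd m l * (((m + 1 + j : ℕ) : ℂ) - l))
    have hdf : ((m + 1 + j).descFactorial (m + 1) : ℂ) = (m + 1 + j).factorial / (j : ℕ).factorial := by
      rw [eq_div_iff (hfac _), mul_comm]
      have := Nat.factorial_mul_descFactorial (n := m + 1 + j) (k := m + 1) (by omega)
      rw [Nat.add_sub_cancel_left] at this
      exact_mod_cast this
    rw [e1, hf, expPhase_sech, hη]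
    simp only
    rw [nodeProd_sub hj]
    rw [hdf] at hi
    have hIp : I * I ^ (2 * (j : ℕ) + 1) = (-1) ^ ((j : ℕ) + 1) := by
      rw [← pow_succ', show 2 * (j : ℕ) + 1 + 1 = 2 * (j + 1) by ring, pow_mul, hI]
    have hz' : α ^ (2 * (j : ℕ) + 1) = I ^ (2 * (j : ℕ) + 1) * ((z : ℂ)⁻¹) ^ (2 * (j : ℕ) + 1) := by
      rw [hα, div_eq_mul_inv, mul_pow]
    rw [hz'] at hi
    set Z : ℂ := ((z : ℂ)⁻¹) ^ (2 * (j : ℕ) + 1)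
    set J : ℂ := I ^ (2 * (j : ℕ) + 1)
    set H : ℂ := kraw α β m (m - j)
    have hJ : I * ((-1) ^ (j : ℕ))⁻¹ = J := by
      have h5 : ((-1 : ℂ) ^ (j : ℕ)) * (-1) ^ (j : ℕ) = 1 := by
        rw [← mul_pow]; simp
      have h6 : ((-1 : ℂ) ^ (j : ℕ))⁻¹ = (-1) ^ (j : ℕ) := inv_eq_of_mul_eq_one_left h5
      rw [h6]
      rw [pow_succ] at hIp
      linear_combination I * hIp - J * hI
    have hm1 : ((-1 : ℂ) ^ (j : ℕ)) ≠ 0 := pow_ne_zero _ (by norm_num)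
    have hi2 : J * Z * H * (j : ℕ).factorial / (m + 1 + j).factorial / A = 1 + Q / A := by
      have f1 := hfac (m + 1 + j)
      have f2 := hfac (j : ℕ)
      rw [hi]
      field_simp
    have hi3 : ((Real.exp x)⁻¹ ^ (2 * (j : ℕ) + 1) * (((m - j).factorial * (j : ℕ).factorial ^ 2) /
        (m + 1 + j).factorial) : ℝ) * (I * (H / (A * ((m - j).factorial * ((-1) ^ (j : ℕ) *
        (j : ℕ).factorial))))) = J * Z * H * (j : ℕ).factorial / (m + 1 + j).factorial / A := by
      rw [← hJ]
      have f1 := hfac (m + 1 + j)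
      have f2 := hfac (j : ℕ)
      have f3 := hfac (m - j)
      rw [← hz]
      push_cast
      field_simp
      ring
    rw [hi3, hi2]
    linear_combination (Q / A) * hI
  have hη' : ∑ j, η j = I * ((m + 1) * (1 + (m + 1) * β) / (α - β)) := by
    rw [hη, ← Finset.mul_sum, hrefl (fun l => kraw α β m l / (A * nodeProd m l))]
    congr 1
    have : ∑ l ∈ Finset.range (m + 1), kraw α β m l / (A * nodeProd m l) =
        (∑ l ∈ Finset.range (m + 1), newtonSeries m (krawNewton α β m) l / nodeProd m l) / A := by
      rw [Finset.sum_div]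
      refine Finset.sum_congr rfl fun l hl => ?_
      have := Finset.mem_range.1 hl
      rw [kraw_eq_newtonSeries _ _ (by omega), mul_comm A, div_div]
    rw [this, hsum, hA, Nat.factorial_succ]
    have f1 := hfac m
    push_cast
    field_simp
    ring
  have hfpos : ∀ j, 0 < f j := expPhase_pos _ _ _ _
  have hR : resolvent κ f *ᵥ 1 = η := by
    rw [← hsol, Matrix.mulVec_mulVec, resolvent_mul_pencil (gramPos_oddSpec _) hfpos,
      Matrix.one_mulVec]
  have hmom : momentMap κ 0 0 (resolvent κ f) = ∑ j, η j := by
    rw [← hR, momentMap_apply]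
    refine Finset.sum_congr rfl fun j _ => ?_
    simp [Matrix.mulVec, dotProduct]
  rw [potential, hmom, hη', hsub, hzz]
  have hβ' : β = -(I * z) := by rw [hβ, div_I, mul_comm]
  rw [hβ']
  -- The β-term is purely imaginary and disappears from the real part.
  have : I * ((m + 1) * (1 + (m + 1) * -(I * z)) / (I * ((2 * Real.cosh x : ℝ) : ℂ))) =
      (((m + 1) / (2 * Real.cosh x) : ℝ) : ℂ) * (1 - I * (((m + 1) * z : ℝ) : ℂ)) := by
    have := I_ne_zero
    push_cast
    push_cast at hch
    field_simp
    ring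
  rw [this, re_ofReal_mul]
  simp
  have := (Real.cosh_pos x).ne'
  field_simp

end MKdV

/-! ### Soliton resolution along a path of edges of the cube -/

namespace MKdV

open Set
open scoped ContDiff

section resolution
variable {N : ℕ}

/-- Projection of the cube to the edge joining the `j`-th and `(j+1)`-st vertex of the path
`(0,…,0), (1,0,…,0), …, (1,…,1)`. -/
def edgeProj (j : Fin N) (s : Fin N → ℝ) : Fin N → ℝ := edgePoint (Finset.Iio j) j (s j)

lemma edgeProj_apply (j k : Fin N) (s : Fin N → ℝ) :
    edgeProj j s k = if k < j then 1 else if k = j then s j else 0 := by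
  simp [edgeProj, edgePoint]

lemma edgeProj_mem (j : Fin N) {s : Fin N → ℝ} (hs : s ∈ Icc (0 : Fin N → ℝ) 1) :
    edgeProj j s ∈ Icc (0 : Fin N → ℝ) 1 :=
  edgePoint_mem _ _ ⟨hs.1 j, hs.2 j⟩

lemma norm_edgeProj_sub_le (j : Fin N) (s s' : Fin N → ℝ) :
    ‖edgeProj j s - edgeProj j s'‖ ≤ ‖s - s'‖ := by
  refine (pi_norm_le_iff_of_nonneg (norm_nonneg _)).2 fun k => ?_
  rw [Pi.sub_apply, edgeProj_apply, edgeProj_apply]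
  split_ifs
  · simp
  · exact norm_le_pi_norm (s - s') j
  · simp

/-- A function on the cube is close to the sum of its restrictions to the edges of the path,
up to the distance to any of these edges, if it vanishes at the vertices of the path. -/
lemma sub_sum_edgeProj_le {Φ : (Fin N → ℝ) → ℝ} (h : CubeSmooth Φ)
    (h0 : ∀ j, Φ (edgePoint (Finset.Iio j) j 0) = 0)
    (h1 : ∀ j, Φ (edgePoint (Finset.Iio j) j 1) = 0) :
    ∃ L : ℝ, 0 ≤ L ∧ ∀ s ∈ Icc (0 : Fin N → ℝ) 1, ∀ j,
      |Φ s - ∑ k, Φ (edgeProj k s)| ≤ L * ‖s - edgeProj j s‖ := by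
  obtain ⟨L, hL, hLip⟩ := h.lipschitz
  refine ⟨L * (1 + N), by positivity, fun s hs j => ?_⟩
  -- On edge j its own projection is the identity, and every other projection lands on a vertex of
  -- the path, where Φ vanishes.
  have hzero : Φ (edgeProj j s) - ∑ k, Φ (edgeProj k (edgeProj j s)) = 0 := by
    rw [Finset.sum_eq_single j]
    · have : edgeProj j (edgeProj j s) = edgeProj j s := by
        rw [edgeProj, edgeProj_apply]; simp [edgeProj]
      rw [this, sub_self]
    · intro k _ hkj
      rw [edgeProj, edgeProj_apply]
      split_ifs
      · exact h1 k
      · exact h0 k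
    · simp
  have e : Φ s - ∑ k, Φ (edgeProj k s) = (Φ s - Φ (edgeProj j s)) -
      ∑ k, (Φ (edgeProj k s) - Φ (edgeProj k (edgeProj j s))) := by
    rw [Finset.sum_sub_distrib]
    linarith
  rw [e]
  calc _ ≤ |Φ s - Φ (edgeProj j s)| +
      |∑ k, (Φ (edgeProj k s) - Φ (edgeProj k (edgeProj j s)))| := abs_sub _ _
    _ ≤ L * ‖s - edgeProj j s‖ + ∑ k : Fin N, L * ‖s - edgeProj j s‖ := by
      refine add_le_add (hLip _ hs _ (edgeProj_mem j hs))
        ((Finset.abs_sum_le_sum_abs _ _).trans (Finset.sum_le_sum fun k _ => ?_))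
      refine (hLip _ (edgeProj_mem k hs) _ (edgeProj_mem k (edgeProj_mem j hs))).trans ?_
      exact mul_le_mul_of_nonneg_left (norm_edgeProj_sub_le k _ _) hL
    _ = _ := by
      rw [Finset.sum_const, Finset.card_univ, Fintype.card_fin, nsmul_eq_mul]; ring

lemma logisticDeriv_vertex (c : Fin N → ℝ) (Φ : (Fin N → ℝ) → ℝ) {s : Fin N → ℝ}
    (hs : ∀ j, s j = 0 ∨ s j = 1) : logisticDeriv c Φ s = 0 := by
  have : (fun j => c j * (s j * (1 - s j))) = 0 := by
    funext j
    rcases hs j with h | h <;> simp [h]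
  rw [logisticDeriv, this, map_zero]

lemma iterate_logisticDeriv_edgePoint {κ : Fin N → ℝ} {Φ : (Fin N → ℝ) → ℝ} {j : Fin N} {σ : ℝ}
    (hσ : σ = 0 ∨ σ = 1) (h0 : Φ (edgePoint (Finset.Iio j) j σ) = 0) (n : ℕ) :
    (logisticDeriv κ)^[n] Φ (edgePoint (Finset.Iio j) j σ) = 0 := by
  cases n with
  | zero => exact h0
  | succ n =>
    rw [Function.iterate_succ_apply']
    refine logisticDeriv_vertex _ _ fun k => ?_
    simp only [edgePoint]
    split_ifs <;> simp [hσ]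

lemma hasDerivAt_edgeProj_logistic (κ β : Fin N → ℝ) (j : Fin N) (t x : ℝ) :
    HasDerivAt (fun y => edgeProj j (logistic κ β t y)) (fun k => κ k *
      (edgeProj j (logistic κ β t x) k * (1 - edgeProj j (logistic κ β t x) k))) x := by
  refine hasDerivAt_pi.2 fun k => ?_
  simp only [edgeProj_apply]
  by_cases h1 : k < j
  · simpa [h1] using hasDerivAt_const x (1 : ℝ)
  · by_cases h2 : k = j
    · subst h2
      simpa using hasDerivAt_pi.1 (hasDerivAt_logistic_space κ β t x) k
    · simpa [h1, h2] using hasDerivAt_const x (0 : ℝ)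

/-- The squares differ by 4(j - k)(j + k + 1). These are the soliton speeds, so the gap 8 separates
the solitons linearly in time. -/
lemma oddSpec_sq_sub {k j : Fin N} (hkj : k < j) : oddSpec N k ^ 2 + 8 ≤ oddSpec N j ^ 2 := by
  have h : (k : ℝ) + 1 ≤ j := by exact_mod_cast hkj
  have h0 : (0 : ℝ) ≤ k := by positivity
  simp only [oddSpec]
  nlinarith

/-- The distance of the logistic point to the nearest edge of the path is exponentially small. -/
lemma norm_logistic_sub_edgeProj_le [Nonempty (Fin N)] (β : Fin N → ℝ) :
    ∃ B : ℝ, 0 ≤ B ∧ ∀ t x : ℝ, 0 < t → ∃ j, ‖logistic (oddSpec N) β t x -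
      edgeProj j (logistic (oddSpec N) β t x)‖ ≤
        B * (Real.exp (-2 * t) * ∑ k, Real.exp (-|x - oddSpec N k ^ 2 * t| / 2)) := by
  refine ⟨Real.exp (∑ k, |β k|), (Real.exp_pos _).le, fun t x ht => ?_⟩
  set κ := oddSpec N
  set r : Fin N → ℝ := fun k => |x - κ k ^ 2 * t| with hr
  -- The soliton nearest to x selects the edge. Every other soliton is then at distance at least 4t,
  -- half the minimal separation 8t.
  obtain ⟨j, -, hj⟩ := Finset.exists_min_image Finset.univ r Finset.univ_nonempty
  refine ⟨j, (pi_norm_le_iff_of_nonneg (by positivity)).2 fun k => ?_⟩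
  have hβ : |β k| ≤ ∑ k, |β k| :=
    Finset.single_le_sum (f := fun k => |β k|) (fun _ _ => abs_nonneg _) (Finset.mem_univ k)
  have hmem := logistic_mem κ β t x
  have hrj := hj k (Finset.mem_univ k)
  have hκ := oddSpec_pos k
  -- Half of the exponent r_k ≥ 4t yields e^{-2t}; the other half is kept as spatial decay. The
  -- factor κ_k ≥ 1 is dropped.
  have main : k ≠ j → 4 * t ≤ r k → ∀ y, y ≤ -(κ k * r k) + |β k| →
      Real.exp y ≤ Real.exp (∑ k, |β k|) * (Real.exp (-2 * t) * ∑ k, Real.exp (-(r k) / 2)) := by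
    intro _ h4 y hy
    have h5 : Real.exp (-(r k) / 2) ≤ ∑ k, Real.exp (-(r k) / 2) :=
      Finset.single_le_sum (f := fun k => Real.exp (-(r k) / 2))
        (fun _ _ => (Real.exp_pos _).le) (Finset.mem_univ k)
    have h6 : y ≤ (∑ k, |β k|) + (-2 * t + -(r k) / 2) := by
      have : r k ≤ κ k * r k := le_mul_of_one_le_left (abs_nonneg _) hκ
      linarith
    refine (Real.exp_le_exp.2 h6).trans ?_
    rw [Real.exp_add, Real.exp_add]
    gcongr
  rw [Pi.sub_apply, edgeProj_apply]
  rcases lt_trichotomy k j with hk | hk | hk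
  -- A slower soliton k < j lies behind x, so its coordinate is close to 1; symmetrically,
  -- coordinates k > j are close to 0.
  · have hsq := oddSpec_sq_sub hk
    have hmul : κ k ^ 2 * t + 8 * t ≤ κ j ^ 2 * t := by nlinarith
    have hx : κ k ^ 2 * t ≤ x := by
      by_contra hcon
      push Not at hcon
      simp only [hr] at hrj
      rw [abs_of_neg (by linarith), abs_of_neg (by linarith)] at hrj
      linarith
    have hrk : r k = x - κ k ^ 2 * t := abs_of_nonneg (by linarith)
    have h4 : 4 * t ≤ r k := by
      have : r j ≥ κ j ^ 2 * t - x := by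
        have := neg_abs_le (x - κ j ^ 2 * t); simp only [hr]; linarith
      linarith
    rw [if_pos hk, Real.norm_eq_abs, abs_sub_comm,
      abs_of_nonneg (sub_nonneg.2 (show logistic κ β t x k ≤ 1 from hmem.2 k))]
    refine (one_sub_logistic_le_exp κ β t x k).trans (main hk.ne h4 _ ?_)
    rw [hrk]
    have := neg_abs_le (β k)
    nlinarith
  · subst hk
    simp only [lt_irrefl, if_false, if_true, sub_self, norm_zero]
    positivity
  · have hsq := oddSpec_sq_sub hk
    have hmul : κ j ^ 2 * t + 8 * t ≤ κ k ^ 2 * t := by nlinarith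
    have hx : x ≤ κ k ^ 2 * t := by
      by_contra hcon
      push Not at hcon
      simp only [hr] at hrj
      rw [abs_of_pos (by linarith), abs_of_pos (by linarith)] at hrj
      linarith
    have hrk : r k = -(x - κ k ^ 2 * t) := abs_of_nonpos (by linarith)
    have h4 : 4 * t ≤ r k := by
      have : r j ≥ x - κ j ^ 2 * t := le_abs_self _
      linarith
    rw [if_neg hk.not_gt, if_neg hk.ne', sub_zero, Real.norm_eq_abs,
      abs_of_pos (logistic_pos κ β t x k)]
    refine (logistic_le_exp κ β t x k).trans (main hk.ne' h4 _ ?_)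
    rw [hrk]
    have := le_abs_self (β k)
    nlinarith

/-- With E = e^{-θ}, the edge profile is a sech in which g only shifts the phase by log g. -/
lemma one_soliton_profile {κ g E : ℝ} (hg : 0 < g) (hE : 0 < E) :
    2 * κ * g * ((1 + E)⁻¹ * (1 - (1 + E)⁻¹)) /
      (((1 + E)⁻¹) ^ 2 + g ^ 2 * (1 - (1 + E)⁻¹) ^ 2) = κ / Real.cosh (-Real.log E - Real.log g) := by
  have h1 : -Real.log E - Real.log g = -Real.log (E * g) := by
    rw [Real.log_mul hE.ne' hg.ne']; ring
  have h2 : 1 - (1 + E)⁻¹ = E * (1 + E)⁻¹ := by field_simp; ring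
  rw [h1, Real.cosh_neg, Real.cosh_log (mul_pos hE hg), h2]
  have : 1 + E ≠ 0 := by positivity
  field_simp
  ring

/-- Soliton resolution: the multisoliton separates into a sum of solitons. -/
theorem soliton_resolution [Nonempty (Fin N)] (β : Fin N → ℝ) : ∃ δ : Fin N → ℝ, ∀ n : ℕ,
    ∃ C : ℝ, 0 ≤ C ∧ ∀ t : ℝ, 0 < t →
    ContDiff ℝ ∞ (fun y => cubePotential (oddSpec N) (logistic (oddSpec N) β t y) -
      ∑ j, oddSpec N j / Real.cosh (oddSpec N j * y - oddSpec N j ^ 3 * t + δ j)) ∧ ∀ x : ℝ,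
    |iteratedDeriv n (fun y => cubePotential (oddSpec N) (logistic (oddSpec N) β t y) -
      ∑ j, oddSpec N j / Real.cosh (oddSpec N j * y - oddSpec N j ^ 3 * t + δ j)) x| ≤
      C * (Real.exp (-2 * t) * ∑ k, Real.exp (-|x - oddSpec N k ^ 2 * t| / 2)) := by
  set κ := oddSpec N
  have hκ : GramPos κ := gramPos_oddSpec N
  have hpos : ∀ j, 0 < κ j := fun j => zero_lt_one.trans_le (oddSpec_pos j)
  have hsm := cubeSmooth_cubePotential hκ
  choose g hg hedge using fun j : Fin N => cubePotential_edge hκ hpos (Finset.Iio j) (j := j) (by simp)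
  obtain ⟨B, hB, hdist⟩ := norm_logistic_sub_edgeProj_le β
  refine ⟨fun j => β j - Real.log (g j), fun n => ?_⟩
  have hsol : ∀ (t y : ℝ) (j : Fin N), cubePotential κ (edgeProj j (logistic κ β t y)) =
      κ j / Real.cosh (κ j * y - κ j ^ 3 * t + (β j - Real.log (g j))) := by
    intro t y j
    have hm := logistic_mem κ β t y
    rw [edgeProj, hedge j _ ⟨hm.1 j, hm.2 j⟩, logistic,
      one_soliton_profile (hg j) (expPhase_pos κ β t y j), expPhase, Real.log_exp]
    congr 2; ring
  have hz : ∀ σ : ℝ, σ = 0 ∨ σ = 1 → ∀ j, cubePotential κ (edgePoint (Finset.Iio j) j σ) = 0 := by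
    intro σ hσ j
    rw [hedge j σ (by rcases hσ with h | h <;> simp [h])]
    rcases hσ with h | h <;> simp [h]
  obtain ⟨L, hL, hsub⟩ := sub_sum_edgeProj_le (hsm.iterate κ n)
    (fun j => iterate_logisticDeriv_edgePoint (Or.inl rfl) (hz 0 (Or.inl rfl) j) n)
    (fun j => iterate_logisticDeriv_edgePoint (Or.inr rfl) (hz 1 (Or.inr rfl) j) n)
  refine ⟨L * B, by positivity, fun t ht => ?_⟩
  have hcd : ContDiff ℝ ∞ (fun y => cubePotential κ (logistic κ β t y)) :=
    contDiff_comp_logistic hsm κ β t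
  have hmem : ∀ j y, edgeProj j (logistic κ β t y) ∈ Icc (0 : Fin N → ℝ) 1 :=
    fun j y => edgeProj_mem j (logistic_mem κ β t y)
  have hcdj : ∀ j, ContDiff ℝ ∞ (fun y => cubePotential κ (edgeProj j (logistic κ β t y))) :=
    fun j => contDiff_comp_curve hsm κ (hmem j) (hasDerivAt_edgeProj_logistic κ β j t)
  have hfun : (fun y => cubePotential κ (logistic κ β t y) -
      ∑ j, κ j / Real.cosh (κ j * y - κ j ^ 3 * t + (β j - Real.log (g j)))) =
      (fun y => cubePotential κ (logistic κ β t y)) - fun y =>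
        ∑ j, cubePotential κ (edgeProj j (logistic κ β t y)) := by
    funext y
    simp only [Pi.sub_apply, hsol]
  have hcds : ContDiff ℝ ∞ (fun y => ∑ j, cubePotential κ (edgeProj j (logistic κ β t y))) :=
    ContDiff.sum fun j _ => hcdj j
  rw [hfun]
  refine ⟨hcd.sub hcds, fun x => ?_⟩
  have hn : ((n : ℕ∞) : WithTop ℕ∞) ≤ ((⊤ : ℕ∞) : WithTop ℕ∞) := by exact_mod_cast le_top
  rw [iteratedDeriv_sub (hcd.contDiffAt.of_le hn) (hcds.contDiffAt.of_le hn),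
    iteratedDeriv_comp_logistic hsm, iteratedDeriv_fun_sum fun j _ => (hcdj j).contDiffAt.of_le hn]
  simp only [iteratedDeriv_comp_curve hsm κ (hmem _) (hasDerivAt_edgeProj_logistic κ β _ t)]
  obtain ⟨j, hj⟩ := hdist t x ht
  refine (hsub _ (logistic_mem κ β t x) j).trans ?_
  rw [mul_assoc]
  exact mul_le_mul_of_nonneg_left hj hL

end resolution

end MKdV

/-! ### Uniqueness by an energy estimate -/

namespace MKdV

open Set SchwartzMap

section uniqueness

/-- Seminorms are bounded on compact time intervals; the weight 1 + x² later provides an integrable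
majorant. -/
lemma exists_curve_bound {u : ℝ → 𝓢(ℝ, ℝ)} (hu : Continuous u) (n : ℕ) (T : ℝ) :
    ∃ C : ℝ, 0 ≤ C ∧ ∀ t, |t| ≤ T → ∀ x, (1 + x ^ 2) * |iteratedDeriv n (u t) x| ≤ C := by
  have hc : Continuous fun t => SchwartzMap.seminorm ℝ 0 n (u t) + SchwartzMap.seminorm ℝ 2 n (u t) :=
    (((schwartz_withSeminorms ℝ ℝ ℝ).continuous_seminorm (0, n)).comp hu).add
      (((schwartz_withSeminorms ℝ ℝ ℝ).continuous_seminorm (2, n)).comp hu)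
  obtain ⟨C, hC⟩ := (isCompact_Icc (a := -T) (b := T)).exists_bound_of_continuousOn hc.continuousOn
  refine ⟨max C 0, le_max_right _ _, fun t ht x => ?_⟩
  have h1 := hC t (abs_le.1 ht)
  have h2 := SchwartzMap.le_seminorm' ℝ 0 n (u t) x
  have h3 := SchwartzMap.le_seminorm' ℝ 2 n (u t) x
  rw [pow_zero, one_mul, Real.norm_eq_abs] at h2
  rw [sq_abs, Real.norm_eq_abs] at h3
  rw [Real.norm_eq_abs] at h1
  refine le_trans ?_ (le_max_left _ _)
  have := le_abs_self (SchwartzMap.seminorm ℝ 0 n (u t) + SchwartzMap.seminorm ℝ 2 n (u t))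
  nlinarith

/-- Pointwise multiplication of Schwartz functions. -/
def schwartzMul (f g : 𝓢(ℝ, ℝ)) : 𝓢(ℝ, ℝ) := SchwartzMap.pairing (ContinuousLinearMap.mul ℝ ℝ) f g

@[simp] lemma schwartzMul_apply (f g : 𝓢(ℝ, ℝ)) (x : ℝ) : schwartzMul f g x = f x * g x := rfl

lemma integral_deriv_schwartz (f : 𝓢(ℝ, ℝ)) : ∫ x, deriv f x = 0 :=
  integral_eq_zero_of_hasDerivAt_of_integrable (fun x => f.hasDerivAt x)
    (SchwartzMap.derivCLM ℝ ℝ f).integrable f.integrable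

/-- The energy identity for the difference of two solutions. -/
lemma energy_identity (f h : 𝓢(ℝ, ℝ)) :
    ∫ x, 2 * (f x - h x) * ((-iteratedDeriv 3 f x - 6 * f x ^ 2 * deriv f x) -
      (-iteratedDeriv 3 h x - 6 * h x ^ 2 * deriv h x)) =
    -2 * ∫ x, (f x - h x) ^ 2 * (2 * f x * deriv f x + deriv f x * h x + f x * deriv h x +
      2 * h x * deriv h x) := by
  set D : 𝓢(ℝ, ℝ) →L[ℝ] 𝓢(ℝ, ℝ) := SchwartzMap.derivCLM ℝ ℝ
  have hD : ∀ g : 𝓢(ℝ, ℝ), ∀ x, deriv g x = D g x := fun g x => rfl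
  have hD' : ∀ g : 𝓢(ℝ, ℝ), deriv g = D g := fun g => rfl
  have h3 : ∀ g : 𝓢(ℝ, ℝ), ∀ x, iteratedDeriv 3 g x = D (D (D g)) x := by
    intro g x
    rw [iteratedDeriv_succ, iteratedDeriv_succ, iteratedDeriv_one, hD', hD', hD']
  set w := f - h with hw
  have hwx : ∀ x, w x = f x - h x := fun x => rfl
  set q := schwartzMul f f + schwartzMul f h + schwartzMul h h with hq
  have hqx : ∀ x, q x = f x * f x + f x * h x + h x * h x := fun x => rfl
  -- The flux. With 6f²f' = 2(f³)' and f³ - h³ = wq, the integrand of the energy identity is -J' -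
  -- 2w²q'.
  set J := (2 : ℝ) • schwartzMul w (D (D w)) - schwartzMul (D w) (D w) +
    (2 : ℝ) • schwartzMul (schwartzMul w w) q with hJ
  have hd : ∀ (g : 𝓢(ℝ, ℝ)) x, HasDerivAt g (D g x) x := fun g x => g.hasDerivAt x
  have hDw : D w = D f - D h := map_sub D f h
  have hDDDw : D (D (D w)) = D (D (D f)) - D (D (D h)) := by rw [hDw, map_sub, map_sub]
  have hDq : ∀ x, D q x = 2 * f x * D f x + D f x * h x + f x * D h x + 2 * h x * D h x := by
    intro x
    have : HasDerivAt q (D f x * f x + f x * D f x + (D f x * h x + f x * D h x) +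
        (D h x * h x + h x * D h x)) x :=
      (((hd f x).mul (hd f x)).add ((hd f x).mul (hd h x))).add ((hd h x).mul (hd h x))
    rw [(hd q x).unique this]; ring
  have hJd : ∀ x, deriv J x = 2 * (w x * D (D (D w)) x) + 4 * (w x * D w x * q x) +
      2 * (w x ^ 2 * D q x) := by
    intro x
    have : HasDerivAt J (2 * (D w x * D (D w) x + w x * D (D (D w)) x) -
        (D (D w) x * D w x + D w x * D (D w) x) +
        2 * ((D w x * w x + w x * D w x) * q x + w x * w x * D q x)) x :=
      ((((hd w x).mul (hd (D (D w)) x)).const_mul 2).sub ((hd (D w) x).mul (hd (D w) x))).add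
        ((((hd w x).mul (hd w x)).mul (hd q x)).const_mul 2)
    rw [this.deriv]; ring
  have hpt : ∀ x, 2 * (f x - h x) * ((-iteratedDeriv 3 f x - 6 * f x ^ 2 * deriv f x) -
      (-iteratedDeriv 3 h x - 6 * h x ^ 2 * deriv h x)) =
      -(deriv J x) + -2 * ((f x - h x) ^ 2 * (2 * f x * deriv f x + deriv f x * h x +
        f x * deriv h x + 2 * h x * deriv h x)) := by
    intro x
    have e1 : D (D (D w)) x = D (D (D f)) x - D (D (D h)) x := by rw [hDDDw]; rfl
    have e2 : D w x = D f x - D h x := by rw [hDw]; rfl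
    rw [hJd, hDq, hwx, hqx, e1, e2, h3, h3, hD, hD]
    ring
  simp only [hpt]
  have i1 : Integrable (fun x => -deriv J x) := (D J).integrable.neg
  have i2 : Integrable (fun x => (f x - h x) ^ 2 * (2 * f x * deriv f x + deriv f x * h x +
        f x * deriv h x + 2 * h x * deriv h x)) := by
    have := (schwartzMul (schwartzMul w w) (D q)).integrable (μ := volume)
    refine this.congr (Filter.Eventually.of_forall fun x => ?_)
    simp only [schwartzMul_apply, hDq, hwx, hD]
    ring
  rw [integral_add i1 (i2.const_mul _), integral_neg, integral_deriv_schwartz, neg_zero,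
    zero_add, integral_const_mul]

/-- Differentiation under the integral: the factor u - v supplies the decay (1 + x²)⁻¹, so the other
factor need only be bounded. -/
lemma hasDerivAt_energy {u v : ℝ → 𝓢(ℝ, ℝ)} (hu : IsSchwartzSolutionMKdV u)
    (hv : IsSchwartzSolutionMKdV v) (t : ℝ) :
    HasDerivAt (fun τ => ∫ x, (u τ x - v τ x) ^ 2)
      (∫ x, 2 * (u t x - v t x) * ((-iteratedDeriv 3 (u t) x - 6 * u t x ^ 2 * deriv (u t) x) -
      (-iteratedDeriv 3 (v t) x - 6 * v t x ^ 2 * deriv (v t) x))) t := by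
  have key : ∀ {u : ℝ → 𝓢(ℝ, ℝ)}, IsSchwartzSolutionMKdV u → ∃ C : ℝ, 0 ≤ C ∧
      ∀ τ ∈ Ioo (t - 1) (t + 1), ∀ x, (1 + x ^ 2) * |u τ x| ≤ C ∧
      |-iteratedDeriv 3 (u τ) x - 6 * u τ x ^ 2 * deriv (u τ) x| ≤ C := by
    intro u hu
    obtain ⟨C0, h0, b0⟩ := exists_curve_bound hu.continuous 0 (|t| + 1)
    obtain ⟨C1, h1, b1⟩ := exists_curve_bound hu.continuous 1 (|t| + 1)
    obtain ⟨C3, h3, b3⟩ := exists_curve_bound hu.continuous 3 (|t| + 1)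
    refine ⟨C0 + (C3 + 6 * C0 ^ 2 * C1), by positivity, fun τ hτ x => ?_⟩
    have hτ' : |τ| ≤ |t| + 1 := by
      have e1 : |τ - t| ≤ 1 := abs_le.2 ⟨by linarith [hτ.1], by linarith [hτ.2]⟩
      have e2 := abs_add_le (τ - t) t
      rw [sub_add_cancel] at e2
      linarith
    have c0 := b0 τ hτ' x
    have c1 := b1 τ hτ' x
    have c3 := b3 τ hτ' x
    rw [iteratedDeriv_zero] at c0
    rw [iteratedDeriv_one] at c1
    have hle : ∀ y : ℝ, |y| ≤ (1 + x ^ 2) * |y| := fun y =>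
      le_mul_of_one_le_left (abs_nonneg _) (by nlinarith [sq_nonneg x])
    refine ⟨c0.trans (by linarith [show 0 ≤ C3 + 6 * C0 ^ 2 * C1 by positivity]), ?_⟩
    have d0 := (hle _).trans c0
    have d1 := (hle _).trans c1
    have d3 := (hle _).trans c3
    calc _ ≤ |-iteratedDeriv 3 (u τ) x| + |6 * u τ x ^ 2 * deriv (u τ) x| := abs_sub _ _
      _ = |iteratedDeriv 3 (u τ) x| + 6 * |u τ x| ^ 2 * |deriv (u τ) x| := by
        rw [abs_neg, abs_mul, abs_mul, abs_pow]; simp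
      _ ≤ C3 + 6 * C0 ^ 2 * C1 := by gcongr
      _ ≤ _ := by linarith
  obtain ⟨A, hA, a⟩ := key hu
  obtain ⟨B, hB, b⟩ := key hv
  have cont : ∀ τ, Continuous fun x => u τ x - v τ x := fun τ =>
    (u τ).continuous.sub (v τ).continuous
  have c3 : ∀ f : 𝓢(ℝ, ℝ), Continuous (iteratedDeriv 3 f) := fun f =>
    (f.smooth 3).continuous_iteratedDeriv 3 (by norm_num)
  have c1 : ∀ f : 𝓢(ℝ, ℝ), Continuous (deriv f) := fun f =>
    (SchwartzMap.derivCLM ℝ ℝ f).continuous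
  refine (hasDerivAt_integral_of_dominated_loc_of_deriv_le (μ := volume)
    (s := Ioo (t - 1) (t + 1))
    (F := fun τ x => (u τ x - v τ x) ^ 2)
    (F' := fun τ x => 2 * (u τ x - v τ x) *
      ((-iteratedDeriv 3 (u τ) x - 6 * u τ x ^ 2 * deriv (u τ) x) -
      (-iteratedDeriv 3 (v τ) x - 6 * v τ x ^ 2 * deriv (v τ) x)))
    (bound := fun x => (2 * (A + B) * (A + B)) * (1 + x ^ 2)⁻¹)
    (Ioo_mem_nhds (by linarith) (by linarith)) ?_ ?_ ?_ ?_ ?_ ?_).2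
  · exact Filter.Eventually.of_forall fun τ => ((cont τ).pow 2).aestronglyMeasurable
  · have := (schwartzMul (u t - v t) (u t - v t)).integrable (μ := volume)
    refine this.congr (Filter.Eventually.of_forall fun x => ?_)
    simp only [schwartzMul_apply, sub_apply]
    ring
  · have := c3 (u t)
    have := c3 (v t)
    have := c1 (u t)
    have := c1 (v t)
    have := (u t).continuous
    have := (v t).continuous
    exact Continuous.aestronglyMeasurable (by fun_prop)
  · refine Filter.Eventually.of_forall fun x τ hτ => ?_
    obtain ⟨a1, a2⟩ := a τ hτ x
    obtain ⟨b1, b2⟩ := b τ hτ x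
    have hx : 0 < 1 + x ^ 2 := by positivity
    have e1 : |u τ x - v τ x| ≤ (A + B) * (1 + x ^ 2)⁻¹ := by
      rw [← div_eq_mul_inv, le_div_iff₀ hx]
      have := abs_sub (u τ x) (v τ x)
      nlinarith
    rw [Real.norm_eq_abs, abs_mul, abs_mul, abs_two]
    calc _ ≤ 2 * ((A + B) * (1 + x ^ 2)⁻¹) * (A + B) := by
          gcongr
          exact (abs_sub _ _).trans (add_le_add a2 b2)
      _ = _ := by ring
  · exact integrable_inv_one_add_sq.const_mul _
  · refine Filter.Eventually.of_forall fun x τ _ => ?_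
    have := ((hu.equation τ x).sub (hv.equation τ x)).pow 2
    refine this.congr_deriv ?_
    simp

/-- Schwartz solutions of mKdV are determined by their initial data. -/
theorem schwartz_solution_unique {u v : ℝ → 𝓢(ℝ, ℝ)} (hu : IsSchwartzSolutionMKdV u)
    (hv : IsSchwartzSolutionMKdV v) (h0 : ∀ x, u 0 x = v 0 x) : u = v := by
  set E : ℝ → ℝ := fun τ => ∫ x, (u τ x - v τ x) ^ 2 with hE
  have hE0 : E 0 = 0 := by simp [hE, h0]
  have hEn : ∀ t, 0 ≤ E t := fun t => integral_nonneg fun x => sq_nonneg _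
  have hint : ∀ t, Integrable fun x => (u t x - v t x) ^ 2 := by
    intro t
    have := (schwartzMul (u t - v t) (u t - v t)).integrable (μ := volume)
    refine this.congr (Filter.Eventually.of_forall fun x => ?_)
    simp only [schwartzMul_apply, sub_apply]
    ring
  have hbound : ∀ T : ℝ, ∃ K : ℝ, ∀ t, |t| ≤ T → ∃ E', HasDerivAt E E' t ∧ |E'| ≤ K * |E t| := by
    intro T
    obtain ⟨A0, hA0, a0⟩ := exists_curve_bound hu.continuous 0 T
    obtain ⟨A1, hA1, a1⟩ := exists_curve_bound hu.continuous 1 T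
    obtain ⟨B0, hB0, b0⟩ := exists_curve_bound hv.continuous 0 T
    obtain ⟨B1, hB1, b1⟩ := exists_curve_bound hv.continuous 1 T
    set M := 2 * A0 * A1 + A1 * B0 + A0 * B1 + 2 * B0 * B1 with hM
    refine ⟨2 * M, fun t ht => ⟨_, hasDerivAt_energy hu hv t, ?_⟩⟩
    rw [energy_identity, abs_mul, abs_of_nonneg (hEn t), mul_assoc, abs_neg, abs_two]
    refine mul_le_mul_of_nonneg_left ?_ zero_le_two
    rw [hE, ← integral_const_mul, ← Real.norm_eq_abs]
    refine norm_integral_le_of_norm_le ((hint t).const_mul M)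
      (Filter.Eventually.of_forall fun x => ?_)
    have hle : ∀ y : ℝ, |y| ≤ (1 + x ^ 2) * |y| := fun y =>
      le_mul_of_one_le_left (abs_nonneg _) (by nlinarith [sq_nonneg x])
    have d1 := (hle _).trans (a0 t ht x)
    have d2 := (hle _).trans (a1 t ht x)
    have d3 := (hle _).trans (b0 t ht x)
    have d4 := (hle _).trans (b1 t ht x)
    rw [iteratedDeriv_zero] at d1 d3
    rw [iteratedDeriv_one] at d2 d4
    rw [Real.norm_eq_abs, abs_mul, abs_of_nonneg (sq_nonneg _), mul_comm M]
    refine mul_le_mul_of_nonneg_left ?_ (sq_nonneg _)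
    calc _ ≤ |2 * u t x * deriv (u t) x| + |deriv (u t) x * v t x| + |u t x * deriv (v t) x| +
          |2 * v t x * deriv (v t) x| := by
          refine (abs_add_le _ _).trans (add_le_add ?_ le_rfl)
          exact abs_add_three _ _ _
      _ = 2 * |u t x| * |deriv (u t) x| + |deriv (u t) x| * |v t x| + |u t x| * |deriv (v t) x| +
          2 * |v t x| * |deriv (v t) x| := by
          simp only [abs_mul, abs_two]
      _ ≤ M := by rw [hM]; gcongr
  have hzero : ∀ t, E t = 0 := by
    -- The Gronwall-type criterion runs forward from 0; ε = -1 reflects time to treat negative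
    -- times.
    have dir : ∀ ε : ℝ, ε = 1 ∨ ε = -1 → ∀ T : ℝ, 0 ≤ T → E (ε * T) = 0 := by
      intro ε hε T hT
      obtain ⟨K, hK⟩ := hbound T
      have habs : ∀ s, |ε * s| = |s| := by
        intro s; rcases hε with h | h <;> simp [h]
      have hK' : ∀ s, ∃ E', |ε * s| ≤ T → HasDerivAt E E' (ε * s) ∧ |E'| ≤ K * |E (ε * s)| := by
        intro s
        by_cases hs : |ε * s| ≤ T
        · obtain ⟨E', h⟩ := hK _ hs
          exact ⟨E', fun _ => h⟩
        · exact ⟨0, fun h => absurd h hs⟩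
      choose E' hE' using hK'
      have hmem : ∀ s ∈ Icc 0 T, |ε * s| ≤ T := by
        intro s hs
        rw [habs, abs_of_nonneg hs.1]
        exact hs.2
      have hder : ∀ s ∈ Icc 0 T, HasDerivAt (fun s => E (ε * s)) (E' s * ε) s := by
        intro s hs
        exact (hE' s (hmem s hs)).1.comp s (by simpa using (hasDerivAt_id s).const_mul ε)
      refine eq_zero_of_abs_deriv_le_mul_abs_self_of_eq_zero_right (f := fun s => E (ε * s))
        (f' := fun s => E' s * ε) (K := K) (a := 0) (b := T)
        (fun s hs => (hder s hs).continuousAt.continuousWithinAt)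
        (fun s hs => (hder s (Ico_subset_Icc_self hs)).hasDerivWithinAt) (by simpa using hE0)
        (fun s hs => ?_) T ⟨hT, le_rfl⟩
      have h1 := (hE' s (hmem s (Ico_subset_Icc_self hs))).2
      have h2 : |ε| = 1 := by rcases hε with h | h <;> simp [h]
      rw [Real.norm_eq_abs, Real.norm_eq_abs, abs_mul, h2, mul_one]
      exact h1
    intro t
    rcases le_total 0 t with h | h
    · simpa using dir 1 (Or.inl rfl) t h
    · simpa using dir (-1) (Or.inr rfl) (-t) (by linarith)
  funext t
  ext x
  have h1 := (integral_eq_zero_iff_of_nonneg (fun x => sq_nonneg _) (hint t)).1 (hzero t)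
  have h2 : (fun x => (u t x - v t x) ^ 2) = fun _ => 0 :=
    (Continuous.ae_eq_iff_eq volume (by
      have := (u t).continuous
      have := (v t).continuous
      fun_prop) continuous_const).1 h1
  have h3 := congrFun h2 x
  exact sub_eq_zero.1 (pow_eq_zero_iff two_ne_zero |>.1 h3)

end uniqueness

end MKdV

namespace MKdV

/-! ### Coincidences between sums of two squares -/

/-- Quadruples in `[1, M]` with equal products. -/
def equalProducts (M : ℕ) : Finset (ℕ × ℕ × ℕ × ℕ) :=
  (Finset.Icc 1 M ×ˢ Finset.Icc 1 M ×ˢ Finset.Icc 1 M ×ˢ Finset.Icc 1 M).filter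
    fun q => q.1 * q.2.1 = q.2.2.1 * q.2.2.2

lemma mem_equalProducts {M u v w z : ℕ} : (u, v, w, z) ∈ equalProducts M ↔
    (1 ≤ u ∧ u ≤ M) ∧ (1 ≤ v ∧ v ≤ M) ∧ (1 ≤ w ∧ w ≤ M) ∧ (1 ≤ z ∧ z ≤ M) ∧ u * v = w * z := by
  simp only [equalProducts, Finset.mem_filter, Finset.mem_product, Finset.mem_Icc]
  tauto

/-- If uv = wz, write u = ga and w = gb with a, b coprime; then v = br and z = ar. For given a and
b, both g and r are at most M / max a b. -/
lemma card_equalProducts_le (M : ℕ) : (equalProducts M).card ≤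
    ∑ a ∈ Finset.Icc 1 M, ∑ b ∈ Finset.Icc 1 M, (M / max a b) ^ 2 := by
  set S : Finset ((_ : ℕ × ℕ) × (ℕ × ℕ)) := (Finset.Icc 1 M ×ˢ Finset.Icc 1 M).sigma
    (fun ab => Finset.Icc 1 (M / max ab.1 ab.2) ×ˢ Finset.Icc 1 (M / max ab.1 ab.2)) with hS
  have hcard : S.card = ∑ a ∈ Finset.Icc 1 M, ∑ b ∈ Finset.Icc 1 M, (M / max a b) ^ 2 := by
    rw [hS, Finset.card_sigma, Finset.sum_product]
    refine Finset.sum_congr rfl fun a _ => Finset.sum_congr rfl fun b _ => ?_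
    rw [Finset.card_product, Nat.card_Icc, sq]
    simp
  rw [← hcard]
  refine (Finset.card_le_card ?_).trans (Finset.card_image_le (s := S)
    (f := fun q => (q.2.1 * q.1.1, q.2.2 * q.1.2, q.2.1 * q.1.2, q.2.2 * q.1.1)))
  rintro ⟨u, v, w, z⟩ hq
  obtain ⟨⟨hu1, hu⟩, ⟨hv1, hv⟩, ⟨hw1, hw⟩, ⟨hz1, hz⟩, h⟩ := mem_equalProducts.1 hq
  obtain ⟨g, a, b, hg, hcop, rfl, rfl⟩ := Nat.exists_coprime' (m := u) (n := w)
    (Nat.gcd_pos_of_pos_left _ hu1)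
  have ha : 0 < a := Nat.pos_of_mul_pos_right hu1
  have hb : 0 < b := Nat.pos_of_mul_pos_right hw1
  have h' : a * v = b * z := by
    have : g * (a * v) = g * (b * z) := by linarith
    exact Nat.eq_of_mul_eq_mul_left hg this
  obtain ⟨r, rfl⟩ : b ∣ v := (hcop.symm).dvd_of_dvd_mul_left ⟨z, h'⟩
  have hz' : z = a * r := by
    have : b * (a * r) = b * z := by rw [← h']; ring
    exact (Nat.eq_of_mul_eq_mul_left hb this).symm
  subst hz'
  have hr : 0 < r := Nat.pos_of_mul_pos_left hv1
  refine Finset.mem_image.2 ⟨⟨(a, b), (g, r)⟩, ?_, by simp [mul_comm]⟩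
  simp only [hS, Finset.mem_sigma, Finset.mem_product, Finset.mem_Icc]
  have hmax : 0 < max a b := lt_max_of_lt_left ha
  refine ⟨⟨⟨ha, ?_⟩, hb, ?_⟩, ⟨hg, ?_⟩, hr, ?_⟩
  · exact (Nat.le_mul_of_pos_right a hg).trans hu
  · exact (Nat.le_mul_of_pos_right b hg).trans hw
  · rw [Nat.le_div_iff_mul_le hmax]
    rcases max_choice a b with e | e <;> rw [e, mul_comm] <;> assumption
  · rw [Nat.le_div_iff_mul_le hmax]
    rcases max_choice a b with e | e <;> rw [e, mul_comm] <;> assumption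

/-- As max(a, b)² ≥ ab, the sum is at most M² times the square of a harmonic sum, and the latter is
at most 5M^{1/4}. Trading the logarithm for a power is harmless: later only an exponent below 3 is
needed. -/
lemma card_equalProducts_le_rpow {M : ℕ} (hM : 1 ≤ M) :
    ((equalProducts M).card : ℝ) ≤ 25 * (M : ℝ) ^ (5 / 2 : ℝ) := by
  have hM' : (1 : ℝ) ≤ M := by exact_mod_cast hM
  have h1 : ((equalProducts M).card : ℝ) ≤
      (M : ℝ) ^ 2 * (∑ a ∈ Finset.Icc 1 M, (a : ℝ)⁻¹) ^ 2 := by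
    refine (Nat.cast_le.2 (card_equalProducts_le M)).trans ?_
    push_cast
    rw [sq (∑ a ∈ Finset.Icc 1 M, (a : ℝ)⁻¹), Finset.sum_mul_sum, Finset.mul_sum]
    refine Finset.sum_le_sum fun a ha => ?_
    rw [Finset.mul_sum]
    refine Finset.sum_le_sum fun b hb => ?_
    have ha1 : (1 : ℝ) ≤ a := by exact_mod_cast (Finset.mem_Icc.1 ha).1
    have hb1 : (1 : ℝ) ≤ b := by exact_mod_cast (Finset.mem_Icc.1 hb).1
    have h2 : ((M / max a b : ℕ) : ℝ) ≤ M / max (a : ℝ) b := by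
      refine Nat.cast_div_le.trans ?_
      rw [Nat.cast_max]
    have hmax : 0 < max (a : ℝ) b := lt_max_of_lt_left (by linarith)
    calc ((M / max a b : ℕ) : ℝ) ^ 2 ≤ (M / max (a : ℝ) b) ^ 2 := by gcongr
      _ = (M : ℝ) ^ 2 * (max (a : ℝ) b * max (a : ℝ) b)⁻¹ := by rw [div_pow, sq (max _ _)]; rfl
      _ ≤ (M : ℝ) ^ 2 * ((a : ℝ) * b)⁻¹ := by
        gcongr
        · exact le_max_left _ _
        · exact le_max_right _ _
      _ = _ := by rw [mul_inv]
  have h2 : ∑ a ∈ Finset.Icc 1 M, (a : ℝ)⁻¹ ≤ 5 * (M : ℝ) ^ (1 / 4 : ℝ) := by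
    have h3 := harmonic_le_one_add_log M
    rw [harmonic_eq_sum_Icc] at h3
    push_cast at h3
    have h4 := Real.log_le_rpow_div (x := M) (ε := 1 / 4) (by linarith) (by norm_num)
    have h5 : (1 : ℝ) ≤ (M : ℝ) ^ (1 / 4 : ℝ) := Real.one_le_rpow hM' (by norm_num)
    linarith
  have h0 : 0 ≤ ∑ a ∈ Finset.Icc 1 M, (a : ℝ)⁻¹ := Finset.sum_nonneg fun a _ => by positivity
  calc _ ≤ (M : ℝ) ^ 2 * (∑ a ∈ Finset.Icc 1 M, (a : ℝ)⁻¹) ^ 2 := h1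
    _ ≤ (M : ℝ) ^ 2 * (5 * (M : ℝ) ^ (1 / 4 : ℝ)) ^ 2 := by gcongr
    _ = 25 * (M : ℝ) ^ (5 / 2 : ℝ) := by
      rw [mul_pow, ← Real.rpow_natCast ((M : ℝ) ^ (1 / 4 : ℝ)), ← Real.rpow_mul (by linarith),
        ← Real.rpow_natCast (M : ℝ) 2, mul_left_comm, ← Real.rpow_add (by linarith)]
      norm_num

/-- Quadruples of indices for which the sums of the squares of the spectral parameters agree. -/
def resonances (N : ℕ) : Finset (Fin N × Fin N × Fin N × Fin N) :=
  Finset.univ.filter fun q => oddSpec N q.1 ^ 2 - oddSpec N q.2.1 ^ 2 + oddSpec N q.2.2.1 ^ 2 -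
    oddSpec N q.2.2.2 ^ 2 = 0

lemma mem_resonances {N : ℕ} {j k l n : Fin N} : (j, k, l, n) ∈ resonances N ↔
    (j : ℕ) * (j + 1) + l * (l + 1) = k * (k + 1) + n * (n + 1) := by
  rw [resonances, Finset.mem_filter]
  simp only [Finset.mem_univ, true_and, oddSpec]
  constructor
  · intro h
    have : (j : ℝ) * (j + 1) + l * (l + 1) = k * (k + 1) + n * (n + 1) := by linarith
    exact_mod_cast this
  · intro h
    have : (j : ℝ) * (j + 1) + l * (l + 1) = k * (k + 1) + n * (n + 1) := by exact_mod_cast h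
    linarith

/-- For k < j the relation is (j - k)(j + k + 1) = (n - l)(n + l + 1), a coincidence of products of
numbers up to 2N whose factors determine the indices. The case j < k is symmetric, and j = k forces
l = n, giving at most N² solutions. The constant is 2 · 25 · 8 + 1, with 2^{5/2} ≤ 8. -/
theorem card_resonances_le {N : ℕ} (hN : 1 ≤ N) :
    ((resonances N).card : ℝ) ≤ 401 * (N : ℝ) ^ (5 / 2 : ℝ) := by
  set A := (resonances N).filter fun q => q.2.1 < q.1
  set B := (resonances N).filter fun q => q.1 < q.2.1
  set D := (resonances N).filter fun q => q.1 = q.2.1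
  have hun : resonances N ⊆ A ∪ B ∪ D := by
    intro q hq
    simp only [A, B, D, Finset.mem_union, Finset.mem_filter, hq, true_and]
    rcases lt_trichotomy q.1 q.2.1 with h | h | h <;> simp [h]
  have hD : D.card ≤ N ^ 2 := by
    have : D.card ≤ (Finset.univ : Finset (Fin N × Fin N)).card := by
      refine Finset.card_le_card_of_injOn (fun q => (q.1, q.2.2.1)) (fun _ _ => by simp) ?_
      rintro ⟨j, k, l, n⟩ h ⟨j', k', l', n'⟩ h' he
      have h := (Finset.mem_filter.1 (Finset.mem_coe.1 h))
      have h' := (Finset.mem_filter.1 (Finset.mem_coe.1 h'))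
      rw [mem_resonances] at h h'
      simp only [Prod.mk.injEq] at he h h'
      obtain ⟨h1, rfl⟩ := h
      obtain ⟨h2, rfl⟩ := h'
      obtain ⟨rfl, rfl⟩ := he
      have e1 : (l : ℕ) = n := by nlinarith
      have e2 : (l : ℕ) = n' := by nlinarith
      have : n = n' := Fin.ext (e1.symm.trans e2)
      rw [this]
    simpa [sq] using this
  have hA : A.card ≤ (equalProducts (2 * N)).card := by
    refine Finset.card_le_card_of_injOn (fun q => ((q.1 : ℕ) - q.2.1, (q.1 : ℕ) + q.2.1 + 1,
      (q.2.2.2 : ℕ) - q.2.2.1, (q.2.2.2 : ℕ) + q.2.2.1 + 1)) ?_ ?_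
    · rintro ⟨j, k, l, n⟩ h
      obtain ⟨h1, h2⟩ := (Finset.mem_filter.1 (Finset.mem_coe.1 h))
      rw [mem_resonances] at h1
      simp only [Fin.lt_def] at h2
      have h3 : (l : ℕ) < n := by nlinarith
      obtain ⟨a, ha⟩ := Nat.exists_eq_add_of_lt h2
      obtain ⟨b, hb⟩ := Nat.exists_eq_add_of_lt h3
      have := j.2
      have := n.2
      rw [Finset.mem_coe, mem_equalProducts]
      simp only
      refine ⟨by omega, by omega, by omega, by omega, ?_⟩
      rw [show (j : ℕ) - k = a + 1 by omega, show (n : ℕ) - l = b + 1 by omega]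
      rw [ha, hb] at h1 ⊢
      nlinarith
    · rintro ⟨j, k, l, n⟩ h ⟨j', k', l', n'⟩ h' he
      obtain ⟨h1, h2⟩ := (Finset.mem_filter.1 (Finset.mem_coe.1 h))
      obtain ⟨h1', h2'⟩ := (Finset.mem_filter.1 (Finset.mem_coe.1 h'))
      rw [mem_resonances] at h1 h1'
      simp only [Fin.lt_def] at h2 h2'
      have h3 : (l : ℕ) < n := by nlinarith
      have h3' : (l' : ℕ) < n' := by nlinarith
      simp only [Prod.mk.injEq] at he ⊢
      refine ⟨Fin.ext (by omega), Fin.ext (by omega), Fin.ext (by omega), Fin.ext (by omega)⟩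
  have hB : B.card ≤ A.card := by
    refine Finset.card_le_card_of_injOn (fun q => (q.2.1, q.1, q.2.2.2, q.2.2.1)) ?_ ?_
    · rintro ⟨j, k, l, n⟩ h
      obtain ⟨h1, h2⟩ := (Finset.mem_filter.1 (Finset.mem_coe.1 h))
      rw [mem_resonances] at h1
      simp only [A, Finset.mem_coe, Finset.mem_filter, mem_resonances]
      exact ⟨h1.symm, h2⟩
    · rintro ⟨j, k, l, n⟩ _ ⟨j', k', l', n'⟩ _ he
      simp only [Prod.mk.injEq] at he ⊢
      tauto
  have hcard : (resonances N).card ≤ 2 * (equalProducts (2 * N)).card + N ^ 2 := by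
    have h1 := Finset.card_le_card hun
    have h2 := Finset.card_union_le (A ∪ B) D
    have h3 := Finset.card_union_le A B
    omega
  have hN' : (1 : ℝ) ≤ N := by exact_mod_cast hN
  have h1 := card_equalProducts_le_rpow (M := 2 * N) (by omega)
  have h2 : ((2 * N : ℕ) : ℝ) ^ (5 / 2 : ℝ) ≤ 8 * (N : ℝ) ^ (5 / 2 : ℝ) := by
    push_cast
    rw [Real.mul_rpow zero_le_two (by linarith)]
    gcongr
    calc (2 : ℝ) ^ (5 / 2 : ℝ) ≤ (2 : ℝ) ^ (3 : ℝ) :=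
          Real.rpow_le_rpow_of_exponent_le one_le_two (by norm_num)
      _ = 8 := by norm_num
  have h3 : (N : ℝ) ^ 2 ≤ (N : ℝ) ^ (5 / 2 : ℝ) := by
    rw [← Real.rpow_natCast]
    exact Real.rpow_le_rpow_of_exponent_le hN' (by norm_num)
  have h4 : ((resonances N).card : ℝ) ≤ 2 * (equalProducts (2 * N)).card + (N : ℝ) ^ 2 := by
    exact_mod_cast hcard
  linarith

end MKdV

namespace MKdV

open Set Filter Topology
open scoped ContDiff FourierTransform

/-! ### The Fourier transform of real functions -/

/-- The Fourier transform of an arbitrary real function, normalised as `fourierHat`. -/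
def hatFn (f : ℝ → ℝ) (ξ : ℝ) : ℂ :=
  ((1 / Real.sqrt (2 * Real.pi) : ℝ) : ℂ) *
    ∫ x : ℝ, Complex.exp (-(Complex.I * (x : ℂ) * (ξ : ℂ))) * ((f x : ℝ) : ℂ)

lemma fourierHat_eq_hatFn (f : 𝓢(ℝ, ℝ)) : fourierHat f = hatFn f := rfl

lemma norm_exp_neg_I_mul (x ξ : ℝ) :
    ‖Complex.exp (-(Complex.I * (x : ℂ) * (ξ : ℂ)))‖ = 1 := by
  rw [show -(Complex.I * (x : ℂ) * (ξ : ℂ)) = ((-(x * ξ) : ℝ) : ℂ) * Complex.I by push_cast; ring]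
  exact Complex.norm_exp_ofReal_mul_I _

lemma integrable_exp_mul {f : ℝ → ℝ} (hf : Integrable f) (ξ : ℝ) : Integrable fun x : ℝ =>
    Complex.exp (-(Complex.I * (x : ℂ) * (ξ : ℂ))) * ((f x : ℝ) : ℂ) := by
  refine hf.ofReal.bdd_mul (c := 1) ?_ (Eventually.of_forall fun x => (norm_exp_neg_I_mul x ξ).le)
  exact Continuous.aestronglyMeasurable (by fun_prop)

lemma hatFn_add {f g : ℝ → ℝ} (hf : Integrable f) (hg : Integrable g) (ξ : ℝ) :
    hatFn (fun x => f x + g x) ξ = hatFn f ξ + hatFn g ξ := by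
  simp only [hatFn]
  rw [← mul_add, ← integral_add (integrable_exp_mul hf ξ) (integrable_exp_mul hg ξ)]
  push_cast
  simp only [mul_add]

lemma hatFn_sum {ι : Type*} (s : Finset ι) {f : ι → ℝ → ℝ} (hf : ∀ i ∈ s, Integrable (f i))
    (ξ : ℝ) : hatFn (fun x => ∑ i ∈ s, f i x) ξ = ∑ i ∈ s, hatFn (f i) ξ := by
  simp only [hatFn]
  rw [← Finset.mul_sum, ← integral_finsetSum s fun i hi => integrable_exp_mul (hf i hi) ξ]
  push_cast
  simp only [Finset.mul_sum]

lemma hatFn_const_mul (c : ℝ) (f : ℝ → ℝ) (ξ : ℝ) :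
    hatFn (fun x => c * f x) ξ = c * hatFn f ξ := by
  simp only [hatFn]
  rw [mul_left_comm, ← integral_const_mul (c : ℂ)]
  congr 1
  refine integral_congr_ae (Eventually.of_forall fun x => ?_)
  push_cast
  ring

/-- The prefactor κ preserves the integral, so a soliton of parameter κ has a transform of height
independent of κ and width proportional to κ. -/
lemma hatFn_comp_affine (f : ℝ → ℝ) {κ : ℝ} (hκ : 0 < κ) (c ξ : ℝ) :
    hatFn (fun x => κ * f (κ * x + c)) ξ =
      Complex.exp (Complex.I * (ξ : ℂ) * ((c / κ : ℝ) : ℂ)) * hatFn f (ξ / κ) := by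
  set F : ℝ → ℂ := fun y => Complex.exp (-(Complex.I * ((y / κ - c / κ : ℝ) : ℂ) * (ξ : ℂ))) *
    ((κ * f y : ℝ) : ℂ) with hF
  have h1 : ∀ x : ℝ, Complex.exp (-(Complex.I * (x : ℂ) * (ξ : ℂ))) *
      ((κ * f (κ * x + c) : ℝ) : ℂ) = F (κ * x + c) := by
    intro x
    simp only [hF]
    rw [show (κ * x + c) / κ - c / κ = x by field_simp; ring]
  have h2 : ∫ x, F (κ * x + c) = (κ : ℂ)⁻¹ * ∫ y, F y := by
    have e1 := Measure.integral_comp_mul_left (fun y => F (y + c)) κ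
    rw [e1, integral_add_right_eq_self F c, abs_of_pos (inv_pos.2 hκ), Complex.real_smul]
    push_cast
    rfl
  have hκ' : (κ : ℂ) ≠ 0 := by exact_mod_cast hκ.ne'
  simp only [hatFn]
  simp_rw [h1]
  rw [h2, mul_left_comm, ← mul_assoc, mul_left_comm (Complex.exp _), ← integral_const_mul,
    ← integral_const_mul, mul_comm _ (_ : ℂ), ← integral_const_mul]
  congr 1
  ext y
  simp only [hF]
  have : Complex.exp (-(Complex.I * ((y / κ - c / κ : ℝ) : ℂ) * (ξ : ℂ))) =
      Complex.exp (Complex.I * (ξ : ℂ) * ((c / κ : ℝ) : ℂ)) *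
        Complex.exp (-(Complex.I * (y : ℂ) * ((ξ / κ : ℝ) : ℂ))) := by
    rw [← Complex.exp_add]
    congr 1
    push_cast
    ring
  rw [this]
  push_cast
  field_simp

lemma inv_sqrt_two_pi_le_one : 1 / Real.sqrt (2 * Real.pi) ≤ 1 := by
  rw [div_le_one (by positivity)]
  exact Real.one_le_sqrt.2 (by linarith [Real.pi_gt_three])

lemma norm_hatFn_le (f : ℝ → ℝ) (ξ : ℝ) : ‖hatFn f ξ‖ ≤ ∫ x, |f x| := by
  have h1 : ‖∫ x : ℝ, Complex.exp (-(Complex.I * (x : ℂ) * (ξ : ℂ))) * ((f x : ℝ) : ℂ)‖ ≤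
      ∫ x, |f x| := by
    refine (norm_integral_le_integral_norm _).trans_eq ?_
    simp [norm_exp_neg_I_mul]
  rw [hatFn, norm_mul, Complex.norm_real, Real.norm_of_nonneg (by positivity)]
  exact (mul_le_of_le_one_left (norm_nonneg _) inv_sqrt_two_pi_le_one).trans h1

lemma hatFn_eq_fourier (f : ℝ → ℝ) (ξ : ℝ) : hatFn f ξ =
    ((1 / Real.sqrt (2 * Real.pi) : ℝ) : ℂ) * 𝓕 (fun x => ((f x : ℝ) : ℂ)) (ξ / (2 * Real.pi)) := by
  rw [hatFn, Real.fourier_eq']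
  congr 2
  ext x
  rw [smul_eq_mul]
  congr 2
  simp only [RCLike.inner_apply, conj_trivial]
  push_cast
  field_simp

lemma continuous_hatFn {f : ℝ → ℝ} (hf : Integrable f) : Continuous (hatFn f) := by
  unfold hatFn
  refine continuous_const.mul (continuous_of_dominated (bound := fun x => |f x|)
    (fun ξ => (integrable_exp_mul hf ξ).aestronglyMeasurable)
    (fun ξ => Eventually.of_forall fun x => ?_) hf.abs (Eventually.of_forall fun x => ?_))
  · rw [norm_mul, norm_exp_neg_I_mul, one_mul, Complex.norm_real, Real.norm_eq_abs]
  · fun_prop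

lemma norm_hatFn_deriv {f : ℝ → ℝ} (hf : Integrable f) (hd : Differentiable ℝ f)
    (hf' : Integrable (deriv f)) (ξ : ℝ) : ‖hatFn (deriv f) ξ‖ = |ξ| * ‖hatFn f ξ‖ := by
  have hder : deriv (fun x => ((f x : ℝ) : ℂ)) = fun x => ((deriv f x : ℝ) : ℂ) :=
    funext fun x => (hd x).hasDerivAt.ofReal_comp.deriv
  have h := Real.fourier_deriv (f := fun x => ((f x : ℝ) : ℂ)) hf.ofReal
    (fun x => (hd x).hasDerivAt.ofReal_comp.differentiableAt) (by rw [hder]; exact hf'.ofReal)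
  rw [hder] at h
  rw [hatFn_eq_fourier, hatFn_eq_fourier, h]
  simp only [smul_eq_mul, norm_mul, Complex.norm_real, Complex.norm_I, norm_div]
  simp only [Complex.norm_ofNat, Real.norm_eq_abs, abs_two, abs_of_pos Real.pi_pos]
  field_simp

lemma abs_pow_mul_norm_hatFn_le {f : ℝ → ℝ} (hf : ContDiff ℝ ∞ f)
    (hi : ∀ n, Integrable (iteratedDeriv n f)) (n : ℕ) (ξ : ℝ) :
    |ξ| ^ n * ‖hatFn f ξ‖ ≤ ∫ x, |iteratedDeriv n f x| := by
  have h : ∀ n, ‖hatFn (iteratedDeriv n f) ξ‖ = |ξ| ^ n * ‖hatFn f ξ‖ := by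
    intro n
    induction n with
    | zero => simp
    | succ n ih =>
      have hi' := hi (n + 1)
      rw [iteratedDeriv_succ] at hi' ⊢
      rw [norm_hatFn_deriv (hi n) (hf.differentiable_iteratedDeriv n
        (by exact_mod_cast WithTop.coe_lt_top n)) hi', ih]
      ring
  rw [← h n]
  exact norm_hatFn_le _ _

/-- Combines the bounds from 0 and 2M derivatives. The constant is explicit so that the factor
e^{-2t} of the resolution error carries over. -/
lemma norm_hatFn_le_div {f : ℝ → ℝ} (hf : ContDiff ℝ ∞ f)
    (hi : ∀ n, Integrable (iteratedDeriv n f)) (M : ℕ) (ξ : ℝ) :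
    ‖hatFn f ξ‖ ≤ 2 ^ M * ((∫ x, |f x|) + ∫ x, |iteratedDeriv (2 * M) f x|) / (1 + ξ ^ 2) ^ M := by
  rw [le_div_iff₀ (by positivity)]
  have h1 := abs_pow_mul_norm_hatFn_le hf hi (2 * M) ξ
  have h2 := norm_hatFn_le f ξ
  rw [pow_mul, sq_abs] at h1
  have h3 : (1 + ξ ^ 2) ^ M ≤ 2 ^ M * (1 + (ξ ^ 2) ^ M) := by
    refine (add_pow_le zero_le_one (sq_nonneg ξ) M).trans ?_
    rw [one_pow]
    gcongr
    · exact one_le_two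
    · omega
  calc ‖hatFn f ξ‖ * (1 + ξ ^ 2) ^ M ≤ ‖hatFn f ξ‖ * (2 ^ M * (1 + (ξ ^ 2) ^ M)) := by gcongr
    _ = 2 ^ M * (‖hatFn f ξ‖ + (ξ ^ 2) ^ M * ‖hatFn f ξ‖) := by ring
    _ ≤ _ := by gcongr

lemma integrable_iteratedDeriv_schwartz (f : 𝓢(ℝ, ℝ)) (n : ℕ) :
    Integrable (iteratedDeriv n f) := by
  have hm : AEStronglyMeasurable (iteratedDeriv n f) :=
    ((f.smooth (n : ℕ∞)).continuous_iteratedDeriv n le_rfl).aestronglyMeasurable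
  refine (f.integrable_pow_mul_iteratedFDeriv volume 0 n).mono' hm
    (Eventually.of_forall fun x => ?_)
  simp [norm_iteratedFDeriv_eq_norm_iteratedDeriv]

lemma fourierHat_decay (f : 𝓢(ℝ, ℝ)) (M : ℕ) :
    ∃ C : ℝ, 0 ≤ C ∧ ∀ ξ, ‖fourierHat f ξ‖ ≤ C / (1 + ξ ^ 2) ^ M :=
  ⟨2 ^ M * ((∫ x, |f x|) + ∫ x, |iteratedDeriv (2 * M) f x|), by positivity, fun ξ =>
    norm_hatFn_le_div (f.smooth _) (integrable_iteratedDeriv_schwartz f) M ξ⟩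

lemma continuous_fourierHat (f : 𝓢(ℝ, ℝ)) : Continuous (fourierHat f) :=
  continuous_hatFn f.integrable

/-! ### The hyperbolic secant -/

lemma exists_sechSolution (m : ℕ) : ∃ u : ℝ → 𝓢(ℝ, ℝ), IsSchwartzSolutionMKdV u ∧
    (∀ x, u 0 x = (m + 1) * (1 / Real.cosh x)) ∧
    ∀ t x, u t x = cubePotential (oddSpec (m + 1)) (logistic (oddSpec (m + 1)) (sechPhase m) t x) := by
  obtain ⟨u, hu, h⟩ := exists_multisoliton (gramPos_oddSpec (m + 1)) oddSpec_pos (sechPhase m)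
  exact ⟨u, hu, fun x => by rw [h, ← potential_expPhase, potential_initial], h⟩

/-- The one-soliton at time 0 is sech, so its Schwartz property is already contained in the
construction. -/
lemma exists_schwartz_sech : ∃ f : 𝓢(ℝ, ℝ), ∀ x, f x = 1 / Real.cosh x := by
  obtain ⟨u, -, h, -⟩ := exists_sechSolution 0
  exact ⟨u 0, fun x => by rw [h]; simp⟩

/-- The hyperbolic secant as a Schwartz function. -/
def sech : 𝓢(ℝ, ℝ) := exists_schwartz_sech.choose

lemma sech_apply (x : ℝ) : sech x = 1 / Real.cosh x := exists_schwartz_sech.choose_spec x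

lemma fourierHat_sech_zero_ne : fourierHat sech 0 ≠ 0 := by
  have h : 0 < ∫ x, sech x := by
    refine (integral_pos_iff_support_of_nonneg (fun x => ?_) sech.integrable).2 ?_
    · rw [sech_apply]; have := Real.cosh_pos x; positivity
    · have : Function.support sech = univ := by
        ext x
        have := Real.cosh_pos x
        simp [sech_apply, this.ne']
      rw [this]
      simp
  simp only [fourierHat, Complex.ofReal_zero, mul_zero, neg_zero, Complex.exp_zero, one_mul]
  rw [integral_complex_ofReal]
  refine mul_ne_zero ?_ (by exact_mod_cast h.ne')
  have : (1 / Real.sqrt (2 * Real.pi)) ≠ 0 := by positivity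
  exact_mod_cast this

lemma integral_sq_fourierHat_sech_pos : 0 < ∫ y in Icc (-(1 / 2) : ℝ) (1 / 2), ‖fourierHat sech y‖ ^ 2 := by
  have hc : Continuous fun y => ‖fourierHat sech y‖ ^ 2 := (continuous_fourierHat sech).norm.pow 2
  rw [integral_Icc_eq_integral_Ioc, ← intervalIntegral.integral_of_le (by norm_num)]
  refine intervalIntegral.integral_pos (by norm_num) hc.continuousOn (fun y _ => by positivity)
    ⟨0, by norm_num, ?_⟩
  have := norm_pos_iff.2 fourierHat_sech_zero_ne
  positivity

/-! ### Long-time asymptotics on the Fourier side -/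

lemma exp_neg_abs_half_le (y : ℝ) : Real.exp (-|y| / 2) ≤ 9 * (1 + y ^ 2)⁻¹ := by
  rw [← div_eq_mul_inv, le_div_iff₀ (by positivity)]
  have h1 := pow_mul_exp_neg_le 2 (y / 2)
  have h2 : Real.exp (-|y / 2|) ≤ 1 := by simp
  rw [abs_div, abs_two] at h1 h2
  rw [div_pow, sq_abs] at h1
  rw [neg_div]
  norm_num [Nat.factorial] at h1
  nlinarith

lemma integrable_exp_neg_abs_half (c : ℝ) : Integrable fun x : ℝ => Real.exp (-|x - c| / 2) := by
  have h : Integrable fun x : ℝ => 9 * (1 + (x - c) ^ 2)⁻¹ :=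
    (integrable_inv_one_add_sq.const_mul 9).comp_sub_right c
  refine h.mono' (Continuous.aestronglyMeasurable (by fun_prop)) (Eventually.of_forall fun x => ?_)
  rw [Real.norm_of_nonneg (Real.exp_pos _).le]
  exact exp_neg_abs_half_le _

/-- The Fourier transform of a sum of receding solitons. -/
def solitonSum (N : ℕ) (δ : Fin N → ℝ) (t η : ℝ) : ℂ :=
  ∑ j, Complex.exp (-(Complex.I * η * ((oddSpec N j ^ 2 * t + δ j : ℝ) : ℂ))) *
    fourierHat sech (η / oddSpec N j)

/-- Control of 2M derivatives of the resolution error becomes decay in η of the same exponential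
smallness; that decay will absorb the weight. -/
theorem fourierHat_resolution (m : ℕ) {u : ℝ → 𝓢(ℝ, ℝ)}
    (hu : ∀ t x, u t x = cubePotential (oddSpec (m + 1))
      (logistic (oddSpec (m + 1)) (sechPhase m) t x)) :
    ∃ δ : Fin (m + 1) → ℝ, ∀ M : ℕ, ∃ C : ℝ, 0 ≤ C ∧ ∀ t : ℝ, 0 < t → ∀ η : ℝ,
      ‖fourierHat (u t) η - solitonSum (m + 1) δ t η‖ ≤ C * Real.exp (-2 * t) / (1 + η ^ 2) ^ M := by
  obtain ⟨δ, hδ⟩ := soliton_resolution (sechPhase m)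
  set κ := oddSpec (m + 1) with hκ
  have hpos : ∀ j, 0 < κ j := fun j => zero_lt_one.trans_le (oddSpec_pos j)
  choose C hC hb using hδ
  -- The argument κ_j y - κ_j³ t + δ_j vanishes at the soliton centre κ_j² t - δ_j/κ_j.
  refine ⟨fun j => -(δ j / κ j), fun M => ?_⟩
  set I₀ : ℝ := ∫ y : ℝ, Real.exp (-|y| / 2) with hI₀
  have hI₀n : 0 ≤ I₀ := integral_nonneg fun y => (Real.exp_pos _).le
  refine ⟨2 ^ M * ((C 0 + C (2 * M)) * ((m + 1) * I₀)), by have := hC 0; have := hC (2 * M); positivity,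
    fun t ht η => ?_⟩
  set sol : Fin (m + 1) → ℝ → ℝ := fun j y => κ j / Real.cosh (κ j * y - κ j ^ 3 * t + δ j) with hsol
  have hsol' : ∀ j, sol j = fun y => κ j * sech (κ j * y + (δ j - κ j ^ 3 * t)) := by
    intro j
    ext y
    simp only [hsol, sech_apply]
    rw [show κ j * y - κ j ^ 3 * t + δ j = κ j * y + (δ j - κ j ^ 3 * t) by ring]
    ring
  have hsoli : ∀ j, Integrable (sol j) := by
    intro j
    rw [hsol' j]
    exact ((sech.integrable (μ := volume)).comp_add_right _ |>.comp_mul_left' (hpos j).ne').const_mul _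
  set e : ℝ → ℝ := fun y => cubePotential κ (logistic κ (sechPhase m) t y) - ∑ j, sol j y with he
  have hes : ContDiff ℝ ∞ e := (hb 0 t ht).1
  have hen : ∀ n x, |iteratedDeriv n e x| ≤
      C n * (Real.exp (-2 * t) * ∑ k, Real.exp (-|x - κ k ^ 2 * t| / 2)) := fun n => (hb n t ht).2
  have hmaj : ∀ n, Integrable fun x =>
      C n * (Real.exp (-2 * t) * ∑ k, Real.exp (-|x - κ k ^ 2 * t| / 2)) := fun n =>
    ((integrable_finsetSum _ fun k _ => integrable_exp_neg_abs_half _).const_mul _).const_mul _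
  have hei : ∀ n, Integrable (iteratedDeriv n e) := fun n =>
    (hmaj n).mono' ((hes.continuous_iteratedDeriv n (by exact_mod_cast le_top)).aestronglyMeasurable)
      (Eventually.of_forall fun x => hen n x)
  have hint : ∀ n, ∫ x, |iteratedDeriv n e x| ≤ C n * (Real.exp (-2 * t) * ((m + 1) * I₀)) := by
    intro n
    refine (integral_mono (hei n).abs (hmaj n) (hen n)).trans_eq ?_
    rw [integral_const_mul, integral_const_mul,
      integral_finsetSum _ fun k _ => integrable_exp_neg_abs_half _]
    have : ∀ k, ∫ x, Real.exp (-|x - κ k ^ 2 * t| / 2) = I₀ := fun k =>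
      integral_sub_right_eq_self (fun y => Real.exp (-|y| / 2)) _
    simp [this]
  have hhat : fourierHat (u t) η - solitonSum (m + 1) (fun j => -(δ j / κ j)) t η = hatFn e η := by
    have h1 : (u t : ℝ → ℝ) = fun y => e y + ∑ j, sol j y := by
      ext y
      simp [he, hu]
    have h0 : Integrable e := by simpa using hei 0
    rw [fourierHat_eq_hatFn, h1, hatFn_add h0 (integrable_finsetSum _ fun j _ => hsoli j),
      hatFn_sum _ fun j _ => hsoli j, add_sub_assoc, add_eq_left, sub_eq_zero]
    refine Finset.sum_congr rfl fun j _ => ?_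
    rw [hsol' j, hatFn_comp_affine _ (hpos j), ← hκ, fourierHat_eq_hatFn]
    congr 2
    rw [show (δ j - κ j ^ 3 * t) / κ j = -(κ j ^ 2 * t + -(δ j / κ j)) by
      have := (hpos j).ne'; field_simp; ring]
    push_cast
    ring
  rw [hhat]
  refine (norm_hatFn_le_div hes hei M η).trans ?_
  have h0 := hint 0
  simp only [iteratedDeriv_zero] at h0
  have h1 := hint (2 * M)
  refine div_le_div_of_nonneg_right ?_ (by positivity)
  calc 2 ^ M * ((∫ x, |e x|) + ∫ x, |iteratedDeriv (2 * M) e x|)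
      ≤ 2 ^ M * (C 0 * (Real.exp (-2 * t) * ((m + 1) * I₀)) +
        C (2 * M) * (Real.exp (-2 * t) * ((m + 1) * I₀))) := by gcongr
    _ = _ := by ring

end MKdV

namespace MKdV

open Set Filter Topology
open scoped ComplexConjugate

/-! ### Sums of oscillating terms -/

/-- Riemann–Lebesgue: for a ≠ 0 the frequency leaves every compact set. -/
lemma tendsto_integral_oscillating (h : ℝ → ℂ) {a : ℝ} (ha : a ≠ 0) (b : ℝ) :
    Tendsto (fun t : ℝ => ∫ η : ℝ, Complex.exp (-(Complex.I * η * ((a * t + b : ℝ) : ℂ))) * h η)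
      atTop (𝓝 0) := by
  have h1 : Tendsto (fun t : ℝ => (a * t + b) / (2 * Real.pi)) atTop (cocompact ℝ) := by
    have hpi : (0 : ℝ) < 2 * Real.pi := by positivity
    rcases ha.lt_or_gt with ha | ha
    · exact (((tendsto_id.const_mul_atTop_of_neg ha).atBot_add tendsto_const_nhds).atBot_div_const
        hpi).mono_right atBot_le_cocompact
    · exact (((tendsto_id.const_mul_atTop ha).atTop_add tendsto_const_nhds).atTop_div_const
        hpi).mono_right atTop_le_cocompact
  refine ((Real.tendsto_integral_exp_smul_cocompact h).comp h1).congr fun t => ?_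
  refine integral_congr_ae (Eventually.of_forall fun η => ?_)
  simp only [Circle.smul_def, Real.fourierChar_apply, smul_eq_mul]
  congr 2
  push_cast
  field_simp

/-- A finite sum of profiles `f j` oscillating with phases `v j * t + δ j`. -/
def phaseSum {ι : Type*} [Fintype ι] (v δ : ι → ℝ) (f : ι → ℝ → ℂ) (t η : ℝ) : ℂ :=
  ∑ j, Complex.exp (-(Complex.I * η * ((v j * t + δ j : ℝ) : ℂ))) * f j η

section phaseSum

variable {ι ι' : Type*} [Fintype ι] [Fintype ι'] {v δ : ι → ℝ} {f : ι → ℝ → ℂ}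

lemma norm_phase (η x : ℝ) : ‖Complex.exp (-(Complex.I * η * (x : ℂ)))‖ = 1 :=
  norm_exp_neg_I_mul η x

lemma phaseSum_mul (v' δ' : ι' → ℝ) (f' : ι' → ℝ → ℂ) (t η : ℝ) :
    phaseSum v δ f t η * phaseSum v' δ' f' t η =
      phaseSum (fun p : ι × ι' => v p.1 + v' p.2) (fun p => δ p.1 + δ' p.2)
        (fun p η => f p.1 η * f' p.2 η) t η := by
  rw [phaseSum, phaseSum, Finset.sum_mul_sum, phaseSum, Fintype.sum_prod_type]
  refine Finset.sum_congr rfl fun j _ => Finset.sum_congr rfl fun k _ => ?_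
  rw [mul_mul_mul_comm, ← Complex.exp_add]
  congr 2
  push_cast
  ring

lemma conj_phaseSum (t η : ℝ) : conj (phaseSum v δ f t η) =
    phaseSum (fun j => -v j) (fun j => -δ j) (fun j η => conj (f j η)) t η := by
  rw [phaseSum, map_sum, phaseSum]
  refine Finset.sum_congr rfl fun j _ => ?_
  rw [map_mul, ← Complex.exp_conj]
  congr 2
  simp only [map_neg, map_mul, Complex.conj_I, Complex.conj_ofReal]
  push_cast
  ring

lemma integrable_phase_mul {h : ℝ → ℂ} (hi : Integrable h) (x : ℝ) :
    Integrable fun η : ℝ => Complex.exp (-(Complex.I * η * (x : ℂ))) * h η := by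
  refine hi.bdd_mul (c := 1) ?_ (Eventually.of_forall fun η => (norm_phase η x).le)
  exact Continuous.aestronglyMeasurable (by fun_prop)

/-- Moving terms disappear in the limit; a stationary term contributes at most the L¹ norm of its
profile. -/
lemma eventually_norm_integral_phaseSum_le (hi : ∀ j, Integrable (f j)) {B : ℝ}
    (hB : ∀ j, v j = 0 → ∫ η, ‖f j η‖ ≤ B) {ε : ℝ} (hε : 0 < ε) :
    ∀ᶠ t in atTop, ‖∫ η, phaseSum v δ f t η‖ ≤
      (Finset.univ.filter fun j => v j = 0).card * B + ε := by
  have hlim : Tendsto (fun t : ℝ => ∑ j ∈ Finset.univ.filter (fun j => v j ≠ 0),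
      ‖∫ η : ℝ, Complex.exp (-(Complex.I * η * ((v j * t + δ j : ℝ) : ℂ))) * f j η‖)
      atTop (𝓝 0) := by
    have h := tendsto_finsetSum (Finset.univ.filter fun j => v j ≠ 0) fun j hj =>
      (tendsto_integral_oscillating (f j) (Finset.mem_filter.1 hj).2 (δ j)).norm
    simpa only [norm_zero, Finset.sum_const_zero] using h
  filter_upwards [hlim.eventually (gt_mem_nhds hε)] with t ht
  simp only [phaseSum]
  rw [integral_finsetSum _ fun j _ => integrable_phase_mul (hi j) _,
    ← Finset.sum_filter_add_sum_filter_not Finset.univ fun j => v j = 0]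
  refine (norm_add_le _ _).trans (add_le_add ?_ ((norm_sum_le _ _).trans ht.le))
  rw [← nsmul_eq_mul, ← Finset.sum_const]
  refine (norm_sum_le _ _).trans (Finset.sum_le_sum fun j hj => ?_)
  refine (norm_integral_le_integral_norm _).trans ((le_of_eq ?_).trans
    (hB j (Finset.mem_filter.1 hj).2))
  refine integral_congr_ae (Eventually.of_forall fun η => ?_)
  simp only [norm_mul, norm_phase, one_mul]

variable {K : ℝ} {b : ℝ → ℝ}

lemma norm_phaseSum_le (hf : ∀ j η, ‖f j η‖ ≤ K * b η) (t η : ℝ) :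
    ‖phaseSum v δ f t η‖ ≤ Fintype.card ι * (K * b η) := by
  rw [← nsmul_eq_mul, ← Finset.card_univ, ← Finset.sum_const]
  refine (norm_sum_le _ _).trans (Finset.sum_le_sum fun j _ => ?_)
  rw [norm_mul, norm_phase, one_mul]
  exact hf j η

lemma continuous_phaseSum (hc : ∀ j, Continuous (f j)) (t : ℝ) :
    Continuous (phaseSum v δ f t) := by
  unfold phaseSum
  refine continuous_finsetSum _ fun j _ => ?_
  have := hc j
  fun_prop

/-- The squared modulus is a phase sum over pairs with velocities v_j - v_k. By injectivity only the
diagonal is stationary, so the cross terms vanish asymptotically. -/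
lemma eventually_integral_phaseSum_sq [DecidableEq ι] (hv : Function.Injective v)
    (hc : ∀ j, Continuous (f j))
    (hK : 0 ≤ K) (hf : ∀ j η, ‖f j η‖ ≤ K * b η) (hbi : Integrable b) (hb0 : ∀ η, 0 ≤ b η)
    (hb1 : ∀ η, b η ≤ 1) {ε : ℝ} (hε : 0 < ε) :
    ∀ᶠ t in atTop, |(∫ η, ‖phaseSum v δ f t η‖ ^ 2) - ∑ j, ∫ η, ‖f j η‖ ^ 2| ≤ ε := by
  -- The diagonal is removed, so every stationary term is zero and B = 0 is admissible.
  set f₂ : ι × ι → ℝ → ℂ := fun p η => if p.1 = p.2 then 0 else f p.1 η * conj (f p.2 η) with hf₂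
  have hprod : ∀ j k, Integrable fun η => f j η * conj (f k η) := by
    intro j k
    refine (hbi.const_mul (K * K)).mono' ?_ (Eventually.of_forall fun η => ?_)
    · exact ((hc j).mul (Complex.continuous_conj.comp (hc k))).aestronglyMeasurable
    · rw [norm_mul, RCLike.norm_conj]
      calc ‖f j η‖ * ‖f k η‖ ≤ (K * b η) * (K * 1) := by
            have h1 := hf j η
            have h2 := (hf k η).trans (mul_le_mul_of_nonneg_left (hb1 η) hK)
            have := hb0 η
            gcongr
        _ = _ := by ring
  have hi₂ : ∀ p, Integrable (f₂ p) := by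
    intro p
    by_cases hp : p.1 = p.2
    · simp only [hf₂, hp, if_true]
      exact integrable_zero _ _ _
    · simp only [hf₂, hp, if_false]
      exact hprod _ _
  have hsq : ∀ j, Integrable fun η => ‖f j η‖ ^ 2 := by
    intro j
    refine (hprod j j).norm.congr (Eventually.of_forall fun η => ?_)
    simp only [norm_mul, RCLike.norm_conj, sq]
  filter_upwards [eventually_norm_integral_phaseSum_le (v := fun p : ι × ι => v p.1 + -v p.2)
    (δ := fun p : ι × ι => δ p.1 + -δ p.2) (B := 0) hi₂ (fun p hp => by
      have : p.1 = p.2 := hv (by linarith)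
      simp [hf₂, this]) hε] with t ht
  have key : ∀ η, phaseSum (fun p : ι × ι => v p.1 + -v p.2) (fun p : ι × ι => δ p.1 + -δ p.2) f₂ t η =
      ((‖phaseSum v δ f t η‖ ^ 2 - ∑ j, ‖f j η‖ ^ 2 : ℝ) : ℂ) := by
    intro η
    push_cast
    rw [← Complex.mul_conj', conj_phaseSum, phaseSum_mul]
    simp only [phaseSum]
    rw [eq_sub_iff_add_eq]
    have hd : ∑ j, (‖f j η‖ : ℂ) ^ 2 = ∑ p : ι × ι, if p.1 = p.2 then
        f p.1 η * conj (f p.2 η) else 0 := by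
      simp [Fintype.sum_prod_type, Complex.mul_conj']
    rw [hd, ← Finset.sum_add_distrib]
    refine Finset.sum_congr rfl fun p _ => ?_
    by_cases hp : p.1 = p.2
    · simp [hf₂, hp]
    · simp [hf₂, hp]
  simp_rw [key] at ht
  rw [integral_complex_ofReal, Complex.norm_real, integral_sub, integral_finsetSum _ fun j _ => hsq j,
    mul_zero, zero_add] at ht
  · exact ht
  · have hmaj := (hbi.const_mul ((Fintype.card ι * K) * (Fintype.card ι * K)))
    refine hmaj.mono' ((continuous_phaseSum hc t).norm.pow 2).aestronglyMeasurable
      (Eventually.of_forall fun η => ?_)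
    rw [Real.norm_of_nonneg (by positivity), sq]
    have h1 := norm_phaseSum_le (v := v) (δ := δ) hf t η
    have h2 := h1.trans (mul_le_mul_of_nonneg_left (mul_le_mul_of_nonneg_left (hb1 η) hK)
      (Nat.cast_nonneg _))
    calc ‖phaseSum v δ f t η‖ * ‖phaseSum v δ f t η‖ ≤
        (Fintype.card ι * (K * b η)) * (Fintype.card ι * (K * 1)) := by
          have := hb0 η
          gcongr
      _ = _ := by ring
  · exact integrable_finsetSum _ fun j _ => hsq j

/-- The fourth power is a phase sum over quadruples whose stationary terms are the resonances. One
of the four factors supplies the integrable b, and b ≤ 1 disposes of the others. -/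
lemma eventually_integral_phaseSum_pow_four (hc : ∀ j, Continuous (f j))
    (hK : 0 ≤ K) (hf : ∀ j η, ‖f j η‖ ≤ K * b η) (hbi : Integrable b) (hb0 : ∀ η, 0 ≤ b η)
    (hb1 : ∀ η, b η ≤ 1) {ε : ℝ} (hε : 0 < ε) :
    ∀ᶠ t in atTop, ∫ η, ‖phaseSum v δ f t η‖ ^ 4 ≤
      (Finset.univ.filter fun q : ι × ι × ι × ι =>
        v q.1 - v q.2.1 + v q.2.2.1 - v q.2.2.2 = 0).card * (K ^ 4 * ∫ η, b η) + ε := by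
  set f₄ : ι × ι × ι × ι → ℝ → ℂ := fun q η =>
    f q.1 η * (conj (f q.2.1 η) * (f q.2.2.1 η * conj (f q.2.2.2 η))) with hf₄
  have hn₄ : ∀ q η, ‖f₄ q η‖ ≤ K ^ 4 * b η := by
    intro q η
    have h := fun j => (hf j η).trans (mul_le_mul_of_nonneg_left (hb1 η) hK)
    have := hb0 η
    simp only [hf₄, norm_mul, RCLike.norm_conj]
    calc ‖f q.1 η‖ * (‖f q.2.1 η‖ * (‖f q.2.2.1 η‖ * ‖f q.2.2.2 η‖)) ≤
        (K * b η) * ((K * 1) * ((K * 1) * (K * 1))) := by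
          have h0 := hf q.1 η
          have h1 := h q.2.1
          have h2 := h q.2.2.1
          have h3 := h q.2.2.2
          gcongr
      _ = _ := by ring
  have hc₄ : ∀ q, Continuous (f₄ q) := by
    intro q
    have h0 := hc q.1
    have h1 := hc q.2.1
    have h2 := hc q.2.2.1
    have h3 := hc q.2.2.2
    fun_prop
  have hi₄ : ∀ q, Integrable (f₄ q) := fun q =>
    (hbi.const_mul (K ^ 4)).mono' (hc₄ q).aestronglyMeasurable (Eventually.of_forall (hn₄ q))
  filter_upwards [eventually_norm_integral_phaseSum_le
    (v := fun q : ι × ι × ι × ι => v q.1 + (-v q.2.1 + (v q.2.2.1 + -v q.2.2.2)))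
    (δ := fun q : ι × ι × ι × ι => δ q.1 + (-δ q.2.1 + (δ q.2.2.1 + -δ q.2.2.2)))
    (B := K ^ 4 * ∫ η, b η) hi₄ (fun q _ => by
      rw [← integral_const_mul]
      exact integral_mono (hi₄ q).norm (hbi.const_mul _) (hn₄ q)) hε] with t ht
  have key : ∀ η, phaseSum (fun q : ι × ι × ι × ι => v q.1 + (-v q.2.1 + (v q.2.2.1 + -v q.2.2.2)))
      (fun q : ι × ι × ι × ι => δ q.1 + (-δ q.2.1 + (δ q.2.2.1 + -δ q.2.2.2))) f₄ t η =
      ((‖phaseSum v δ f t η‖ ^ 4 : ℝ) : ℂ) := by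
    intro η
    have : ((‖phaseSum v δ f t η‖ ^ 4 : ℝ) : ℂ) = phaseSum v δ f t η * (conj (phaseSum v δ f t η) *
        (phaseSum v δ f t η * conj (phaseSum v δ f t η))) := by
      rw [Complex.mul_conj', ← mul_assoc, Complex.mul_conj']
      push_cast
      ring
    rw [this, conj_phaseSum, phaseSum_mul, phaseSum_mul, phaseSum_mul]
  simp_rw [key] at ht
  rw [integral_complex_ofReal, Complex.norm_real] at ht
  refine (le_abs_self _).trans (ht.trans_eq ?_)
  congr 4
  ext q
  rw [Finset.mem_filter, Finset.mem_filter, show v q.1 + (-v q.2.1 + (v q.2.2.1 + -v q.2.2.2)) =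
    v q.1 - v q.2.1 + v q.2.2.1 - v q.2.2.2 by ring]

end phaseSum

/-! ### Weights -/

lemma one_le_japaneseBracket (x : ℝ) : 1 ≤ japaneseBracket x :=
  Real.one_le_sqrt.2 (by linarith [sq_nonneg x])

lemma continuous_japaneseBracket_rpow (s : ℝ) : Continuous fun x => japaneseBracket x ^ s := by
  refine Continuous.rpow_const ?_ fun x => Or.inl (by linarith [one_le_japaneseBracket x])
  unfold japaneseBracket
  fun_prop

lemma japaneseBracket_rpow_le (s x : ℝ) : japaneseBracket x ^ s ≤ (1 + x ^ 2) ^ ⌈|s|⌉₊ := by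
  have h1 := one_le_japaneseBracket x
  calc japaneseBracket x ^ s ≤ japaneseBracket x ^ ((2 * ⌈|s|⌉₊ : ℕ) : ℝ) := by
        refine Real.rpow_le_rpow_of_exponent_le h1 ?_
        have := Nat.le_ceil |s|
        have := le_abs_self s
        push_cast
        linarith [abs_nonneg s]
    _ = _ := by
        rw [Real.rpow_natCast, pow_mul, japaneseBracket, Real.sq_sqrt (by positivity)]

lemma le_japaneseBracket_rpow (s x : ℝ) : ((1 + x ^ 2) ^ ⌈|s|⌉₊)⁻¹ ≤ japaneseBracket x ^ s := by
  have h := japaneseBracket_rpow_le (-s) x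
  have h1 := one_le_japaneseBracket x
  rw [abs_neg, Real.rpow_neg (by linarith)] at h
  have : 0 < japaneseBracket x ^ s := Real.rpow_pos_of_pos (by linarith) s
  exact inv_le_of_inv_le₀ this h

end MKdV

namespace MKdV

open Set Filter Topology

/-! ### Moments of the Fourier transform at large times -/

lemma oddSpec_le {N : ℕ} (j : Fin N) : oddSpec N j ≤ 2 * N := by
  have : (j : ℝ) + 1 ≤ N := by exact_mod_cast j.2
  simp only [oddSpec]
  linarith

lemma sum_oddSpec (N : ℕ) : ∑ j, oddSpec N j = (N : ℝ) ^ 2 := by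
  simp only [oddSpec]
  rw [Fin.sum_univ_eq_sum_range (fun j => 2 * (j : ℝ) + 1) N]
  induction N with
  | zero => simp
  | succ n ih => rw [Finset.sum_range_succ, ih]; push_cast; ring

lemma one_add_div_sq_le {x a b : ℝ} (hb : 0 < b) (h : b ≤ a) :
    1 + (x / a) ^ 2 ≤ 1 + (x / b) ^ 2 := by
  rw [div_pow, div_pow]
  gcongr

/-- The common profile dominating all solitons. -/
def bump (N : ℕ) (η : ℝ) : ℝ := (1 + (η / (2 * N)) ^ 2)⁻¹

lemma bump_nonneg (N : ℕ) (η : ℝ) : 0 ≤ bump N η := by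
  unfold bump
  positivity

lemma bump_le_one (N : ℕ) (η : ℝ) : bump N η ≤ 1 :=
  inv_le_one_of_one_le₀ (by linarith [sq_nonneg (η / (2 * N))])

lemma integrable_bump {N : ℕ} (hN : 1 ≤ N) : Integrable (bump N) :=
  integrable_inv_one_add_sq.comp_div (by positivity)

lemma integral_bump (N : ℕ) : ∫ η, bump N η = 2 * Real.pi * N := by
  unfold bump
  rw [Measure.integral_comp_div (fun x => (1 + x ^ 2)⁻¹), integral_univ_inv_one_add_sq,
    abs_of_nonneg (by positivity), smul_eq_mul]
  ring

/-- The profile lives on |η| ≲ κ_j ≤ 2N ≤ 2λ, where the weight is O(1); beyond that the rapid decay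
of the transform of sech absorbs the weight. The point is uniformity in N, λ and j. -/
lemma exists_profile_bound (s : ℝ) : ∃ K : ℝ, 1 ≤ K ∧ ∀ (N : ℕ) (lam : ℝ), 1 ≤ N → (N : ℝ) ≤ lam →
    ∀ (j : Fin N) (η : ℝ), japaneseBracket (η / lam) ^ s * ‖fourierHat sech (η / oddSpec N j)‖ ≤
      K * bump N η := by
  set n := ⌈|s|⌉₊
  obtain ⟨C, hC, h⟩ := fourierHat_decay sech (n + 1)
  refine ⟨1 + 4 ^ n * C, by have : 0 ≤ 4 ^ n * C := by positivity
                            linarith, fun N lam hN hlam j η => ?_⟩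
  have hκ : 1 ≤ oddSpec N j := oddSpec_pos j
  have hN' : (1 : ℝ) ≤ N := by exact_mod_cast hN
  set y := η / oddSpec N j with hy
  have h1 : 1 + (η / lam) ^ 2 ≤ 4 * (1 + y ^ 2) := by
    have := one_add_div_sq_le (x := 2 * η) (a := 2 * lam) (b := oddSpec N j) (by linarith)
      ((oddSpec_le j).trans (by linarith))
    rw [mul_div_mul_left _ _ two_ne_zero, mul_div_assoc, ← hy] at this
    nlinarith
  have h2 : (1 + y ^ 2)⁻¹ ≤ bump N η :=
    inv_anti₀ (by positivity) (one_add_div_sq_le (by linarith) (oddSpec_le j))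
  calc japaneseBracket (η / lam) ^ s * ‖fourierHat sech y‖
      ≤ (4 * (1 + y ^ 2)) ^ n * (C / (1 + y ^ 2) ^ (n + 1)) :=
        mul_le_mul ((japaneseBracket_rpow_le s _).trans (pow_le_pow_left₀ (by positivity) h1 n))
          (h y) (norm_nonneg _) (by positivity)
    _ = 4 ^ n * C * (1 + y ^ 2)⁻¹ := by
        have : (1 + y ^ 2) ≠ 0 := by positivity
        rw [mul_pow]
        field_simp
        ring
    _ ≤ (1 + 4 ^ n * C) * bump N η := by
        gcongr
        linarith

/-- By scaling, soliton j has mass κ_j I on |η| ≤ κ_j/2, and Σ κ_j = N². There |η| ≤ λ, so the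
weight is at least 2⁻ⁿ. -/
lemma exists_diagonal_lower_bound (s : ℝ) : ∃ c : ℝ, 0 < c ∧ ∀ (N : ℕ) (lam : ℝ), 1 ≤ N →
    (N : ℝ) ≤ lam → c * (N : ℝ) ^ 2 ≤
      ∑ j, ∫ η, (japaneseBracket (η / lam) ^ s * ‖fourierHat sech (η / oddSpec N j)‖) ^ 2 := by
  obtain ⟨K, hK, hb⟩ := exists_profile_bound s
  set n := ⌈|s|⌉₊
  have hI := integral_sq_fourierHat_sech_pos
  set I := ∫ y in Icc (-(1 / 2) : ℝ) (1 / 2), ‖fourierHat sech y‖ ^ 2 with hI_def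
  refine ⟨((2 ^ n)⁻¹) ^ 2 * I, by positivity, fun N lam hN hlam => ?_⟩
  have hN' : (1 : ℝ) ≤ N := by exact_mod_cast hN
  rw [← sum_oddSpec, Finset.mul_sum]
  refine Finset.sum_le_sum fun j _ => ?_
  have hκ : 1 ≤ oddSpec N j := oddSpec_pos j
  have hκN := oddSpec_le j
  set κ := oddSpec N j with hκ_def
  have hcs := continuous_fourierHat sech
  have hcw := continuous_japaneseBracket_rpow s
  have hc : Continuous fun η : ℝ => japaneseBracket (η / lam) ^ s * ‖fourierHat sech (η / κ)‖ :=
    (hcw.comp (continuous_id.div_const lam)).mul (hcs.comp (continuous_id.div_const κ)).norm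
  have hn : ∀ η : ℝ, 0 ≤ japaneseBracket (η / lam) ^ s * ‖fourierHat sech (η / κ)‖ := fun η =>
    mul_nonneg (Real.rpow_nonneg (zero_le_one.trans (one_le_japaneseBracket _)) _) (norm_nonneg _)
  have hi : Integrable fun η : ℝ =>
      (japaneseBracket (η / lam) ^ s * ‖fourierHat sech (η / κ)‖) ^ 2 := by
    refine ((integrable_bump hN).const_mul (K ^ 2)).mono' (hc.pow 2).aestronglyMeasurable
      (Eventually.of_forall fun η => ?_)
    rw [Real.norm_of_nonneg (by positivity)]
    calc _ ≤ (K * bump N η) ^ 2 := pow_le_pow_left₀ (hn η) (hb N lam hN hlam j η) 2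
      _ = K ^ 2 * (bump N η * bump N η) := by ring
      _ ≤ K ^ 2 * (bump N η * 1) := by
        have := bump_nonneg N η
        have := bump_le_one N η
        gcongr
      _ = _ := by ring
  have h1 : ∫ η in Icc (-(κ / 2)) (κ / 2), ‖fourierHat sech (η / κ)‖ ^ 2 = κ * I := by
    rw [hI_def, integral_Icc_eq_integral_Ioc, integral_Icc_eq_integral_Ioc,
      ← intervalIntegral.integral_of_le (by linarith), ← intervalIntegral.integral_of_le (by norm_num),
      intervalIntegral.integral_comp_div (fun y => ‖fourierHat sech y‖ ^ 2) (by linarith), smul_eq_mul]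
    congr 2 <;> field_simp
  calc ((2 ^ n)⁻¹) ^ 2 * I * κ = ((2 ^ n)⁻¹) ^ 2 * (κ * I) := by ring
    _ = ∫ η in Icc (-(κ / 2)) (κ / 2), ((2 ^ n)⁻¹) ^ 2 * ‖fourierHat sech (η / κ)‖ ^ 2 := by
        rw [← h1, integral_const_mul]
    _ ≤ ∫ η in Icc (-(κ / 2)) (κ / 2),
          (japaneseBracket (η / lam) ^ s * ‖fourierHat sech (η / κ)‖) ^ 2 := by
        refine setIntegral_mono_on ?_ hi.integrableOn measurableSet_Icc fun η hη => ?_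
        · exact Continuous.integrableOn_Icc
            (((hcs.comp (continuous_id.div_const κ)).norm.pow 2).const_mul _)
        · rw [mul_pow]
          gcongr
          refine le_trans ?_ (le_japaneseBracket_rpow s (η / lam))
          refine inv_anti₀ (by positivity) (pow_le_pow_left₀ (by positivity) ?_ n)
          have : |η / lam| ≤ 1 := by
            rw [abs_div, abs_of_pos (by linarith : 0 < lam), div_le_one (by linarith), abs_le]
            constructor <;> linarith [hη.1, hη.2]
          have := (sq_le_one_iff_abs_le_one _).2 this
          linarith
    _ ≤ _ := setIntegral_le_integral hi (Eventually.of_forall fun η => sq_nonneg _)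

lemma sq_le_of_abs_sub_le {a b r : ℝ} (h : |a - b| ≤ r) : a ^ 2 ≤ 2 * b ^ 2 + 2 * r ^ 2 := by
  have h1 : (a - b) ^ 2 ≤ r ^ 2 := by
    rw [← sq_abs]
    exact pow_le_pow_left₀ (abs_nonneg _) h 2
  nlinarith [sq_nonneg (a - 2 * b)]

lemma pow_four_le_of_abs_sub_le {a b r : ℝ} (h : |a - b| ≤ r) : a ^ 4 ≤ 8 * b ^ 4 + 8 * r ^ 4 := by
  have h1 := sq_le_of_abs_sub_le h
  have h2 : (a ^ 2) ^ 2 ≤ (2 * b ^ 2 + 2 * r ^ 2) ^ 2 := pow_le_pow_left₀ (sq_nonneg _) h1 2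
  nlinarith [sq_nonneg (b ^ 2 - r ^ 2)]

/-- At some large time the weighted Fourier transform has the moments of a superposition of
solitons in random position. -/
theorem exists_time_moments (s : ℝ) : ∃ c K : ℝ, 0 < c ∧ 1 ≤ K ∧
    ∀ (m : ℕ) (lam : ℝ), ((m + 1 : ℕ) : ℝ) ≤ lam → ∀ u : ℝ → 𝓢(ℝ, ℝ),
      (∀ t x, u t x = cubePotential (oddSpec (m + 1))
        (logistic (oddSpec (m + 1)) (sechPhase m) t x)) →
      ∃ t : ℝ, 0 < t ∧
        c * ((m + 1 : ℕ) : ℝ) ^ 2 ≤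
          ∫ η, (japaneseBracket (η / lam) ^ s * ‖fourierHat (u t) η‖) ^ 2 ∧
        ∫ η, (japaneseBracket (η / lam) ^ s * ‖fourierHat (u t) η‖) ^ 2 ≤
          K * ((m + 1 : ℕ) : ℝ) ^ 2 ∧
        ∫ η, (japaneseBracket (η / lam) ^ s * ‖fourierHat (u t) η‖) ^ 4 ≤
          K * ((m + 1 : ℕ) : ℝ) ^ (7 / 2 : ℝ) ∧
        ∀ η, japaneseBracket (η / lam) ^ s * ‖fourierHat (u t) η‖ ≤ K * ((m + 1 : ℕ) : ℝ) := by
  obtain ⟨K, hK, hb⟩ := exists_profile_bound s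
  obtain ⟨c, hc, hdiag⟩ := exists_diagonal_lower_bound s
  set n := ⌈|s|⌉₊
  -- With π ≤ 4 this gives επ ≤ c/8. After the error c/4 in `ev2` and the factor 2 in comparing
  -- squares, the second moment keeps at least (c/4)N².
  set ε : ℝ := min 1 (c / 32) with hε_def
  have hε : 0 < ε := lt_min one_pos (by positivity)
  have hpi := Real.pi_pos
  refine ⟨c / 4, 8 * (401 * K ^ 4 * 2 * Real.pi + 1) + 8 * Real.pi + 6 * K ^ 2 * Real.pi + (K + 1),
    by positivity, ?_, fun m lam hlam u hu => ?_⟩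
  · have : 0 ≤ 8 * (401 * K ^ 4 * 2 * Real.pi + 1) + 8 * Real.pi + 6 * K ^ 2 * Real.pi := by
      positivity
    linarith
  set N := m + 1 with hN_def
  have hN : 1 ≤ N := by omega
  have hN' : (1 : ℝ) ≤ N := by exact_mod_cast hN
  obtain ⟨δ, hδ⟩ := fourierHat_resolution m hu
  obtain ⟨C, hC, hres⟩ := hδ (n + 1)
  set w : ℝ → ℝ := fun η => japaneseBracket (η / lam) ^ s with hw
  have hw0 : ∀ η, 0 ≤ w η := fun η =>
    Real.rpow_nonneg (zero_le_one.trans (one_le_japaneseBracket _)) _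
  have hwc : Continuous w := (continuous_japaneseBracket_rpow s).comp (continuous_id.div_const lam)
  set f : Fin N → ℝ → ℂ := fun j η => (w η : ℂ) * fourierHat sech (η / oddSpec N j) with hf
  have hfn : ∀ j η, ‖f j η‖ = w η * ‖fourierHat sech (η / oddSpec N j)‖ := by
    intro j η
    rw [hf, norm_mul, Complex.norm_real, Real.norm_of_nonneg (hw0 η)]
  have hfb : ∀ j η, ‖f j η‖ ≤ K * bump N η := fun j η => by
    rw [hfn]
    exact hb N lam hN hlam j η
  have hfc : ∀ j, Continuous (f j) := fun j =>
    (Complex.continuous_ofReal.comp hwc).mul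
      ((continuous_fourierHat sech).comp (continuous_id.div_const _))
  set v : Fin N → ℝ := fun j => oddSpec N j ^ 2 with hv
  have hvinj : Function.Injective v := by
    intro j k hjk
    rcases lt_trichotomy j k with h | h | h
    · have := oddSpec_sq_sub h
      simp only [hv] at hjk
      linarith
    · exact h
    · have := oddSpec_sq_sub h
      simp only [hv] at hjk
      linarith
  have hK0 : 0 ≤ K := by linarith
  have ev2 := eventually_integral_phaseSum_sq (v := v) (δ := δ) hvinj hfc hK0 hfb
    (integrable_bump hN) (bump_nonneg N) (bump_le_one N) (by positivity : 0 < c / 4)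
  have ev4 := eventually_integral_phaseSum_pow_four (v := v) (δ := δ) hfc hK0 hfb
    (integrable_bump hN) (bump_nonneg N) (bump_le_one N) one_pos
  have ev0 : ∀ᶠ t : ℝ in atTop, C * Real.exp (-2 * t) < ε := by
    have h1 : Tendsto (fun t : ℝ => C * Real.exp (-2 * t)) atTop (𝓝 (C * 0)) :=
      (Real.tendsto_exp_atBot.comp (tendsto_id.const_mul_atTop_of_neg (by norm_num))).const_mul C
    rw [mul_zero] at h1
    exact h1.eventually (gt_mem_nhds hε)
  obtain ⟨t, ⟨ht2, ht4⟩, ht0, htpos⟩ := ((ev2.and ev4).and (ev0.and (eventually_gt_atTop 0))).exists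
  refine ⟨t, htpos, ?_⟩
  set F : ℝ → ℝ := fun η => ‖phaseSum v δ f t η‖ with hF
  set g : ℝ → ℝ := fun η => w η * ‖fourierHat (u t) η‖ with hg
  set r : ℝ → ℝ := fun η => (1 + η ^ 2)⁻¹ with hr
  have hr0 : ∀ η, 0 ≤ r η := fun η => by simp only [hr]; positivity
  have hr1 : ∀ η, r η ≤ 1 := fun η => inv_le_one_of_one_le₀ (by linarith [sq_nonneg η])
  have hg0 : ∀ η, 0 ≤ g η := fun η => mul_nonneg (hw0 η) (norm_nonneg _)
  have hphase : ∀ η, phaseSum v δ f t η = w η * solitonSum N δ t η := by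
    intro η
    rw [phaseSum, solitonSum, Finset.mul_sum]
    exact Finset.sum_congr rfl fun j _ => mul_left_comm _ _ _
  -- The resolution error was taken with exponent n + 1, so the weight, at most (1 + η²)ⁿ, leaves
  -- the integrable (1 + η²)⁻¹.
  have hgF : ∀ η, |g η - F η| ≤ ε * r η := by
    intro η
    have h1 : F η = w η * ‖solitonSum N δ t η‖ := by
      rw [hF]
      simp only [hphase, norm_mul, Complex.norm_real, Real.norm_of_nonneg (hw0 η)]
    rw [h1, hg, ← mul_sub, abs_mul, abs_of_nonneg (hw0 η)]
    have hwle : w η ≤ (1 + η ^ 2) ^ n := by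
      refine (japaneseBracket_rpow_le s _).trans (pow_le_pow_left₀ (by positivity) ?_ n)
      have := one_add_div_sq_le (x := η) one_pos (hN'.trans hlam)
      simpa using this
    calc w η * |‖fourierHat (u t) η‖ - ‖solitonSum N δ t η‖|
        ≤ (1 + η ^ 2) ^ n * (ε / (1 + η ^ 2) ^ (n + 1)) := by
          refine mul_le_mul hwle ((abs_norm_sub_norm_le _ _).trans ((hres t htpos η).trans ?_))
            (abs_nonneg _) (by positivity)
          gcongr
      _ = ε * r η := by
          have : (1 + η ^ 2) ≠ 0 := by positivity
          simp only [hr]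
          field_simp
          ring
  have hFc : Continuous F := (continuous_phaseSum hfc t).norm
  have hgc : Continuous g := hwc.mul (continuous_fourierHat _).norm
  have hri : Integrable r := integrable_inv_one_add_sq
  have hFb : ∀ η, F η ≤ N * (K * bump N η) := fun η => by
    have := norm_phaseSum_le (v := v) (δ := δ) hfb t η
    rwa [Fintype.card_fin] at this
  have hF0 : ∀ η, 0 ≤ F η := fun η => norm_nonneg _
  have hFi : ∀ k, 1 ≤ k → Integrable fun η => F η ^ k := by
    intro k hk
    refine ((integrable_bump hN).const_mul ((N * K) ^ k)).mono' (hFc.pow k).aestronglyMeasurable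
      (Eventually.of_forall fun η => ?_)
    rw [Real.norm_of_nonneg (pow_nonneg (hF0 η) k)]
    calc F η ^ k ≤ (N * (K * bump N η)) ^ k := pow_le_pow_left₀ (hF0 η) (hFb η) k
      _ = (N * K) ^ k * bump N η ^ k := by ring
      _ ≤ (N * K) ^ k * bump N η ^ 1 := by
        gcongr ?_ * ?_
        exact pow_le_pow_of_le_one (bump_nonneg N η) (bump_le_one N η) hk
      _ = _ := by rw [pow_one]
  have hgle : ∀ η, g η ≤ F η + r η := fun η => by
    have := (abs_le.1 (hgF η)).2
    have h2 : ε * r η ≤ 1 * r η := mul_le_mul_of_nonneg_right (min_le_left _ _) (hr0 η)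
    linarith
  have hrk : ∀ k, 1 ≤ k → ∀ η, (ε * r η) ^ k ≤ ε * r η := by
    intro k hk η
    have h1 : ε * r η ≤ 1 := mul_le_one₀ (min_le_left _ _) (hr0 η) (hr1 η)
    calc (ε * r η) ^ k ≤ (ε * r η) ^ 1 :=
          pow_le_pow_of_le_one (mul_nonneg hε.le (hr0 η)) h1 hk
      _ = _ := pow_one _
  have hri' : Integrable fun η => ε * r η := hri.const_mul ε
  have hrI : ∫ η, ε * r η = ε * Real.pi := by
    rw [integral_const_mul, integral_univ_inv_one_add_sq]
  have g2 : ∀ η, g η ^ 2 ≤ 2 * F η ^ 2 + 2 * (ε * r η) := fun η =>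
    (sq_le_of_abs_sub_le (hgF η)).trans (by linarith [hrk 2 (by norm_num) η])
  have F2 : ∀ η, F η ^ 2 ≤ 2 * g η ^ 2 + 2 * (ε * r η) := fun η =>
    (sq_le_of_abs_sub_le ((abs_sub_comm _ _).le.trans (hgF η))).trans
      (by linarith [hrk 2 (by norm_num) η])
  have g4 : ∀ η, g η ^ 4 ≤ 8 * F η ^ 4 + 8 * (ε * r η) := fun η =>
    (pow_four_le_of_abs_sub_le (hgF η)).trans (by linarith [hrk 4 (by norm_num) η])
  have i2 : Integrable fun η => 2 * F η ^ 2 + 2 * (ε * r η) :=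
    ((hFi 2 (by norm_num)).const_mul 2).add (hri'.const_mul 2)
  have i4 : Integrable fun η => 8 * F η ^ 4 + 8 * (ε * r η) :=
    ((hFi 4 (by norm_num)).const_mul 8).add (hri'.const_mul 8)
  have gi2 : Integrable fun η => g η ^ 2 := i2.mono' (hgc.pow 2).aestronglyMeasurable
    (Eventually.of_forall fun η => by rw [Real.norm_of_nonneg (sq_nonneg _)]; exact g2 η)
  have gi4 : Integrable fun η => g η ^ 4 := i4.mono' (hgc.pow 4).aestronglyMeasurable
    (Eventually.of_forall fun η => by
      rw [Real.norm_of_nonneg (pow_nonneg (hg0 η) 4)]; exact g4 η)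
  have I2 : ∫ η, g η ^ 2 ≤ 2 * (∫ η, F η ^ 2) + 2 * (ε * Real.pi) := by
    refine (integral_mono gi2 i2 g2).trans_eq ?_
    rw [integral_add ((hFi 2 (by norm_num)).const_mul 2) (hri'.const_mul 2), integral_const_mul,
      integral_const_mul, hrI]
  have J2 : ∫ η, F η ^ 2 ≤ 2 * (∫ η, g η ^ 2) + 2 * (ε * Real.pi) := by
    refine (integral_mono (hFi 2 (by norm_num))
      ((gi2.const_mul 2).add (hri'.const_mul 2)) F2).trans_eq ?_
    simp only [Pi.add_apply]
    rw [integral_add (gi2.const_mul 2) (hri'.const_mul 2), integral_const_mul,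
      integral_const_mul, hrI]
  have I4 : ∫ η, g η ^ 4 ≤ 8 * (∫ η, F η ^ 4) + 8 * (ε * Real.pi) := by
    refine (integral_mono gi4 i4 g4).trans_eq ?_
    rw [integral_add ((hFi 4 (by norm_num)).const_mul 8) (hri'.const_mul 8), integral_const_mul,
      integral_const_mul, hrI]
  have hdl := hdiag N lam hN hlam
  have hdl' : c * (N : ℝ) ^ 2 ≤ ∑ j, ∫ η, ‖f j η‖ ^ 2 := by simpa only [hfn] using hdl
  have hdu : ∑ j, ∫ η, ‖f j η‖ ^ 2 ≤ 2 * K ^ 2 * Real.pi * (N : ℝ) ^ 2 := by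
    have h1 : ∀ j, ∫ η, ‖f j η‖ ^ 2 ≤ K ^ 2 * (2 * Real.pi * N) := by
      intro j
      rw [← integral_bump, ← integral_const_mul]
      refine integral_mono_of_nonneg (Eventually.of_forall fun η => sq_nonneg _)
        ((integrable_bump hN).const_mul _) (Eventually.of_forall fun η => ?_)
      calc ‖f j η‖ ^ 2 ≤ (K * bump N η) ^ 2 := pow_le_pow_left₀ (norm_nonneg _) (hfb j η) 2
        _ = K ^ 2 * (bump N η * bump N η) := by ring
        _ ≤ K ^ 2 * (bump N η * 1) := by
          have := bump_nonneg N η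
          have := bump_le_one N η
          gcongr
        _ = _ := by ring
    calc ∑ j, ∫ η, ‖f j η‖ ^ 2 ≤ ∑ _j : Fin N, K ^ 2 * (2 * Real.pi * N) :=
          Finset.sum_le_sum fun j _ => h1 j
      _ = _ := by
          rw [Finset.sum_const, Finset.card_univ, Fintype.card_fin, nsmul_eq_mul]
          ring
  have hN2 : (1 : ℝ) ≤ (N : ℝ) ^ 2 := one_le_pow₀ hN'
  have habs := abs_le.1 ht2
  have hε1 : ε ≤ 1 := min_le_left _ _
  have hε2 : ε ≤ c / 32 := min_le_right _ _
  have hεpi : ε * Real.pi ≤ c / 8 := by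
    have := Real.pi_le_four
    nlinarith
  have hεpi' : ε * Real.pi ≤ Real.pi := mul_le_of_le_one_left hpi.le hε1
  have hc' : c ≤ 2 * K ^ 2 * Real.pi := by
    have := hdl'.trans hdu
    nlinarith
  have hcN : c ≤ c * (N : ℝ) ^ 2 := le_mul_of_one_le_right hc.le hN2
  have hKpos : 0 ≤ 8 * (401 * K ^ 4 * 2 * Real.pi + 1) + 8 * Real.pi := by positivity
  have hKpos' : 0 ≤ 6 * K ^ 2 * Real.pi := by positivity
  refine ⟨by linarith, ?_, ?_, fun η => ?_⟩
  · calc ∫ η, g η ^ 2 ≤ 6 * K ^ 2 * Real.pi * (N : ℝ) ^ 2 := by nlinarith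
      _ ≤ _ := mul_le_mul_of_nonneg_right (by linarith) (by positivity)
  · have hres : (Finset.univ.filter fun q : Fin N × Fin N × Fin N × Fin N =>
        v q.1 - v q.2.1 + v q.2.2.1 - v q.2.2.2 = 0) = resonances N := by
      ext q
      simp only [resonances, Finset.mem_filter, hv]
    -- The resonance count N^{5/2} meets ∫ bump = 2πN, which produces N^{7/2}.
    rw [hres, integral_bump] at ht4
    have h52 := card_resonances_le hN
    have h72 : (N : ℝ) ^ (7 / 2 : ℝ) = (N : ℝ) ^ (5 / 2 : ℝ) * N := by
      rw [← Real.rpow_add_one (by positivity)]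
      norm_num
    have h72' : 1 ≤ (N : ℝ) ^ (7 / 2 : ℝ) := Real.one_le_rpow hN' (by norm_num)
    have h1 : (resonances N).card * (K ^ 4 * (2 * Real.pi * N)) ≤
        401 * K ^ 4 * 2 * Real.pi * (N : ℝ) ^ (7 / 2 : ℝ) := by
      calc _ ≤ 401 * (N : ℝ) ^ (5 / 2 : ℝ) * (K ^ 4 * (2 * Real.pi * N)) := by gcongr
        _ = _ := by rw [h72]; ring
    calc ∫ η, g η ^ 4 ≤ 8 * (401 * K ^ 4 * 2 * Real.pi * (N : ℝ) ^ (7 / 2 : ℝ) + 1) +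
          8 * Real.pi := by linarith
      _ ≤ (8 * (401 * K ^ 4 * 2 * Real.pi + 1) + 8 * Real.pi) * (N : ℝ) ^ (7 / 2 : ℝ) := by
        nlinarith
      _ ≤ _ := mul_le_mul_of_nonneg_right (by linarith) (by positivity)
  · have h1 : F η ≤ N * (K * 1) :=
      (hFb η).trans (by gcongr; exact bump_le_one N η)
    have h2 := hgle η
    have h3 := hr1 η
    calc g η ≤ (K + 1) * N := by linarith
      _ ≤ _ := mul_le_mul_of_nonneg_right (by linarith) (by positivity)

end MKdV

namespace MKdV

open Set Filter Topology
open scoped ContDiff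

/-! ### Interpolation between moments -/

section interpolation

variable {g : ℝ → ℝ} {c K N p : ℝ}

/-- Below the threshold A the quadratic term suffices, above it the quartic one. -/
lemma rpow_le_add_of_le_four {y A : ℝ} (hy : 0 ≤ y) (hA : 0 < A) (hp2 : 2 ≤ p) (hp4 : p ≤ 4) :
    y ^ p ≤ A ^ (p - 2) * y ^ 2 + A ^ (p - 4) * y ^ 4 := by
  have h2 : 0 ≤ A ^ (p - 2) * y ^ 2 := by positivity
  have h4 : 0 ≤ A ^ (p - 4) * y ^ 4 := by positivity
  rcases le_or_gt y A with h | h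
  · have : y ^ p = y ^ (p - 2) * y ^ 2 := by
      rw [← Real.rpow_natCast y 2, ← Real.rpow_add_of_nonneg hy (by linarith) (by norm_num)]
      norm_num
    rw [this]
    have := mul_le_mul_of_nonneg_right (Real.rpow_le_rpow hy h (by linarith : 0 ≤ p - 2))
      (sq_nonneg y)
    linarith
  · have hy' : 0 < y := hA.trans h
    have : y ^ p = y ^ (p - 4) * y ^ 4 := by
      rw [← Real.rpow_natCast y 4, ← Real.rpow_add hy']
      norm_num
    rw [this]
    have := mul_le_mul_of_nonneg_right
      (Real.rpow_le_rpow_of_nonpos hA h.le (by linarith : p - 4 ≤ 0)) (pow_nonneg hy 4)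
    linarith

lemma sq_le_add_of_le_two {y A : ℝ} (hy : 0 ≤ y) (hA : 0 < A) (hp1 : 1 ≤ p) (hp2 : p ≤ 2) :
    y ^ 2 ≤ A ^ (2 - p) * y ^ p + (A ^ 2)⁻¹ * y ^ 4 := by
  have h2 : 0 ≤ A ^ (2 - p) * y ^ p := by positivity
  have h4 : 0 ≤ (A ^ 2)⁻¹ * y ^ 4 := by positivity
  rcases le_or_gt y A with h | h
  · have : y ^ 2 = y ^ (2 - p) * y ^ p := by
      rw [← Real.rpow_natCast y 2, ← Real.rpow_add_of_nonneg hy (by linarith) (by linarith)]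
      norm_num
    rw [this]
    have := mul_le_mul_of_nonneg_right (Real.rpow_le_rpow hy h (by linarith : 0 ≤ 2 - p))
      (Real.rpow_nonneg hy p)
    linarith
  · have : y ^ 2 ≤ (A ^ 2)⁻¹ * y ^ 4 := by
      rw [inv_mul_eq_div, le_div_iff₀ (by positivity)]
      have := mul_le_mul_of_nonneg_left (pow_le_pow_left₀ hA.le h.le 2) (sq_nonneg y)
      calc y ^ 2 * A ^ 2 ≤ y ^ 2 * y ^ 2 := this
        _ = y ^ 4 := by ring
    linarith

lemma integral_rpow_le_of_le_four (hg : ∀ x, 0 ≤ g x) (hK : 1 ≤ K) (hN : 1 ≤ N) (hp2 : 2 < p) (hp4 : p ≤ 4)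
    (i2 : Integrable fun x => g x ^ 2) (i4 : Integrable fun x => g x ^ 4)
    (h2 : ∫ x, g x ^ 2 ≤ K * N ^ 2) (h4 : ∫ x, g x ^ 4 ≤ K * N ^ (7 / 2 : ℝ)) :
    (∫ x, g x ^ p) ^ (1 / p) ≤ (2 * K) ^ (1 / p) * N ^ (1 - (p - 2) / (4 * p)) := by
  have hN0 : 0 < N := by linarith
  have hp0 : 0 < p := by linarith
  -- This threshold balances the two terms: A² is the quotient of N^{7/2} by N².
  set A := N ^ (3 / 4 : ℝ) with hA
  have hA0 : 0 < A := by positivity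
  have key : ∫ x, g x ^ p ≤ 2 * K * N ^ (3 * p / 4 + 1 / 2) := by
    calc ∫ x, g x ^ p ≤ ∫ x, (A ^ (p - 2) * g x ^ 2 + A ^ (p - 4) * g x ^ 4) :=
          integral_mono_of_nonneg (Eventually.of_forall fun x => Real.rpow_nonneg (hg x) p)
            ((i2.const_mul _).add (i4.const_mul _))
            (Eventually.of_forall fun x => rpow_le_add_of_le_four (hg x) hA0 hp2.le hp4)
      _ = A ^ (p - 2) * (∫ x, g x ^ 2) + A ^ (p - 4) * ∫ x, g x ^ 4 := by
          rw [integral_add (i2.const_mul _) (i4.const_mul _), integral_const_mul,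
            integral_const_mul]
      _ ≤ A ^ (p - 2) * (K * N ^ 2) + A ^ (p - 4) * (K * N ^ (7 / 2 : ℝ)) := by gcongr
      _ = K * (A ^ (p - 2) * N ^ (2 : ℝ)) + K * (A ^ (p - 4) * N ^ (7 / 2 : ℝ)) := by
          rw [Real.rpow_two]
          ring
      _ = 2 * K * N ^ (3 * p / 4 + 1 / 2) := by
          rw [hA, ← Real.rpow_mul hN0.le, ← Real.rpow_mul hN0.le, ← Real.rpow_add hN0,
            ← Real.rpow_add hN0, show 3 / 4 * (p - 2) + 2 = 3 * p / 4 + 1 / 2 by ring,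
            show 3 / 4 * (p - 4) + 7 / 2 = 3 * p / 4 + 1 / 2 by ring]
          ring
  refine (Real.rpow_le_rpow (integral_nonneg fun x => Real.rpow_nonneg (hg x) p) key
    (by positivity)).trans_eq ?_
  rw [Real.mul_rpow (by linarith) (by positivity), ← Real.rpow_mul hN0.le]
  congr 2
  field_simp
  ring

/-- The extra p - 4 powers are bounded pointwise; the fourth moment supplies the saving N^{-1/2}
against N^p. -/
lemma integral_rpow_le_of_four_le (hg : ∀ x, 0 ≤ g x) (hK : 1 ≤ K) (hN : 1 ≤ N) (hp4 : 4 ≤ p)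
    (i4 : Integrable fun x => g x ^ 4)
    (h4 : ∫ x, g x ^ 4 ≤ K * N ^ (7 / 2 : ℝ)) (hs : ∀ x, g x ≤ K * N) :
    (∫ x, g x ^ p) ^ (1 / p) ≤ (K ^ (p - 3)) ^ (1 / p) * N ^ (1 - 1 / (2 * p)) := by
  have hN0 : 0 < N := by linarith
  have hK0 : 0 < K := by linarith
  have hp0 : 0 < p := by linarith
  have key : ∫ x, g x ^ p ≤ K ^ (p - 3) * N ^ (p - 1 / 2) := by
    calc ∫ x, g x ^ p ≤ ∫ x, (K * N) ^ (p - 4) * g x ^ 4 := by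
          refine integral_mono_of_nonneg (Eventually.of_forall fun x => Real.rpow_nonneg (hg x) p)
            (i4.const_mul _) (Eventually.of_forall fun x => ?_)
          have : g x ^ p = g x ^ (p - 4) * g x ^ 4 := by
            rw [← Real.rpow_natCast (g x) 4,
              ← Real.rpow_add_of_nonneg (hg x) (by linarith) (by norm_num)]
            norm_num
          simp only [this]
          exact mul_le_mul_of_nonneg_right (Real.rpow_le_rpow (hg x) (hs x) (by linarith))
            (pow_nonneg (hg x) 4)
      _ = (K * N) ^ (p - 4) * ∫ x, g x ^ 4 := integral_const_mul _ _
      _ ≤ (K * N) ^ (p - 4) * (K * N ^ (7 / 2 : ℝ)) := by gcongr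
      _ = (K ^ (p - 4) * K ^ (1 : ℝ)) * (N ^ (p - 4) * N ^ (7 / 2 : ℝ)) := by
          rw [Real.mul_rpow hK0.le hN0.le, Real.rpow_one]
          ring
      _ = K ^ (p - 3) * N ^ (p - 1 / 2) := by
          rw [← Real.rpow_add hK0, ← Real.rpow_add hN0]
          congr 2 <;> ring
  refine (Real.rpow_le_rpow (integral_nonneg fun x => Real.rpow_nonneg (hg x) p) key
    (by positivity)).trans_eq ?_
  rw [Real.mul_rpow (by positivity) (by positivity), ← Real.rpow_mul hN0.le]
  congr 2
  field_simp

/-- A moderate fourth moment prevents the L² mass from sitting where g is large, and mass carried by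
values g ≤ A forces a large L^p norm. -/
lemma le_integral_rpow_of_lt_two (hg : ∀ x, 0 ≤ g x) (hc : 0 < c) (hK : 1 ≤ K) (hN : 1 ≤ N)
    (hp1 : 1 ≤ p) (hp2 : p < 2)
    (ip : Integrable fun x => g x ^ p) (i4 : Integrable fun x => g x ^ 4)
    (h2 : c * N ^ 2 ≤ ∫ x, g x ^ 2) (h4 : ∫ x, g x ^ 4 ≤ K * N ^ (7 / 2 : ℝ)) :
    (c / 2 * Real.sqrt (2 * K / c) ^ (p - 2)) ^ (1 / p) * N ^ (1 + (2 - p) / (4 * p)) ≤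
      (∫ x, g x ^ p) ^ (1 / p) := by
  have hN0 : 0 < N := by linarith
  have hK0 : 0 < K := by linarith
  have hp0 : 0 < p := by linarith
  -- With this factor in A, the quartic term is at most half of the lower bound cN² and can be
  -- absorbed.
  set M := Real.sqrt (2 * K / c) with hM
  have hM0 : 0 < M := Real.sqrt_pos.2 (by positivity)
  have hM2 : M ^ 2 = 2 * K / c := Real.sq_sqrt (by positivity)
  set A := M * N ^ (3 / 4 : ℝ) with hA
  have hA0 : 0 < A := by positivity
  have hA2 : A ^ 2 = 2 * K / c * N ^ (3 / 2 : ℝ) := by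
    rw [hA, mul_pow, hM2, ← Real.rpow_natCast (N ^ (3 / 4 : ℝ)), ← Real.rpow_mul hN0.le]
    norm_num
  have h1 : ∫ x, g x ^ 2 ≤ A ^ (2 - p) * (∫ x, g x ^ p) + (A ^ 2)⁻¹ * ∫ x, g x ^ 4 := by
    rw [← integral_const_mul, ← integral_const_mul,
      ← integral_add (ip.const_mul _) (i4.const_mul _)]
    exact integral_mono_of_nonneg (Eventually.of_forall fun x => sq_nonneg _)
      ((ip.const_mul _).add (i4.const_mul _))
      (Eventually.of_forall fun x => sq_le_add_of_le_two (hg x) hA0 hp1 hp2.le)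
  have h3 : (A ^ 2)⁻¹ * ∫ x, g x ^ 4 ≤ c / 2 * N ^ 2 := by
    rw [inv_mul_eq_div, div_le_iff₀ (by positivity)]
    refine h4.trans_eq ?_
    rw [hA2, show (7 / 2 : ℝ) = 2 + 3 / 2 by norm_num, Real.rpow_add hN0, Real.rpow_two]
    field_simp
  have h5 : c / 2 * N ^ 2 ≤ A ^ (2 - p) * ∫ x, g x ^ p := by linarith
  have key : c / 2 * M ^ (p - 2) * N ^ (3 * p / 4 + 1 / 2) ≤ ∫ x, g x ^ p := by
    have h6 : A ^ (p - 2) * (c / 2 * N ^ 2) ≤ ∫ x, g x ^ p := by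
      calc A ^ (p - 2) * (c / 2 * N ^ 2) ≤ A ^ (p - 2) * (A ^ (2 - p) * ∫ x, g x ^ p) := by gcongr
        _ = ∫ x, g x ^ p := by
          rw [← mul_assoc, ← Real.rpow_add hA0]
          simp
    refine le_trans (le_of_eq ?_) h6
    rw [hA, Real.mul_rpow hM0.le (by positivity), ← Real.rpow_mul hN0.le,
      show 3 * p / 4 + 1 / 2 = 3 / 4 * (p - 2) + 2 by ring, Real.rpow_add hN0, Real.rpow_two]
    ring
  refine le_trans (le_of_eq ?_) (Real.rpow_le_rpow (by positivity) key (by positivity))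
  rw [Real.mul_rpow (y := N ^ (3 * p / 4 + 1 / 2)) (by positivity) (by positivity), ← Real.rpow_mul hN0.le]
  congr 2
  field_simp
  ring

end interpolation

/-! ### Fourier--Lebesgue norms of rescaled functions -/

/-- The modulus of the Fourier transform weighted at frequency scale `lam`. -/
def weightedHat (s lam : ℝ) (f : 𝓢(ℝ, ℝ)) (η : ℝ) : ℝ :=
  japaneseBracket (η / lam) ^ s * ‖fourierHat f η‖

lemma weightedHat_nonneg (s lam : ℝ) (f : 𝓢(ℝ, ℝ)) (η : ℝ) : 0 ≤ weightedHat s lam f η :=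
  mul_nonneg (Real.rpow_nonneg (zero_le_one.trans (one_le_japaneseBracket _)) _) (norm_nonneg _)

lemma continuous_weightedHat (s lam : ℝ) (f : 𝓢(ℝ, ℝ)) : Continuous (weightedHat s lam f) :=
  ((continuous_japaneseBracket_rpow s).comp (continuous_id.div_const lam)).mul
    (continuous_fourierHat f).norm

lemma integrable_weightedHat_rpow (s : ℝ) {lam p : ℝ} (hlam : 1 ≤ lam) (hp : 1 ≤ p) (f : 𝓢(ℝ, ℝ)) :
    Integrable fun η => weightedHat s lam f η ^ p := by
  set n := ⌈|s|⌉₊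
  obtain ⟨C, hC, h⟩ := fourierHat_decay f (n + 1)
  have hb : ∀ η, weightedHat s lam f η ≤ C * (1 + η ^ 2)⁻¹ := by
    intro η
    have h1 : 1 + (η / lam) ^ 2 ≤ 1 + η ^ 2 := by
      simpa using one_add_div_sq_le (x := η) one_pos hlam
    calc weightedHat s lam f η ≤ (1 + η ^ 2) ^ n * (C / (1 + η ^ 2) ^ (n + 1)) :=
          mul_le_mul ((japaneseBracket_rpow_le s _).trans (pow_le_pow_left₀ (by positivity) h1 n))
            (h η) (norm_nonneg _) (by positivity)
      _ = _ := by
          have : (1 + η ^ 2) ≠ 0 := by positivity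
          field_simp
          ring
  refine (integrable_inv_one_add_sq.const_mul (C ^ p)).mono'
    ((continuous_weightedHat s lam f).rpow_const fun _ => Or.inr (by linarith)).aestronglyMeasurable
    (Eventually.of_forall fun η => ?_)
  have h0 := weightedHat_nonneg s lam f η
  rw [Real.norm_of_nonneg (Real.rpow_nonneg h0 p)]
  have h1 : (1 + η ^ 2)⁻¹ ≤ 1 := inv_le_one_of_one_le₀ (by linarith [sq_nonneg η])
  calc weightedHat s lam f η ^ p ≤ (C * (1 + η ^ 2)⁻¹) ^ p :=
        Real.rpow_le_rpow h0 (hb η) (by linarith)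
    _ = C ^ p * ((1 + η ^ 2)⁻¹) ^ p := Real.mul_rpow hC (by positivity)
    _ ≤ C ^ p * ((1 + η ^ 2)⁻¹) ^ (1 : ℝ) :=
        mul_le_mul_of_nonneg_left (Real.rpow_le_rpow_of_exponent_ge (by positivity) h1 hp)
          (by positivity)
    _ = _ := by rw [Real.rpow_one]

lemma integrable_weightedHat_pow (s : ℝ) {lam : ℝ} (hlam : 1 ≤ lam) {k : ℕ} (hk : 1 ≤ k)
    (f : 𝓢(ℝ, ℝ)) : Integrable fun η => weightedHat s lam f η ^ k := by
  simpa only [Real.rpow_natCast] using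
    integrable_weightedHat_rpow s hlam (p := k) (by exact_mod_cast hk) f

lemma fourierHat_rescaled {f h : 𝓢(ℝ, ℝ)} {σ lam : ℝ} (hlam : 0 < lam)
    (hh : ∀ x, h x = σ * lam⁻¹ * f (x / lam)) (ξ : ℝ) :
    fourierHat h ξ = σ * fourierHat f (lam * ξ) := by
  have h1 : (h : ℝ → ℝ) = fun x => σ * (lam⁻¹ * f (lam⁻¹ * x + 0)) := by
    ext x
    rw [hh, add_zero, inv_mul_eq_div lam x]
    ring
  rw [fourierHat_eq_hatFn, h1, hatFn_const_mul,
    hatFn_comp_affine f (inv_pos.2 hlam), fourierHat_eq_hatFn]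
  simp [mul_comm]

/-- The transform of h at ξ is σ times that of f at λξ; the substitution η = λξ moves the scale into
the weight and costs λ^{-1/p}. -/
lemma fourierLebesgueNorm_rescaled {f h : 𝓢(ℝ, ℝ)} {σ lam p : ℝ} (s : ℝ) (hσ : |σ| = 1)
    (hlam : 1 ≤ lam) (hp : 1 ≤ p) (hh : ∀ x, h x = σ * lam⁻¹ * f (x / lam)) :
    fourierLebesgueNorm p s h =
      ENNReal.ofReal ((∫ η, weightedHat s lam f η ^ p) ^ (1 / p) * lam ^ (-(1 / p))) := by
  have hlam0 : 0 < lam := by linarith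
  have hp0 : 0 < p := by linarith
  set G : ℝ → ℂ := fun ξ => ((japaneseBracket ξ ^ s : ℝ) : ℂ) * fourierHat h ξ with hG
  have hn : ∀ ξ, ‖G ξ‖ = weightedHat s lam f (lam * ξ) := by
    intro ξ
    simp only [hG, weightedHat]
    rw [fourierHat_rescaled hlam0 hh, norm_mul, norm_mul, Complex.norm_real, Complex.norm_real,
      Real.norm_eq_abs σ, hσ, one_mul, Real.norm_of_nonneg
      (Real.rpow_nonneg (zero_le_one.trans (one_le_japaneseBracket _)) _),
      mul_div_cancel_left₀ _ hlam0.ne']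
  have hGc : Continuous G := (Complex.continuous_ofReal.comp (continuous_japaneseBracket_rpow s)).mul
    (continuous_fourierHat h)
  have hpt : (ENNReal.ofReal p).toReal = p := ENNReal.toReal_ofReal hp0.le
  have hp0' : ENNReal.ofReal p ≠ 0 := by simpa using hp0
  have hi : Integrable fun ξ => ‖G ξ‖ ^ p := by
    simp only [hn]
    exact (integrable_weightedHat_rpow s hlam hp f).comp_mul_left' hlam0.ne'
  have hmem : MemLp G (ENNReal.ofReal p) := by
    rw [← integrable_norm_rpow_iff hGc.aestronglyMeasurable hp0' ENNReal.ofReal_ne_top, hpt]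
    exact hi
  have hI : ∫ ξ, ‖G ξ‖ ^ p = lam⁻¹ * ∫ η, weightedHat s lam f η ^ p := by
    simp only [hn]
    rw [Measure.integral_comp_mul_left (fun η => weightedHat s lam f η ^ p) lam,
      abs_of_pos (inv_pos.2 hlam0), smul_eq_mul]
  rw [fourierLebesgueNorm, hmem.eLpNorm_eq_integral_rpow_norm hp0' ENNReal.ofReal_ne_top, hpt, hI,
    Real.mul_rpow (inv_nonneg.2 hlam0.le)
      (integral_nonneg fun η => Real.rpow_nonneg (weightedHat_nonneg s lam f η) p),
    Real.inv_rpow hlam0.le, ← Real.rpow_neg hlam0.le, one_div, mul_comm]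

/-! ### The rescaled solution -/

/-- Two symmetries of mKdV are combined: the scaling, and u ↦ -u, available because the nonlinearity
is odd. -/
lemma exists_rescaled_solution {U : ℝ → 𝓢(ℝ, ℝ)} (hU : IsSchwartzSolutionMKdV U) {σ lam : ℝ}
    (hσ : σ ^ 2 = 1) (hlam : 0 < lam) : ∃ u : ℝ → 𝓢(ℝ, ℝ), IsSchwartzSolutionMKdV u ∧
      ∀ t x, u t x = σ * lam⁻¹ * U (t / lam ^ 3) (x / lam) := by
  set L : ℝ ≃L[ℝ] ℝ := ContinuousLinearEquiv.unitsEquivAut ℝ (Units.mk0 lam⁻¹ (inv_ne_zero hlam.ne'))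
  have hL : ∀ x, L x = x / lam := fun x => rfl
  set u : ℝ → 𝓢(ℝ, ℝ) := fun t =>
    (σ * lam⁻¹) • SchwartzMap.compCLMOfContinuousLinearEquiv ℝ L (U (t / lam ^ 3))
  have hu : ∀ t x, u t x = σ * lam⁻¹ * U (t / lam ^ 3) (x / lam) := fun t x => rfl
  refine ⟨u, ⟨?_, fun t x => ?_⟩, hu⟩
  · have h1 : Continuous fun t : ℝ => U (t / lam ^ 3) :=
      hU.continuous.comp (continuous_id.div_const _)
    exact ((SchwartzMap.compCLMOfContinuousLinearEquiv ℝ L).continuous.comp h1).const_smul (σ * lam⁻¹)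
  · have h1 := (hU.equation (t / lam ^ 3) (x / lam)).comp_of_eq t ((hasDerivAt_id t).div_const (lam ^ 3)) rfl
    have h2 := h1.const_mul (σ * lam⁻¹)
    have e : (fun y => u t y) = fun y => σ * lam⁻¹ * U (t / lam ^ 3) (lam⁻¹ * y) := by
      ext y
      rw [hu, inv_mul_eq_div lam y]
    have hs : ∀ n : ℕ, ContDiff ℝ n (fun y => U (t / lam ^ 3) y) := fun n =>
      (U (t / lam ^ 3)).smooth n
    have h3 : ∀ n : ℕ, iteratedDeriv n (fun y => u t y) x =
        σ * lam⁻¹ * ((lam⁻¹) ^ n * iteratedDeriv n (fun y => U (t / lam ^ 3) y) (x / lam)) := by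
      intro n
      rw [e, iteratedDeriv_const_mul_field, iteratedDeriv_comp_const_mul (hs n)]
      simp only [inv_mul_eq_div lam x]
    have h4 := h3 1
    simp only [iteratedDeriv_one, pow_one] at h4
    rw [h3 3, h4, hu]
    refine (h2.congr_deriv ?_)
    have hσ3 : σ ^ 3 = σ := by rw [pow_succ, hσ, one_mul]
    field_simp
    ring_nf
    simp only [hσ3]

end MKdV

namespace MKdV

open Set Filter Topology

/-! ### Conclusion -/

lemma isRescaledSechSolution_of_rescaled {m : ℕ} {lam : ℝ} {U u : ℝ → 𝓢(ℝ, ℝ)}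
    (hU0 : ∀ x, U 0 x = (m + 1) * (1 / Real.cosh x)) (hu : IsSchwartzSolutionMKdV u)
    (huU : ∀ t x, u t x = (-1) ^ (m + 1) * lam⁻¹ * U (t / lam ^ 3) (x / lam)) :
    IsRescaledSechSolution (m + 1) lam u := by
  refine ⟨hu, fun x => ?_⟩
  rw [huU, zero_div, hU0]
  push_cast
  ring

lemma neg_one_pow_sq (n : ℕ) : (((-1 : ℝ)) ^ n) ^ 2 = 1 := by
  rw [← pow_mul, mul_comm, pow_mul]
  simp

lemma eq_rescaled_of_isRescaledSechSolution {m : ℕ} {lam : ℝ} (hlam : 0 < lam) {U u : ℝ → 𝓢(ℝ, ℝ)}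
    (hU : IsSchwartzSolutionMKdV U) (hU0 : ∀ x, U 0 x = (m + 1) * (1 / Real.cosh x))
    (hu : IsRescaledSechSolution (m + 1) lam u) (t x : ℝ) :
    u t x = (-1) ^ (m + 1) * lam⁻¹ * U (t / lam ^ 3) (x / lam) := by
  obtain ⟨v, hv, hvU⟩ := exists_rescaled_solution hU (neg_one_pow_sq (m + 1)) hlam
  have : u = v := schwartz_solution_unique hu.1 hv fun x => by
    rw [hu.2, (isRescaledSechSolution_of_rescaled hU0 hv hvU).2]
  rw [this, hvU]

theorem existsUnique_isRescaledSechSolution {N : ℕ} {lam : ℝ} (hN : 1 ≤ N) (hlam : (N : ℝ) ≤ lam) :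
    ∃! u : ℝ → 𝓢(ℝ, ℝ), IsRescaledSechSolution N lam u := by
  have hlam0 : 0 < lam := lt_of_lt_of_le (by exact_mod_cast hN) hlam
  obtain ⟨m, rfl⟩ := Nat.exists_eq_add_of_le' hN
  obtain ⟨U, hU, hU0, -⟩ := exists_sechSolution m
  obtain ⟨u, hu, huU⟩ := exists_rescaled_solution hU (neg_one_pow_sq (m + 1)) hlam0
  refine ⟨u, isRescaledSechSolution_of_rescaled hU0 hu huU, fun v hv => ?_⟩
  exact schwartz_solution_unique hv.1 hu fun x => by
    rw [hv.2, (isRescaledSechSolution_of_rescaled hU0 hu huU).2]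

lemma integral_weightedHat_sech_rpow_pos (s : ℝ) {lam p : ℝ} (hlam : 1 ≤ lam) (hp : 1 ≤ p) :
    0 < ∫ η, weightedHat s lam sech η ^ p := by
  have hc : Continuous fun η => weightedHat s lam sech η ^ p :=
    (continuous_weightedHat s lam sech).rpow_const fun _ => Or.inr (by linarith)
  refine (integral_pos_iff_support_of_nonneg
    (fun η => Real.rpow_nonneg (weightedHat_nonneg s lam sech η) p)
    (integrable_weightedHat_rpow s hlam hp sech)).2 ?_
  refine hc.isOpen_support.measure_pos _ ⟨0, ?_⟩
  have : 0 < weightedHat s lam sech 0 :=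
    mul_pos (Real.rpow_pos_of_pos (by linarith [one_le_japaneseBracket (0 / lam)]) s)
      (norm_pos_iff.2 fourierHat_sech_zero_ne)
  exact (Real.rpow_pos_of_pos this p).ne'

lemma japaneseBracket_mono {x y : ℝ} (h : x ^ 2 ≤ y ^ 2) : japaneseBracket x ≤ japaneseBracket y :=
  Real.sqrt_le_sqrt (by linarith)

/-- From 1 ≤ ⟨η/λ⟩ ≤ ⟨η⟩ the weight is trapped between ⟨η⟩^{-|s|} and ⟨η⟩^{|s|}, which do not
involve λ. -/
lemma weightedHat_sech_bounds (s : ℝ) {lam : ℝ} (hlam : 1 ≤ lam) (η : ℝ) :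
    weightedHat (-|s|) 1 sech η ≤ weightedHat s lam sech η ∧
      weightedHat s lam sech η ≤ weightedHat |s| 1 sech η := by
  have h1 := one_le_japaneseBracket (η / lam)
  have h2 : japaneseBracket (η / lam) ≤ japaneseBracket (η / 1) := by
    refine japaneseBracket_mono ?_
    have := one_add_div_sq_le (x := η) one_pos hlam
    linarith
  have h0 := norm_nonneg (fourierHat sech η)
  constructor <;> refine mul_le_mul_of_nonneg_right ?_ h0
  · exact (Real.rpow_le_rpow_of_nonpos (by linarith) h2 (by simp)).trans
      (Real.rpow_le_rpow_of_exponent_le h1 (neg_abs_le s))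
  · exact (Real.rpow_le_rpow_of_exponent_le h1 (le_abs_self s)).trans
      (Real.rpow_le_rpow (by linarith) h2 (abs_nonneg s))

/-- Before rescaling, the initial transform is exactly N times that of sech, so beyond the explicit
factors only the weight depends on λ. -/
theorem initial_norm_bounds {p : ℝ} (s : ℝ) (hp : 1 ≤ p) : ∃ c C : ℝ, 0 < c ∧ 0 < C ∧
    ∀ (N : ℕ) (lam : ℝ), 1 ≤ N → (N : ℝ) ≤ lam →
    ∀ u : ℝ → 𝓢(ℝ, ℝ), IsRescaledSechSolution N lam u →
      ENNReal.ofReal (c * ((N : ℝ) * lam ^ (-(1 / p)))) ≤ fourierLebesgueNorm p s (u 0) ∧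
      fourierLebesgueNorm p s (u 0) ≤ ENNReal.ofReal (C * ((N : ℝ) * lam ^ (-(1 / p)))) := by
  have hp0 : 0 < p := by linarith
  refine ⟨(∫ η, weightedHat (-|s|) 1 sech η ^ p) ^ (1 / p),
    (∫ η, weightedHat |s| 1 sech η ^ p) ^ (1 / p),
    Real.rpow_pos_of_pos (integral_weightedHat_sech_rpow_pos _ le_rfl hp) _,
    Real.rpow_pos_of_pos (integral_weightedHat_sech_rpow_pos _ le_rfl hp) _,
    fun N lam hN hlam u hu => ?_⟩
  have hN' : (1 : ℝ) ≤ N := by exact_mod_cast hN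
  have hlam1 : 1 ≤ lam := hN'.trans hlam
  have hpow : 0 ≤ lam ^ (-(1 / p)) := Real.rpow_nonneg (by linarith) _
  obtain ⟨m, rfl⟩ := Nat.exists_eq_add_of_le' hN
  obtain ⟨U, hU, hU0, -⟩ := exists_sechSolution m
  have h1 : ∀ x, u 0 x = (-1) ^ (m + 1) * lam⁻¹ * U 0 (x / lam) := fun x => by
    rw [eq_rescaled_of_isRescaledSechSolution (by linarith) hU hU0 hu, zero_div]
  have h2 : ∀ η, weightedHat s lam (U 0) η = ((m + 1 : ℕ) : ℝ) * weightedHat s lam sech η := by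
    intro η
    have e : (U 0 : ℝ → ℝ) = fun x => ((m + 1 : ℕ) : ℝ) * sech x := by
      ext x
      rw [hU0, sech_apply]
      push_cast
      ring
    rw [weightedHat, fourierHat_eq_hatFn, e, hatFn_const_mul, norm_mul, ← fourierHat_eq_hatFn,
      weightedHat, Complex.norm_real, Real.norm_of_nonneg (by positivity)]
    ring
  have h3 : (∫ η, weightedHat s lam (U 0) η ^ p) ^ (1 / p) =
      ((m + 1 : ℕ) : ℝ) * (∫ η, weightedHat s lam sech η ^ p) ^ (1 / p) := by
    simp only [h2, Real.mul_rpow (Nat.cast_nonneg (m + 1)) (weightedHat_nonneg s lam sech _)]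
    rw [integral_const_mul, Real.mul_rpow (by positivity)
      (integral_nonneg fun η => Real.rpow_nonneg (weightedHat_nonneg s lam sech η) p),
      ← Real.rpow_mul (by positivity), mul_one_div_cancel hp0.ne', Real.rpow_one]
  rw [fourierLebesgueNorm_rescaled s (by simp) hlam1 hp h1, h3]
  have hn : ∀ s' lam', 0 ≤ ∫ η, weightedHat s' lam' sech η ^ p := fun s' lam' =>
    integral_nonneg fun η => Real.rpow_nonneg (weightedHat_nonneg s' lam' sech η) p
  have hi : ∀ s', Integrable fun η => weightedHat s' 1 sech η ^ p := fun s' =>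
    integrable_weightedHat_rpow s' le_rfl hp sech
  have hi' := integrable_weightedHat_rpow s hlam1 hp sech
  have lo : (∫ η, weightedHat (-|s|) 1 sech η ^ p) ^ (1 / p) ≤
      (∫ η, weightedHat s lam sech η ^ p) ^ (1 / p) :=
    Real.rpow_le_rpow (hn _ _) (integral_mono (hi _) hi' fun η => Real.rpow_le_rpow
      (weightedHat_nonneg _ _ _ _) (weightedHat_sech_bounds s hlam1 η).1 hp0.le) (by positivity)
  have up : (∫ η, weightedHat s lam sech η ^ p) ^ (1 / p) ≤
      (∫ η, weightedHat |s| 1 sech η ^ p) ^ (1 / p) :=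
    Real.rpow_le_rpow (hn _ _) (integral_mono hi' (hi _) fun η => Real.rpow_le_rpow
      (weightedHat_nonneg _ _ _ _) (weightedHat_sech_bounds s hlam1 η).2 hp0.le) (by positivity)
  constructor <;> refine ENNReal.ofReal_le_ofReal ?_ <;> rw [mul_left_comm, ← mul_assoc] <;>
    gcongr

/-- At a suitable time the moments of the weighted Fourier transform are those of a superposition
of solitons in random position, and they control the Fourier--Lebesgue norms. -/
theorem exists_time_norm_eq (s : ℝ) : ∃ c K : ℝ, 0 < c ∧ 1 ≤ K ∧
    ∀ (N : ℕ) (lam : ℝ), 1 ≤ N → (N : ℝ) ≤ lam →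
    ∀ u : ℝ → 𝓢(ℝ, ℝ), IsRescaledSechSolution N lam u →
      ∃ (t : ℝ) (f : 𝓢(ℝ, ℝ)), 0 < t ∧
        (∀ p, 1 ≤ p → fourierLebesgueNorm p s (u t) =
          ENNReal.ofReal ((∫ η, weightedHat s lam f η ^ p) ^ (1 / p) * lam ^ (-(1 / p)))) ∧
        c * (N : ℝ) ^ 2 ≤ ∫ η, weightedHat s lam f η ^ 2 ∧
        ∫ η, weightedHat s lam f η ^ 2 ≤ K * (N : ℝ) ^ 2 ∧
        ∫ η, weightedHat s lam f η ^ 4 ≤ K * (N : ℝ) ^ (7 / 2 : ℝ) ∧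
        ∀ η, weightedHat s lam f η ≤ K * N := by
  obtain ⟨c, K, hc, hK, H⟩ := exists_time_moments s
  refine ⟨c, K, hc, hK, fun N lam hN hlam u hu => ?_⟩
  have hN' : (1 : ℝ) ≤ N := by exact_mod_cast hN
  have hlam1 : 1 ≤ lam := hN'.trans hlam
  have hlam0 : 0 < lam := by linarith
  obtain ⟨m, rfl⟩ := Nat.exists_eq_add_of_le' hN
  obtain ⟨U, hU, hU0, hUc⟩ := exists_sechSolution m
  obtain ⟨t, ht, h⟩ := H m lam hlam U hUc
  -- The factor λ³ undoes the time scaling of the solution.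
  refine ⟨lam ^ 3 * t, U t, by positivity, fun p hp => ?_, h⟩
  refine fourierLebesgueNorm_rescaled s (σ := (-1) ^ (m + 1)) (by simp) hlam1 hp fun x => ?_
  rw [eq_rescaled_of_isRescaledSechSolution hlam0 hU hU0 hu, mul_div_cancel_left₀ _ (by positivity)]

/-- The exponent is (p - 2)/(4p) up to p = 4 and 1/(2p) beyond; both equal 1/8 at p = 4. The
parameter s enters only the constants. -/
theorem exists_time_small_norm {p : ℝ} (hp : 2 < p) : ∃ α : ℝ, 0 < α ∧ ∀ s : ℝ, ∃ C : ℝ, 0 < C ∧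
    ∀ (N : ℕ) (lam : ℝ), 1 ≤ N → (N : ℝ) ≤ lam →
    ∀ u : ℝ → 𝓢(ℝ, ℝ), IsRescaledSechSolution N lam u →
      ∃ t : ℝ, 0 < t ∧ fourierLebesgueNorm p s (u t) ≤
        ENNReal.ofReal (C * ((N : ℝ) ^ (1 - α) * lam ^ (-(1 / p)))) := by
  rcases le_total p 4 with hp4 | hp4
  · refine ⟨(p - 2) / (4 * p), div_pos (by linarith) (by linarith), fun s => ?_⟩
    obtain ⟨c, K, hc, hK, H⟩ := exists_time_norm_eq s
    refine ⟨(2 * K) ^ (1 / p), by positivity, fun N lam hN hlam u hu => ?_⟩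
    have hN' : (1 : ℝ) ≤ N := by exact_mod_cast hN
    have hlam1 : 1 ≤ lam := hN'.trans hlam
    obtain ⟨t, f, ht, hnorm, -, h2, h4, -⟩ := H N lam hN hlam u hu
    refine ⟨t, ht, ?_⟩
    rw [hnorm p (by linarith), ← mul_assoc]
    refine ENNReal.ofReal_le_ofReal (mul_le_mul_of_nonneg_right ?_ (by positivity))
    exact integral_rpow_le_of_le_four (weightedHat_nonneg s lam f) hK hN' hp hp4
      (integrable_weightedHat_pow s hlam1 (by norm_num) f)
      (integrable_weightedHat_pow s hlam1 (by norm_num) f) h2 h4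
  · refine ⟨1 / (2 * p), by positivity, fun s => ?_⟩
    obtain ⟨c, K, hc, hK, H⟩ := exists_time_norm_eq s
    refine ⟨(K ^ (p - 3)) ^ (1 / p), by positivity, fun N lam hN hlam u hu => ?_⟩
    have hN' : (1 : ℝ) ≤ N := by exact_mod_cast hN
    have hlam1 : 1 ≤ lam := hN'.trans hlam
    obtain ⟨t, f, ht, hnorm, -, -, h4, hsup⟩ := H N lam hN hlam u hu
    refine ⟨t, ht, ?_⟩
    rw [hnorm p (by linarith), ← mul_assoc]
    refine ENNReal.ofReal_le_ofReal (mul_le_mul_of_nonneg_right ?_ (by positivity))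
    exact integral_rpow_le_of_four_le (weightedHat_nonneg s lam f) hK hN' hp4
      (integrable_weightedHat_pow s hlam1 (by norm_num) f) h4 hsup

theorem exists_time_large_norm {p : ℝ} (hp1 : 1 ≤ p) (hp2 : p < 2) :
    ∃ α : ℝ, 0 < α ∧ ∀ s : ℝ, ∃ c : ℝ, 0 < c ∧
      ∀ (N : ℕ) (lam : ℝ), 1 ≤ N → (N : ℝ) ≤ lam →
      ∀ u : ℝ → 𝓢(ℝ, ℝ), IsRescaledSechSolution N lam u →
        ∃ t : ℝ, 0 < t ∧
          ENNReal.ofReal (c * ((N : ℝ) ^ (1 + α) * lam ^ (-(1 / p)))) ≤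
            fourierLebesgueNorm p s (u t) := by
  refine ⟨(2 - p) / (4 * p), div_pos (by linarith) (by linarith), fun s => ?_⟩
  obtain ⟨c, K, hc, hK, H⟩ := exists_time_norm_eq s
  refine ⟨(c / 2 * Real.sqrt (2 * K / c) ^ (p - 2)) ^ (1 / p), by positivity,
    fun N lam hN hlam u hu => ?_⟩
  have hN' : (1 : ℝ) ≤ N := by exact_mod_cast hN
  have hlam1 : 1 ≤ lam := hN'.trans hlam
  obtain ⟨t, f, ht, hnorm, h2, -, h4, -⟩ := H N lam hN hlam u hu
  refine ⟨t, ht, ?_⟩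
  rw [hnorm p hp1, ← mul_assoc]
  refine ENNReal.ofReal_le_ofReal (mul_le_mul_of_nonneg_right ?_ (by positivity))
  exact le_integral_rpow_of_lt_two (weightedHat_nonneg s lam f) hc hK hN' hp1 hp2
    (integrable_weightedHat_rpow s hlam1 hp1 f)
    (integrable_weightedHat_pow s hlam1 (by norm_num) f) h2 h4

end MKdV

end

theorem proposition4p1 :
    -- the solution with the prescribed data exists and is unique
    (∀ (N : ℕ) (lam : ℝ), 1 ≤ N → (N : ℝ) ≤ lam →
      ∃! u : ℝ → 𝓢(ℝ, ℝ), IsRescaledSechSolution N lam u) ∧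
    -- size of the initial data
    (∀ p s : ℝ, 1 ≤ p → ∃ c C : ℝ, 0 < c ∧ 0 < C ∧
      ∀ (N : ℕ) (lam : ℝ), 1 ≤ N → (N : ℝ) ≤ lam →
      ∀ u : ℝ → 𝓢(ℝ, ℝ), IsRescaledSechSolution N lam u →
        ENNReal.ofReal (c * ((N : ℝ) * lam ^ (-(1 / p)))) ≤ fourierLebesgueNorm p s (u 0) ∧
        fourierLebesgueNorm p s (u 0) ≤ ENNReal.ofReal (C * ((N : ℝ) * lam ^ (-(1 / p))))) ∧
    -- a small norm at a later time, for `2 < p < ∞`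
    (∀ p : ℝ, 2 < p → ∃ α : ℝ, 0 < α ∧ ∀ s : ℝ, ∃ C : ℝ, 0 < C ∧
      ∀ (N : ℕ) (lam : ℝ), 1 ≤ N → (N : ℝ) ≤ lam →
      ∀ u : ℝ → 𝓢(ℝ, ℝ), IsRescaledSechSolution N lam u →
        ∃ t : ℝ, 0 < t ∧ fourierLebesgueNorm p s (u t) ≤
          ENNReal.ofReal (C * ((N : ℝ) ^ (1 - α) * lam ^ (-(1 / p))))) ∧
    -- a large norm at a later time, for `1 ≤ p < 2`
    (∀ p : ℝ, 1 ≤ p → p < 2 → ∃ α : ℝ, 0 < α ∧ ∀ s : ℝ, ∃ c : ℝ, 0 < c ∧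
      ∀ (N : ℕ) (lam : ℝ), 1 ≤ N → (N : ℝ) ≤ lam →
      ∀ u : ℝ → 𝓢(ℝ, ℝ), IsRescaledSechSolution N lam u →
        ∃ t : ℝ, 0 < t ∧
          ENNReal.ofReal (c * ((N : ℝ) ^ (1 + α) * lam ^ (-(1 / p)))) ≤
            fourierLebesgueNorm p s (u t)) := by
  refine ⟨fun N lam hN hlam => MKdV.existsUnique_isRescaledSechSolution hN hlam,
    fun p s hp => MKdV.initial_norm_bounds s hp, fun p hp => MKdV.exists_time_small_norm hp,
    fun p hp1 hp2 => MKdV.exists_time_large_norm hp1 hp2⟩
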